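/- Let $\lambda,c,s>0$, $p,q\ge 0$, $p+q=1$, and let $F$ be a probability distribution on $(-\infty,0)$. Let $\xi(t)=\sum_{k\le\nu(t)}\xi_k$ be a compound Poisson process, where $\nu$ is a Poisson process of rate $\lambda$ and the jumps $\xi_k$ are i.i.d., independent of $\nu$, with law $qF+p\,\mathrm{Exp}(c)$, that is, $\mathrm P\{\xi_k<x\}=qF(x)$ for $x\le 0$ and $=1-pe^{-cx}$ for $x>0$. Let $\theta_s$ be exponential with $\mathrm P\{\theta_s>t\}=e^{-st}$, independent of $\xi$. For $0<x<T$ put $$\tau=\tau(x,T)=\inf\{t>0:\xi(t)\notin(x-T,x)\},\qquad A_+=\{\tau<\infty,\ \xi(\tau)\ge x\},$$ and, for real $\alpha$, where $\mathrm E[Y,A]=\mathrm E[Y\mathbf 1_A]$, $$Q^T(s,x)=\mathrm E[e^{-s\tau},A_+],\quad V^+(s,\alpha,x,T)=\mathrm E[e^{i\alpha(\xi(\tau)-x)-s\tau},A_+],\quad V_+(s,\alpha,x,T)=\mathrm E[e^{i\alpha\xi(\tau)-s\tau},A_+],$$ $$V(s,\alpha,x,T)=\mathrm E[e^{i\alpha\xi(\theta_s)},\tau>\theta_s],\qquad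 H_s(T,x,z)=\mathrm P\{\xi(\theta_s)<z,\ \tau>\theta_s\}.$$ Let $\xi^{+}(t)=\sup_{0\le u\le t}\xi(u)$, $\xi^{-}(t)=\inf_{0\le u\le t}\xi(u)$, $\varphi_\pm(s,\alpha)=\mathrm E e^{i\alpha\xi^\pm(\theta_s)}$, $p_\pm(s)=\mathrm P\{\xi^\pm(\theta_s)=0\}$, $q_+(s)=1-p_+(s)$, $\rho_+(s)=c\,p_+(s)$, $P_-(s,z)=\mathrm P\{\xi^-(\theta_s)<z\}$; $dP_-(s,\cdot)$ is the law of $\xi^-(\theta_s)$, including its atom at $0$, and $\int_a^0$ is over $(a,0]$. For $g(\alpha)=C+\int_{\mathbb R}e^{i\alpha y}G(y)\,dy$ with $G$ integrable and an interval $I\ni 0$, put $[g(\alpha)]_I=C+\int_I e^{i\alpha y}G(y)\,dy$; more generally, for $g(\alpha)=\int e^{i\alpha y}M(dy)$ with a finite signed measure $M$, put $[g(\alpha)]_I=\int_I e^{i\alpha y}M(dy)$. Then: (i) For all real $\alpha$, $$V^+(s,\alpha,x,T)=\frac{c}{c-i\alpha}Q^T(s,x),\qquad V_+(s,\alpha,x,T)=e^{i\alpha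 x}V^+(s,\alpha,x,T)=\frac{c\,e^{i\alpha x}}{c-i\alpha}Q^T(s,x).$$ (ii) If $F$ is absolutely continuous, then for all real $\alpha$ $$V(s,\alpha,x,T)=\varphi_+(s,\alpha)\bigl[\varphi_-(s,\alpha)(1-V_+(s,\alpha,x,T))\bigr]_{[x-T,\infty)}=\varphi_+(s,\alpha)\Bigl[\varphi_-(s,\alpha)\Bigl(1-\frac{c\,e^{i\alpha x}}{c-i\alpha}Q^T(s,x)\Bigr)\Bigr]_{[x-T,\infty)};$$ for arbitrary $F$ the same holds with $(x-T,\infty)$ in place of $[x-T,\infty)$. (iii) For $x-T<z<x$, $z\ne 0$, put $$h_s(T,x,z)=\Bigl(p_+(s)P_-'(s,z)-q_+(s)\rho_+(s)\int_z^0e^{\rho_+(s)(y-z)}dP_-(s,y)\Bigr)I\{z<0\}+\rho_+(s)Q^T(s,x)\int_{z-x}^0e^{\rho_+(s)(y-(z-x))}dP_-(s,y).$$ Then $\frac{\partial}{\partial z}H_s(T,x,z)=h_s(T,x,z)$ at each such $z$ for which $P_-(s,\cdot)$ is differentiable at $z$ (if $z<0$), provided that $F$ has no atoms or that $P_-(s,\cdot)$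 is continuous at $z-x$. If $F$ is absolutely continuous, the distribution of $\xi(\theta_s)$ on the event $\{\tau>\theta_s\}$ is the sum of an atom of mass $\frac{s}{s+\lambda}$ at $0$ and of the absolutely continuous measure with density $h_s(T,x,\cdot)$ on $(x-T,x)$. (iv) For arbitrary $F$, $$\mathrm P\{\xi(\theta_s)=0,\ \tau(x,T)>\theta_s\}=\mathrm P\{\xi(\theta_s)=0\}=p_-(s)p_+(s)=\frac{s}{s+\lambda}.$$ -/

import Mathlib

open MeasureTheory ProbabilityTheory Set
open scoped ENNReal

noncomputable section

namespace ExitProblem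

variable {Ω : Type*} [MeasurableSpace Ω]

/-- Law of one jump: negative with law `F` with probability `q`, exponential with parameter `c`
with probability `p`. -/
def jumpLaw (p q c : ℝ) (F : Measure ℝ) : Measure ℝ :=
  ENNReal.ofReal q • F + ENNReal.ofReal p • expMeasure c

/-- The random data of the model: the waiting times `W k` between the jumps of a Poisson process
of rate `lam`, the jumps `X k`, and an exponential clock `θ` of rate `s`, all independent. -/
structure IsModel (P : Measure Ω) (lam p q c s : ℝ) (F : Measure ℝ)
    (W X : ℕ → Ω → ℝ) (θ : Ω → ℝ) : Prop where
  waiting : ∀ k, HasLaw (W k) (expMeasure lam) P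
  jump : ∀ k, HasLaw (X k) (jumpLaw p q c F) P
  clock : HasLaw θ (expMeasure s) P
  indep : iIndepFun (Sum.elim W (Sum.elim X fun _ : Unit => θ)) P

/-- Time of the jump with index `n` (indices start at `0`). -/
def jumpTime (W : ℕ → Ω → ℝ) (n : ℕ) (ω : Ω) : ℝ := ∑ k ∈ Finset.range (n + 1), W k ω

/-- The Poisson process `ν(t)`: the number of jumps up to time `t`. -/
def count (W : ℕ → Ω → ℝ) (t : ℝ) (ω : Ω) : ℕ := {n : ℕ | jumpTime W n ω ≤ t}.ncard

/-- The compound Poisson process `ξ(t) = ∑_{k ≤ ν(t)} ξ_k`. -/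
def xi (W X : ℕ → Ω → ℝ) (t : ℝ) (ω : Ω) : ℝ := ∑ k ∈ Finset.range (count W t ω), X k ω

/-- `ξ⁺(t) = sup_{0 ≤ u ≤ t} ξ(u)`. -/
def xiSup (W X : ℕ → Ω → ℝ) (t : ℝ) (ω : Ω) : ℝ := sSup ((fun u => xi W X u ω) '' Icc 0 t)

/-- `ξ⁻(t) = inf_{0 ≤ u ≤ t} ξ(u)`. -/
def xiInf (W X : ℕ → Ω → ℝ) (t : ℝ) (ω : Ω) : ℝ := sInf ((fun u => xi W X u ω) '' Icc 0 t)

/-- `τ(x,T) = inf {t > 0 : ξ(t) ∉ (x - T, x)}`, equal to `∞` if there is no such `t`. -/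
def exitTime (W X : ℕ → Ω → ℝ) (x T : ℝ) (ω : Ω) : ℝ≥0∞ :=
  ⨅ (t : ℝ) (_ : 0 < t ∧ xi W X t ω ∉ Ioo (x - T) x), ENNReal.ofReal t

/-- The position `ξ(τ(x,T))` at the exit time (used only where the latter is finite). -/
def exitPos (W X : ℕ → Ω → ℝ) (x T : ℝ) (ω : Ω) : ℝ := xi W X (exitTime W X x T ω).toReal ω

/-- The event `A₊(x)` of exit through the upper end. -/
def upperExit (W X : ℕ → Ω → ℝ) (x T : ℝ) : Set Ω :=
  {ω | exitTime W X x T ω ≠ ∞ ∧ x ≤ exitPos W X x T ω}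

/-- The event `τ(x,T) > θ`. -/
def noExit (W X : ℕ → Ω → ℝ) (θ : Ω → ℝ) (x T : ℝ) : Set Ω :=
  {ω | ENNReal.ofReal (θ ω) < exitTime W X x T ω}

/-- `Q^T(s,x) = E[e^{-s τ⁺(x,T)}, A₊(x)]`. -/
def QT (P : Measure Ω) (W X : ℕ → Ω → ℝ) (s x T : ℝ) : ℝ :=
  ∫ ω in upperExit W X x T, Real.exp (-s * (exitTime W X x T ω).toReal) ∂P

/-- `V⁺(s,α,x,T) = E[e^{iα γ⁺ - s τ⁺}, A₊(x)]` with the overshoot `γ⁺ = ξ(τ⁺) - x`. -/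
def VOvershoot (P : Measure Ω) (W X : ℕ → Ω → ℝ) (s α x T : ℝ) : ℂ :=
  ∫ ω in upperExit W X x T,
    Complex.exp (Complex.I * α * ((exitPos W X x T ω - x : ℝ) : ℂ)
      - s * ((exitTime W X x T ω).toReal : ℂ)) ∂P

/-- `V₊(s,α,x,T) = E[e^{iα ξ(τ⁺) - s τ⁺}, A₊(x)]`. -/
def VPosition (P : Measure Ω) (W X : ℕ → Ω → ℝ) (s α x T : ℝ) : ℂ :=
  ∫ ω in upperExit W X x T,
    Complex.exp (Complex.I * α * (exitPos W X x T ω : ℂ)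
      - s * ((exitTime W X x T ω).toReal : ℂ)) ∂P

/-- `V(s,α,x,T) = E[e^{iα ξ(θ)}, τ(x,T) > θ]`. -/
def VNoExit (P : Measure Ω) (W X : ℕ → Ω → ℝ) (θ : Ω → ℝ) (α x T : ℝ) : ℂ :=
  ∫ ω in noExit W X θ x T, Complex.exp (Complex.I * α * (xi W X (θ ω) ω : ℂ)) ∂P

/-- `H_s(T,x,z) = P{ξ(θ) < z, τ(x,T) > θ}`. -/
def H (P : Measure Ω) (W X : ℕ → Ω → ℝ) (θ : Ω → ℝ) (T x z : ℝ) : ℝ :=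
  P.real ({ω | xi W X (θ ω) ω < z} ∩ noExit W X θ x T)

/-- `p₊(s) = P{ξ⁺(θ) = 0}`. -/
def pPlus (P : Measure Ω) (W X : ℕ → Ω → ℝ) (θ : Ω → ℝ) : ℝ :=
  P.real {ω | xiSup W X (θ ω) ω = 0}

/-- `p₋(s) = P{ξ⁻(θ) = 0}`. -/
def pMinus (P : Measure Ω) (W X : ℕ → Ω → ℝ) (θ : Ω → ℝ) : ℝ :=
  P.real {ω | xiInf W X (θ ω) ω = 0}

/-- `q₊(s) = 1 - p₊(s)`. -/
def qPlus (P : Measure Ω) (W X : ℕ → Ω → ℝ) (θ : Ω → ℝ) : ℝ := 1 - pPlus P W X θ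

/-- `ρ₊(s) = c p₊(s)`. -/
def rhoPlus (P : Measure Ω) (c : ℝ) (W X : ℕ → Ω → ℝ) (θ : Ω → ℝ) : ℝ := c * pPlus P W X θ

/-- The distribution function `P₋(s,z) = P{ξ⁻(θ) < z}`. -/
def PMinus (P : Measure Ω) (W X : ℕ → Ω → ℝ) (θ : Ω → ℝ) (z : ℝ) : ℝ :=
  P.real {ω | xiInf W X (θ ω) ω < z}

/-- The measure `dP₋(s,·)`: the law of `ξ⁻(θ)`, with its atom at `0`. -/
def lawMinus (P : Measure Ω) (W X : ℕ → Ω → ℝ) (θ : Ω → ℝ) : Measure ℝ :=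
  P.map fun ω => xiInf W X (θ ω) ω

/-- `φ₊(s,α) = E e^{iα ξ⁺(θ)}`. -/
def phiPlus (P : Measure Ω) (W X : ℕ → Ω → ℝ) (θ : Ω → ℝ) (α : ℝ) : ℂ :=
  ∫ ω, Complex.exp (Complex.I * α * (xiSup W X (θ ω) ω : ℂ)) ∂P

/-- `φ₋(s,α) = E e^{iα ξ⁻(θ)}`. -/
def phiMinus (P : Measure Ω) (W X : ℕ → Ω → ℝ) (θ : Ω → ℝ) (α : ℝ) : ℂ :=
  ∫ ω, Complex.exp (Complex.I * α * (xiInf W X (θ ω) ω : ℂ)) ∂P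

/-- `gI` is the projection of `g(α) = C + ∫ e^{iαy} G(y) dy`, `G` integrable, given by
`gI(α) = C + ∫_I e^{iαy} G(y) dy`. By uniqueness of Fourier transforms, `C` and (almost everywhere)
`G` are determined by `g`, so there is at most one such `gI`. -/
def IsProjection (I : Set ℝ) (g gI : ℝ → ℂ) : Prop :=
  ∃ (C : ℂ) (G : ℝ → ℂ), Integrable G ∧
    (∀ α : ℝ, g α = C + ∫ y : ℝ, Complex.exp (Complex.I * α * y) * G y) ∧
    (∀ α : ℝ, gI α = C + ∫ y in I, Complex.exp (Complex.I * α * y) * G y)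

/-- The same projection on Fourier transforms of finite signed measures `M₁ - M₂`: the measure is
restricted to `I`. (For `0 ∈ I` the constant `C` above is the mass `C` at `0`.) -/
def IsMeasureProjection (I : Set ℝ) (g gI : ℝ → ℂ) : Prop :=
  ∃ M₁ M₂ : Measure ℝ, IsFiniteMeasure M₁ ∧ IsFiniteMeasure M₂ ∧
    (∀ α : ℝ, g α = (∫ y, Complex.exp (Complex.I * α * y) ∂M₁)
      - ∫ y, Complex.exp (Complex.I * α * y) ∂M₂) ∧
    (∀ α : ℝ, gI α = (∫ y in I, Complex.exp (Complex.I * α * y) ∂M₁)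
      - ∫ y in I, Complex.exp (Complex.I * α * y) ∂M₂)

/-- The explicit expression for the density `h_s(T,x,z)`. -/
def h (P : Measure Ω) (c s : ℝ) (W X : ℕ → Ω → ℝ) (θ : Ω → ℝ) (T x z : ℝ) : ℝ :=
  (if z < 0 then
      pPlus P W X θ * deriv (PMinus P W X θ) z
        - qPlus P W X θ * rhoPlus P c W X θ
          * ∫ y in Ioc z 0, Real.exp (rhoPlus P c W X θ * (y - z)) ∂(lawMinus P W X θ)
    else 0)
  + rhoPlus P c W X θ * QT P W X s x T
      * ∫ y in Ioc (z - x) 0,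
          Real.exp (rhoPlus P c W X θ * (y - (z - x))) ∂(lawMinus P W X θ)

end ExitProblem

end

noncomputable section

namespace ExitProblem


/-! ### The exponential distribution -/

/-! Write r = λ/(λ+s), μ for the law of a jump, and hats for Fourier transforms. The number of jumps
before the clock rings is geometric, P(N = n) = (1-r) r^n, and independent of the jumps; the time
t_n of the n-th jump satisfies E e^{-s t_n} = r^n. So the problem is one about a random walk. The
laws `LP` of ξ⁺(θ) and `LM` of ξ⁻(θ) solve Lindley's equations (`IsFluctuation`). The discounted
occupation measure G of the walk before it leaves (x-T, x) solves G = δ₀ + r (G ∗ μ) restricted to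
the interval; (1-r) G is the law of ξ(θ) before exit, and r (G ∗ μ) on [x, ∞) is the discounted law
of the position at an upper exit (`exists_isExitLaws`).

Upward jumps are exponential, so the overshoot over any level is Exp(c) whatever the past
(`restrict_conv_jumpLaw`); this is (i). The same fact makes the equation of the minimum explicit up
to constants. Combined with the equation of the maximum and restricted to (0, ∞), it gives p₋p₊ =
1-r, the law p₊δ₀ + q₊Exp(ρ₊) of the maximum, and the factorization φ₊φ₋(1 - rμ̂) = 1-r
(`smul_sup_eq`, `inf_mul_sup`, `sup_eq`, `charFun_sup_mul_inf`).

For the killed walk this becomes V = φ₊φ₋(1 - V₊ - V₋), where V₋ is the unknown transform at the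
lower exit. Since 1/φ₊ = (1 - q₊c/(c-iα))/p₊ is the transform of a signed measure on [0, ∞), V/φ₊
belongs to a measure on (x-T, ∞), whereas φ₋V₋ belongs to one on (-∞, x-T]. Restriction to (x-T, ∞)
removes V₋, which is (ii) (`charFun_killed_eq_projection`).

For (iii) the identity is expanded with the law of the maximum inserted. Above x-T the unknown lower
exit contributes only a multiple of e^{-ρ₊z}, and the constant is fixed because the killed walk has
no mass beyond x (`killed_real_eq`). The atom in (iv) is p₊p₋, because ξ(θ) is distributed as a sum
of independent copies of ξ⁺(θ) and ξ⁻(θ), and the exponential part of the former carries no atoms.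
-/

lemma expMeasure_eq_withDensity (c : ℝ) :
    expMeasure c = (volume.restrict (Ioi 0)).withDensity
      fun y => ENNReal.ofReal (c * Real.exp (-(c * y))) := by
  have h1 : expMeasure c = volume.withDensity (exponentialPDF c) := rfl
  have h2 : exponentialPDF c
      = (Ici (0 : ℝ)).indicator fun y => ENNReal.ofReal (c * Real.exp (-(c * y))) := by
    ext y
    by_cases hy : 0 ≤ y
    · simp [exponentialPDF_eq, hy]
    · simp [exponentialPDF_eq, hy]
  rw [h1, h2, withDensity_indicator measurableSet_Ici, restrict_Ioi_eq_restrict_Ici]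

lemma expMeasure_absolutelyContinuous (c : ℝ) : expMeasure c ≪ volume := by
  rw [expMeasure_eq_withDensity]
  exact (withDensity_absolutelyContinuous _ _).trans Measure.absolutelyContinuous_restrict

lemma expMeasure_Iic_zero (c : ℝ) : expMeasure c (Iic 0) = 0 := by
  rw [expMeasure_eq_withDensity]
  refine withDensity_absolutelyContinuous _ _ ?_
  rw [Measure.restrict_apply measurableSet_Iic, Iic_inter_Ioi, Ioc_self, measure_empty]

lemma lintegral_expMeasure (c : ℝ) {f : ℝ → ℝ≥0∞} (hf : Measurable f) :
    ∫⁻ y, f y ∂(expMeasure c)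
      = ∫⁻ y in Ioi 0, ENNReal.ofReal (c * Real.exp (-(c * y))) * f y := by
  rw [expMeasure_eq_withDensity, lintegral_withDensity_eq_lintegral_mul _ (by fun_prop) hf]
  rfl

lemma integral_exp_mul_expMeasure {c : ℝ} (hc : 0 < c) {z : ℂ} (hz : z.re < c) :
    ∫ y, Complex.exp (z * y) ∂(expMeasure c) = c / (c - z) := by
  rw [expMeasure_eq_withDensity, integral_withDensity_eq_integral_toReal_smul (by fun_prop) (by simp)]
  have h : ∀ y : ℝ, (ENNReal.ofReal (c * Real.exp (-(c * y)))).toReal • Complex.exp (z * y)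
      = c * Complex.exp ((z - c) * y) := by
    intro y
    rw [ENNReal.toReal_ofReal (by positivity), Complex.real_smul]
    push_cast
    rw [mul_assoc, ← Complex.exp_add]
    ring_nf
  simp_rw [h]
  rw [integral_const_mul, integral_exp_mul_complex_Ioi (by simpa using hz)]
  have h1 : (c : ℂ) - z ≠ 0 := fun h0 => by
    have := congrArg Complex.re h0
    simp at this
    linarith
  have h2 : z - (c : ℂ) ≠ 0 := by rwa [← neg_sub, neg_ne_zero]
  simp only [Complex.ofReal_zero, mul_zero, Complex.exp_zero]
  field_simp
  ring

lemma charFun_expMeasure {c : ℝ} (hc : 0 < c) (α : ℝ) :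
    charFun (expMeasure c) α = c / (c - Complex.I * α) := by
  rw [charFun_apply_real, ← integral_exp_mul_expMeasure hc (by simpa using hc)]
  congr with y
  ring_nf

lemma lintegral_exp_neg_mul_expMeasure {c s : ℝ} (hc : 0 < c) (hs : 0 ≤ s) :
    ∫⁻ y, ENNReal.ofReal (Real.exp (-s * y)) ∂(expMeasure c) = ENNReal.ofReal (c / (c + s)) := by
  have hcs : 0 < c + s := by positivity
  rw [lintegral_expMeasure c (by fun_prop)]
  have h : ∀ y : ℝ, ENNReal.ofReal (c * Real.exp (-(c * y))) * ENNReal.ofReal (Real.exp (-s * y))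
      = ENNReal.ofReal (c * Real.exp (-(c + s) * y)) := by
    intro y
    rw [← ENNReal.ofReal_mul (by positivity), mul_assoc, ← Real.exp_add]
    ring_nf
  simp_rw [h]
  rw [← ofReal_integral_eq_lintegral_ofReal]
  · rw [integral_const_mul, integral_exp_mul_Ioi (by linarith)]
    congr 1
    simp only [mul_zero, Real.exp_zero]
    field_simp
  · refine Integrable.const_mul ?_ _
    have := exp_neg_integrableOn_Ioi 0 hcs
    simpa [IntegrableOn] using this
  · exact ae_of_all _ fun y => by positivity

/-- Lack of memory in integral form: translating by b multiplies the exponential density by e^{-cb}.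
-/
lemma setLIntegral_Ici_expMeasure (c : ℝ) {b : ℝ} (hb : 0 ≤ b) {f : ℝ → ℝ≥0∞} (hf : Measurable f) :
    ∫⁻ y in Ici b, f y ∂(expMeasure c)
      = ENNReal.ofReal (Real.exp (-(c * b))) * ∫⁻ y, f (b + y) ∂(expMeasure c) := by
  have hmeas : MeasurableSet (Ici b) := measurableSet_Ici
  rw [← lintegral_indicator hmeas, lintegral_expMeasure c (hf.indicator hmeas),
    lintegral_expMeasure c (by fun_prop), ← lintegral_const_mul _ (by fun_prop)]
  have h1 : ∀ y : ℝ, ENNReal.ofReal (c * Real.exp (-(c * y))) * (Ici b).indicator f y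
      = (Ici b).indicator (fun y => ENNReal.ofReal (c * Real.exp (-(c * y))) * f y) y := by
    intro y
    by_cases hy : y ∈ Ici b <;> simp [hy]
  simp_rw [h1]
  rw [lintegral_indicator hmeas, Measure.restrict_restrict hmeas]
  have h2 : volume.restrict (Ici b ∩ Ioi 0) = volume.restrict (Ioi b) := by
    refine (Measure.restrict_congr_set ?_)
    have h3 : Ioi b ∩ Ioi (0 : ℝ) = Ioi b := by
      rw [Ioi_inter_Ioi, sup_of_le_left hb]
    conv_rhs => rw [← h3]
    exact Ioi_ae_eq_Ici.symm.inter (ae_eq_refl _)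
  rw [h2]
  have h4 : volume.restrict (Ioi b) = (volume.restrict (Ioi (0 : ℝ))).map (b + ·) := by
    have := (measurePreserving_add_left (volume : Measure ℝ) b).restrict_preimage
      (measurableSet_Ioi (a := b))
    rw [← this.map_eq]
    congr 2
    ext y
    simp
  rw [h4, lintegral_map (by fun_prop) (by fun_prop)]
  refine lintegral_congr fun y => ?_
  rw [← mul_assoc]
  congr 1
  by_cases hc : 0 ≤ c
  · rw [← ENNReal.ofReal_mul (by positivity)]
    congr 1
    rw [mul_left_comm, ← Real.exp_add]
    ring_nf
  -- For c < 0 the density is `ENNReal.ofReal` of a negative number, so both sides vanish.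
  · push Not at hc
    rw [ENNReal.ofReal_of_nonpos (mul_nonpos_of_nonpos_of_nonneg hc.le (Real.exp_pos _).le),
      ENNReal.ofReal_of_nonpos (mul_nonpos_of_nonpos_of_nonneg hc.le (Real.exp_pos _).le), mul_zero]

lemma expMeasure_Ici {c : ℝ} (hc : 0 < c) {b : ℝ} (hb : 0 ≤ b) :
    expMeasure c (Ici b) = ENNReal.ofReal (Real.exp (-(c * b))) := by
  have := isProbabilityMeasure_expMeasure hc
  have h := setLIntegral_Ici_expMeasure c hb (f := fun _ => 1) measurable_const
  simpa using h

/-! ### The lack of memory at an upward crossing -/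

/-- From a point y ≤ a the exponential jump must exceed a - y ≥ 0, and its excess over that
threshold is again Exp(c), independently of y. Only the probability e^{-c(a-y)} of crossing depends
on y. -/
lemma restrict_conv_expMeasure {c : ℝ} (hc : 0 < c) (A : Measure ℝ) [SFinite A] {a : ℝ}
    (hA : A (Ioi a) = 0) :
    (A ∗ expMeasure c).restrict (Ici a)
      = (∫⁻ y, ENNReal.ofReal (Real.exp (-(c * (a - y)))) ∂A) • (expMeasure c).map (a + ·) := by
  have := isProbabilityMeasure_expMeasure hc
  refine Measure.ext_of_lintegral _ fun f hf => ?_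
  rw [← lintegral_indicator measurableSet_Ici,
    Measure.lintegral_conv (hf.indicator measurableSet_Ici), lintegral_smul_measure,
    lintegral_map hf (by fun_prop), smul_eq_mul, ← lintegral_mul_const _ (by fun_prop)]
  refine lintegral_congr_ae ?_
  have hA' : ∀ᵐ y ∂A, y ≤ a := by
    rw [ae_iff]
    simpa [Ioi] using hA
  filter_upwards [hA'] with y hy
  have h1 : ∀ u, (Ici a).indicator f (y + u)
      = (Ici (a - y)).indicator (fun u => f (y + u)) u := by
    intro u
    simp only [indicator, mem_Ici, sub_le_iff_le_add']
  simp_rw [h1]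
  rw [lintegral_indicator measurableSet_Ici, setLIntegral_Ici_expMeasure c (by linarith) (by fun_prop)]
  congr 2 with u
  ring_nf

lemma isProbabilityMeasure_jumpLaw {p q c : ℝ} (hp : 0 ≤ p) (hq : 0 ≤ q) (hpq : p + q = 1)
    (hc : 0 < c) (F : Measure ℝ) [IsProbabilityMeasure F] :
    IsProbabilityMeasure (jumpLaw p q c F) := by
  have := isProbabilityMeasure_expMeasure hc
  constructor
  simp [jumpLaw, ← ENNReal.ofReal_add hq hp, add_comm q, hpq]

lemma conv_Ici_eq_zero (A F : Measure ℝ) [SFinite A] [SFinite F] {a : ℝ} (hA : A (Ioi a) = 0)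
    (hF : F (Ici 0) = 0) : (A ∗ F) (Ici a) = 0 := by
  rw [Measure.conv, Measure.map_apply (by fun_prop) measurableSet_Ici]
  refine measure_mono_null (t := (Ioi a ×ˢ univ) ∪ (univ ×ˢ Ici 0)) ?_ ?_
  · rintro ⟨y, u⟩ (h : a ≤ y + u)
    simp only [mem_union, mem_prod, mem_Ioi, mem_univ, and_true, mem_Ici, true_and]
    by_contra! h'
    linarith
  · rw [measure_union_null_iff, Measure.prod_prod, Measure.prod_prod, hA, hF]
    simp

lemma conv_jumpLaw (A : Measure ℝ) [SFinite A] (p q c : ℝ) (F : Measure ℝ) [SFinite F]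
    [SFinite (expMeasure c)] :
    A ∗ jumpLaw p q c F
      = ENNReal.ofReal q • (A ∗ F) + ENNReal.ofReal p • (A ∗ expMeasure c) := by
  rw [jumpLaw, Measure.conv_add, Measure.conv_smul_right, Measure.conv_smul_right]

/-- Negative jumps cannot reach the level from below, so only the exponential component crosses it.
The factor is then identified by comparing total masses. -/
lemma restrict_conv_jumpLaw {p q c : ℝ} (hc : 0 < c) (F : Measure ℝ) [IsProbabilityMeasure F]
    (hF : F (Ici 0) = 0) (A : Measure ℝ) [SFinite A] {a : ℝ} (hA : A (Ioi a) = 0) :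
    (A ∗ jumpLaw p q c F).restrict (Ici a)
      = (A ∗ jumpLaw p q c F) (Ici a) • (expMeasure c).map (a + ·) := by
  have := isProbabilityMeasure_expMeasure hc
  have h : ∃ k : ℝ≥0∞, (A ∗ jumpLaw p q c F).restrict (Ici a) = k • (expMeasure c).map (a + ·) := by
    refine ⟨ENNReal.ofReal p * ∫⁻ y, ENNReal.ofReal (Real.exp (-(c * (a - y)))) ∂A, ?_⟩
    rw [conv_jumpLaw, Measure.restrict_add, Measure.restrict_smul, Measure.restrict_smul,
      restrict_conv_expMeasure hc A hA,
      Measure.restrict_eq_zero.2 (conv_Ici_eq_zero A F hA hF), smul_zero, zero_add, smul_smul]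
  obtain ⟨k, hk⟩ := h
  have hmass := congrArg (fun M : Measure ℝ => M univ) hk
  have hprob : IsProbabilityMeasure ((expMeasure c).map (a + ·)) :=
    Measure.isProbabilityMeasure_map (by fun_prop)
  simp at hmass
  rw [hk, hmass]

end ExitProblem

end

noncomputable section

namespace ExitProblem


/-! ### Characteristic functions of combinations of measures -/

lemma integrable_exp_ofReal_mul_I (μ : Measure ℝ) [IsFiniteMeasure μ] (α : ℝ) :
    Integrable (fun y : ℝ => Complex.exp (α * y * Complex.I)) μ := by
  refine (integrable_const (1 : ℝ)).mono (by fun_prop) (ae_of_all _ fun y => ?_)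
  rw [← Complex.ofReal_mul, Complex.norm_exp_ofReal_mul_I]
  simp

lemma charFun_add (μ ν : Measure ℝ) [IsFiniteMeasure μ] [IsFiniteMeasure ν] (α : ℝ) :
    charFun (μ + ν) α = charFun μ α + charFun ν α := by
  simp_rw [charFun_apply_real]
  exact integral_add_measure (integrable_exp_ofReal_mul_I μ α) (integrable_exp_ofReal_mul_I ν α)

lemma charFun_smul (a : ℝ≥0∞) (μ : Measure ℝ) (α : ℝ) :
    charFun (a • μ) α = a.toReal * charFun μ α := by
  simp_rw [charFun_apply_real]
  rw [integral_smul_measure, Complex.real_smul]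

lemma charFun_ofReal_smul {a : ℝ} (ha : 0 ≤ a) (μ : Measure ℝ) (α : ℝ) :
    charFun (ENNReal.ofReal a • μ) α = a * charFun μ α := by
  rw [charFun_smul, ENNReal.toReal_ofReal ha]

lemma charFun_dirac_zero (α : ℝ) : charFun (Measure.dirac (0 : ℝ)) α = 1 := by
  simp [charFun_dirac]

instance isFiniteMeasure_ofReal_smul (a : ℝ) (μ : Measure ℝ) [IsFiniteMeasure μ] :
    IsFiniteMeasure (ENNReal.ofReal a • μ) := Measure.smul_finite μ ENNReal.ofReal_ne_top

/-! ### Supports and atoms of convolutions -/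

lemma conv_Ioi_eq_zero (A B : Measure ℝ) [SFinite A] [SFinite B] {a b : ℝ} (hA : A (Ioi a) = 0)
    (hB : B (Ioi b) = 0) : (A ∗ B) (Ioi (a + b)) = 0 := by
  rw [Measure.conv, Measure.map_apply (by fun_prop) measurableSet_Ioi]
  refine measure_mono_null (t := (Ioi a ×ˢ univ) ∪ (univ ×ˢ Ioi b)) ?_ ?_
  · rintro ⟨y, u⟩ (h : a + b < y + u)
    simp only [mem_union, mem_prod, mem_Ioi, mem_univ, and_true, true_and]
    by_contra! h'
    linarith
  · rw [measure_union_null_iff, Measure.prod_prod, Measure.prod_prod, hA, hB]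
    simp

lemma conv_Iic_eq_zero (A B : Measure ℝ) [SFinite A] [SFinite B] {a b : ℝ} (hA : A (Iio a) = 0)
    (hB : B (Iic b) = 0) : (A ∗ B) (Iic (a + b)) = 0 := by
  rw [Measure.conv, Measure.map_apply (by fun_prop) measurableSet_Iic]
  refine measure_mono_null (t := (Iio a ×ˢ univ) ∪ (univ ×ˢ Iic b)) ?_ ?_
  · rintro ⟨y, u⟩ (h : y + u ≤ a + b)
    simp only [mem_union, mem_prod, mem_Iio, mem_Iic, mem_univ, and_true, true_and]
    by_contra! h'
    linarith
  · rw [measure_union_null_iff, Measure.prod_prod, Measure.prod_prod, hA, hB]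
    simp

lemma conv_expMeasure_absolutelyContinuous {c : ℝ} (hc : 0 < c) (A : Measure ℝ) :
    A ∗ expMeasure c ≪ volume := by
  have := isProbabilityMeasure_expMeasure hc
  exact Measure.conv_absolutelyContinuous (expMeasure_absolutelyContinuous c)

lemma map_min_zero (B : Measure ℝ) :
    B.map (min 0) = B.restrict (Iio 0) + B (Ici 0) • Measure.dirac 0 := by
  classical
  ext A hA
  have hm : Measurable (min (0 : ℝ)) := by fun_prop
  rw [Measure.map_apply hm hA, ← measure_inter_add_sdiff _ (measurableSet_Iio (a := (0 : ℝ))),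
    Measure.add_apply, Measure.restrict_apply hA, Measure.smul_apply,
    Measure.dirac_apply' _ hA, smul_eq_mul]
  congr 1
  · congr 1
    ext y
    simp only [mem_inter_iff, mem_preimage, mem_Iio, and_congr_left_iff]
    intro hy
    rw [min_eq_right hy.le]
  · have h : (min 0) ⁻¹' A \ Iio 0 = if (0 : ℝ) ∈ A then Ici 0 else ∅ := by
      ext y
      simp only [mem_sdiff, mem_preimage, mem_Iio, not_lt]
      split_ifs with h0
      · simp only [mem_Ici, and_iff_right_iff_imp]
        intro hy
        rwa [min_eq_left hy]
      · simp only [mem_empty_iff_false, iff_false, not_and, not_le]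
        intro h1
        by_contra! h2
        rw [min_eq_left h2] at h1
        exact h0 h1
    rw [h]
    split_ifs with h0 <;> simp [h0]

lemma map_max_zero (B : Measure ℝ) :
    B.map (max 0) = B.restrict (Ioi 0) + B (Iic 0) • Measure.dirac 0 := by
  classical
  ext A hA
  have hm : Measurable (max (0 : ℝ)) := by fun_prop
  rw [Measure.map_apply hm hA, ← measure_inter_add_sdiff _ (measurableSet_Ioi (a := (0 : ℝ))),
    Measure.add_apply, Measure.restrict_apply hA, Measure.smul_apply,
    Measure.dirac_apply' _ hA, smul_eq_mul]
  congr 1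
  · congr 1
    ext y
    simp only [mem_inter_iff, mem_preimage, mem_Ioi, and_congr_left_iff]
    intro hy
    rw [max_eq_right hy.le]
  · have h : (max 0) ⁻¹' A \ Ioi 0 = if (0 : ℝ) ∈ A then Iic 0 else ∅ := by
      ext y
      simp only [mem_sdiff, mem_preimage, mem_Ioi, not_lt]
      split_ifs with h0
      · simp only [mem_Iic, and_iff_right_iff_imp]
        intro hy
        rwa [max_eq_left hy]
      · simp only [mem_empty_iff_false, iff_false, not_and, not_le]
        intro h1
        by_contra! h2
        rw [max_eq_left h2] at h1
        exact h0 h1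
    rw [h]
    split_ifs with h0 <;> simp [h0]

/-! ### Fluctuation identities -/

/-- The laws `LP` and `LM` of the maximum and of the minimum of a random walk with jump law
`jumpLaw p q c F`, stopped at an independent geometric time with parameter `r`, characterized by
Lindley's equations. -/
structure IsFluctuation (r p q c : ℝ) (F LP LM : Measure ℝ) : Prop where
  r_pos : 0 < r
  r_lt_one : r < 1
  c_pos : 0 < c
  probF : IsProbabilityMeasure F
  prob_jump : IsProbabilityMeasure (jumpLaw p q c F)
  F_neg : F (Ici 0) = 0
  prob_sup : IsProbabilityMeasure LP
  prob_inf : IsProbabilityMeasure LM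
  lindley_sup : LP = ENNReal.ofReal (1 - r) • Measure.dirac 0
    + ENNReal.ofReal r • (LP ∗ jumpLaw p q c F).map (max 0)
  lindley_inf : LM = ENNReal.ofReal (1 - r) • Measure.dirac 0
    + ENNReal.ofReal r • (LM ∗ jumpLaw p q c F).map (min 0)

namespace IsFluctuation

variable {r p q c : ℝ} {F LP LM : Measure ℝ}

lemma sup_Iio (hfl : IsFluctuation r p q c F LP LM) : LP (Iio 0) = 0 := by
  rw [hfl.lindley_sup, map_max_zero]
  simp [Measure.restrict_apply, Iio_inter_Ioi]

lemma inf_Ioi (hfl : IsFluctuation r p q c F LP LM) : LM (Ioi 0) = 0 := by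
  rw [hfl.lindley_inf, map_min_zero]
  simp [Measure.restrict_apply, Ioi_inter_Iio]

lemma inf_singleton_zero (hfl : IsFluctuation r p q c F LP LM) :
    LM.real {0} = 1 - r + r * (LM ∗ jumpLaw p q c F).real (Ici 0) := by
  have h1 := hfl.r_lt_one
  have h2 := hfl.r_pos
  have := hfl.prob_inf
  have := hfl.prob_jump
  conv_lhs => rw [measureReal_def, hfl.lindley_inf, map_min_zero]
  simp only [Measure.coe_add, Measure.coe_smul, Pi.add_apply, Pi.smul_apply, smul_eq_mul,
    Measure.dirac_apply' _ (measurableSet_singleton (0 : ℝ)), mem_singleton_iff, indicator_of_mem,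
    Pi.one_apply, mul_one, Measure.restrict_apply (measurableSet_singleton (0 : ℝ))]
  have h3 : ({0} : Set ℝ) ∩ Iio 0 = ∅ := by simp
  rw [h3, measure_empty, zero_add, ENNReal.toReal_add (by simp) (by finiteness),
    ENNReal.toReal_mul, ENNReal.toReal_ofReal (by linarith), ENNReal.toReal_ofReal (by linarith)]
  rfl

/-- One half of the factorization. Lindley's equation clips `LM ∗ μ` at 0; by lack of memory the
clipped part is a multiple of Exp(c), so the right side is explicit up to two constants. -/
lemma charFun_inf_mul (hfl : IsFluctuation r p q c F LP LM) (α : ℝ) :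
    charFun LM α * (1 - r * charFun (jumpLaw p q c F) α)
      = LM.real {0} - (r * (LM ∗ jumpLaw p q c F).real (Ici 0) : ℝ) * charFun (expMeasure c) α := by
  have h1 := hfl.r_lt_one
  have h2 := hfl.r_pos
  have := hfl.prob_inf
  have := hfl.prob_jump
  have := hfl.probF
  have := isProbabilityMeasure_expMeasure hfl.c_pos
  set μ := jumpLaw p q c F
  -- Clipping replaces the mass on [0, ∞), which is distributed as Exp(c), by an atom of equal mass
  -- at 0.
  have e1 : (LM ∗ μ).map (min 0) + (LM ∗ μ) (Ici 0) • expMeasure c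
      = LM ∗ μ + (LM ∗ μ) (Ici 0) • Measure.dirac 0 := by
    have h := restrict_conv_jumpLaw (p := p) (q := q) hfl.c_pos F hfl.F_neg LM hfl.inf_Ioi
    simp only [zero_add, Measure.map_id'] at h
    rw [← h, map_min_zero, add_right_comm]
    congr 1
    have := Measure.restrict_add_restrict_compl (μ := LM ∗ μ) (measurableSet_Iio (a := (0 : ℝ)))
    rwa [compl_Iio] at this
  have hfin : (LM ∗ μ) (Ici 0) ≠ ∞ := by finiteness
  have : IsFiniteMeasure ((LM ∗ μ) (Ici 0) • expMeasure c) := Measure.smul_finite _ hfin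
  have : IsFiniteMeasure ((LM ∗ μ) (Ici 0) • (Measure.dirac 0 : Measure ℝ)) :=
    Measure.smul_finite _ hfin
  have e2 := congrArg (charFun · α) e1
  simp only [charFun_add, charFun_smul, charFun_conv, charFun_dirac_zero] at e2
  have e3 := congrArg (charFun · α) hfl.lindley_inf
  simp only [charFun_add, charFun_smul, charFun_dirac_zero] at e3
  rw [ENNReal.toReal_ofReal (by linarith), ENNReal.toReal_ofReal (by linarith)] at e3
  rw [hfl.inf_singleton_zero]
  push_cast
  simp only [measureReal_def] at e2 ⊢
  push_cast at e3
  linear_combination e3 + r * e2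

/-- The other half. Here the clipped part η depends on F and has no explicit form; all that is kept
is that it lives on (-∞, 0]. -/
lemma exists_charFun_sup_mul (hfl : IsFluctuation r p q c F LP LM) :
    ∃ η : Measure ℝ, IsFiniteMeasure η ∧ η (Ioi 0) = 0 ∧ ∀ α,
      charFun LP α * (1 - r * charFun (jumpLaw p q c F) α)
        = (1 - r + η.real univ : ℝ) - charFun η α := by
  have h1 := hfl.r_lt_one
  have h2 := hfl.r_pos
  have := hfl.prob_sup
  have := hfl.prob_jump
  set μ := jumpLaw p q c F
  refine ⟨ENNReal.ofReal r • (LP ∗ μ).restrict (Iic 0), inferInstance, ?_, fun α => ?_⟩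
  · simp [Measure.restrict_apply, Ioi_inter_Iic]
  have e1 : (LP ∗ μ).map (max 0) + (LP ∗ μ).restrict (Iic 0)
      = LP ∗ μ + (LP ∗ μ) (Iic 0) • Measure.dirac 0 := by
    rw [map_max_zero, add_right_comm]
    congr 1
    have := Measure.restrict_add_restrict_compl (μ := LP ∗ μ) (measurableSet_Ioi (a := (0 : ℝ)))
    rwa [compl_Ioi] at this
  have hfin : (LP ∗ μ) (Iic 0) ≠ ∞ := by finiteness
  have : IsFiniteMeasure ((LP ∗ μ) (Iic 0) • (Measure.dirac 0 : Measure ℝ)) :=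
    Measure.smul_finite _ hfin
  have e2 := congrArg (charFun · α) e1
  simp only [charFun_add, charFun_smul, charFun_conv, charFun_dirac_zero] at e2
  have e3 := congrArg (charFun · α) hfl.lindley_sup
  simp only [charFun_add, charFun_smul, charFun_dirac_zero] at e3
  rw [ENNReal.toReal_ofReal (by linarith), ENNReal.toReal_ofReal (by linarith)] at e3
  rw [charFun_ofReal_smul h2.le, measureReal_ennreal_smul_apply, ENNReal.toReal_ofReal h2.le]
  simp only [measureReal_def, Measure.restrict_apply_univ]
  push_cast at e2 e3 ⊢
  linear_combination e3 + r * e2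

/-- The atom of the maximum, in the equation satisfied by its law. -/
lemma smul_sup_eq (hfl : IsFluctuation r p q c F LP LM) :
    LM {0} • LP = (LM {0} * LP {0}) • Measure.dirac 0
      + ENNReal.ofReal (r * (LM ∗ jumpLaw p q c F).real (Ici 0)) • (LP ∗ expMeasure c) := by
  have h1 := hfl.r_lt_one
  have h2 := hfl.r_pos
  have := hfl.prob_sup
  have := hfl.prob_inf
  have := hfl.prob_jump
  have := isProbabilityMeasure_expMeasure hfl.c_pos
  obtain ⟨η, hη, hη0, hηeq⟩ := hfl.exists_charFun_sup_mul
  set κ : ℝ := r * (LM ∗ jumpLaw p q c F).real (Ici 0)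
  have hκ : 0 ≤ κ := by positivity
  have hη1 : 0 ≤ 1 - r + η.real univ := by
    have : 0 ≤ η.real univ := measureReal_nonneg
    linarith
  have : IsFiniteMeasure (LM {0} • LP) := Measure.smul_finite _ (by finiteness)
  -- The equation of the maximum times the transform of `LM`, against that of the minimum times the
  -- transform of `LP`: the factor 1 - rμ̂ drops out.
  have key : LM {0} • LP + LM ∗ η
      = ENNReal.ofReal κ • (LP ∗ expMeasure c) + ENNReal.ofReal (1 - r + η.real univ) • LM := by
    refine Measure.ext_of_charFun (funext fun α => ?_)
    simp only [charFun_add, charFun_smul, charFun_conv]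
    rw [ENNReal.toReal_ofReal hκ, ENNReal.toReal_ofReal hη1]
    have e1 := hfl.charFun_inf_mul α
    have e2 := hηeq α
    simp only [measureReal_def LM] at e1
    linear_combination charFun LM α * e2 - charFun LP α * e1
  -- `LM ∗ η` and `LM` live on (-∞, 0], while `LP ∗ Exp(c)` lives on (0, ∞). Restriction to (0, ∞)
  -- therefore eliminates the unknown η.
  have key2 := congrArg (fun M => M.restrict (Ioi 0)) key
  simp only [Measure.restrict_add, Measure.restrict_smul] at key2
  have hz1 := conv_Ioi_eq_zero LM η hfl.inf_Ioi hη0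
  have hz2 := conv_Iic_eq_zero LP (expMeasure c) hfl.sup_Iio (expMeasure_Iic_zero c)
  rw [add_zero] at hz1 hz2
  rw [Measure.restrict_eq_zero.2 hz1, Measure.restrict_eq_zero.2 hfl.inf_Ioi, smul_zero, add_zero,
    add_zero] at key2
  have hz3 : (LP ∗ expMeasure c).restrict (Ioi 0) = LP ∗ expMeasure c := by
    refine Measure.restrict_eq_self_of_ae_mem ?_
    rw [ae_iff]
    simpa [Iic] using hz2
  rw [hz3] at key2
  rw [← key2, ← smul_smul, ← smul_add]
  congr 1
  have h3 := Measure.restrict_add_restrict_compl (μ := LP) (measurableSet_Ioi (a := (0 : ℝ)))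
  have h4 : LP.restrict (Iic 0) = LP {0} • Measure.dirac 0 := by
    rw [← Measure.restrict_singleton]
    refine Measure.restrict_congr_set ?_
    rw [← Iio_union_right]
    refine union_ae_eq_right_of_ae_eq_empty ?_
    exact ae_eq_empty.2 hfl.sup_Iio
  rw [compl_Ioi, h4, add_comm] at h3
  exact h3.symm

end IsFluctuation

end ExitProblem

end

noncomputable section

namespace ExitProblem


/-! ### The Wiener–Hopf factorization and its use for the killed walk. -/

namespace IsFluctuation

variable {r p q c : ℝ} {F LP LM : Measure ℝ}

/-- Total masses in `smul_sup_eq` give p₋ = p₋p₊ + κ, and Lindley's equation gives p₋ = 1 - r + κ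
with the same constant κ. -/
lemma inf_mul_sup (hfl : IsFluctuation r p q c F LP LM) : LM.real {0} * LP.real {0} = 1 - r := by
  have := hfl.prob_sup
  have := hfl.prob_inf
  have := hfl.prob_jump
  have := isProbabilityMeasure_expMeasure hfl.c_pos
  have h2 := hfl.r_pos
  have h := congrArg (fun M : Measure ℝ => (M univ).toReal) hfl.smul_sup_eq
  simp only [Measure.coe_add, Measure.coe_smul, Pi.add_apply, Pi.smul_apply, smul_eq_mul,
    measure_univ, mul_one] at h
  rw [ENNReal.toReal_add (by finiteness) (by finiteness), ENNReal.toReal_mul,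
    ENNReal.toReal_ofReal (by positivity)] at h
  have h3 := hfl.inf_singleton_zero
  simp only [measureReal_def] at h h3 ⊢
  linarith

lemma sup_singleton_zero_pos (hfl : IsFluctuation r p q c F LP LM) : 0 < LP.real {0} := by
  have h := hfl.inf_mul_sup
  have h1 := hfl.r_lt_one
  have h2 : 0 ≤ LP.real {0} := measureReal_nonneg
  rcases h2.eq_or_lt with h3 | h3
  · rw [← h3] at h
    linarith
  · exact h3

lemma inf_singleton_zero_pos (hfl : IsFluctuation r p q c F LP LM) : 0 < LM.real {0} := by
  have h := hfl.inf_mul_sup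
  have h1 := hfl.r_lt_one
  have h2 : 0 ≤ LM.real {0} := measureReal_nonneg
  rcases h2.eq_or_lt with h3 | h3
  · rw [← h3] at h
    linarith
  · exact h3

lemma sup_singleton_zero_le_one (hfl : IsFluctuation r p q c F LP LM) : LP.real {0} ≤ 1 := by
  have := hfl.prob_sup
  exact measureReal_le_one

/-- The maximum is a geometric sum of Exp(c) variables. This is `smul_sup_eq` divided by the
positive number p₋, with κ = p₋(1 - p₊). -/
lemma charFun_sup_mul (hfl : IsFluctuation r p q c F LP LM) (α : ℝ) :
    charFun LP α * (1 - (1 - LP.real {0}) * charFun (expMeasure c) α) = LP.real {0} := by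
  have := hfl.prob_sup
  have := hfl.prob_inf
  have := hfl.prob_jump
  have := isProbabilityMeasure_expMeasure hfl.c_pos
  have h2 := hfl.r_pos
  have : IsFiniteMeasure ((LM {0} * LP {0}) • (Measure.dirac 0 : Measure ℝ)) :=
    Measure.smul_finite _ (by finiteness)
  have h := congrArg (charFun · α) hfl.smul_sup_eq
  simp only [charFun_add, charFun_smul, charFun_conv, charFun_dirac_zero, ENNReal.toReal_mul] at h
  rw [ENNReal.toReal_ofReal (by positivity)] at h
  have h3 := hfl.inf_singleton_zero
  have h4 := hfl.inf_mul_sup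
  have h5 : (LM.real {0} : ℂ) ≠ 0 := by exact_mod_cast hfl.inf_singleton_zero_pos.ne'
  have h6 : r * (LM ∗ jumpLaw p q c F).real (Ici 0) = LM.real {0} - LM.real {0} * LP.real {0} := by
    linarith
  rw [h6] at h
  simp only [measureReal_def] at *
  refine mul_left_cancel₀ h5 ?_
  push_cast at h ⊢
  linear_combination h

/-- The Wiener–Hopf factorization: with κ = p₋(1 - p₊), the right side of `charFun_inf_mul` is p₋
times the factor that `charFun_sup_mul` inverts. -/
lemma charFun_sup_mul_inf (hfl : IsFluctuation r p q c F LP LM) (α : ℝ) :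
    charFun LP α * charFun LM α * (1 - r * charFun (jumpLaw p q c F) α) = (1 - r : ℝ) := by
  have h1 := hfl.charFun_inf_mul α
  have h2 := hfl.charFun_sup_mul α
  have h3 := hfl.inf_singleton_zero
  have h4 := hfl.inf_mul_sup
  have h6 : r * (LM ∗ jumpLaw p q c F).real (Ici 0) = LM.real {0} - LM.real {0} * LP.real {0} := by
    linarith
  rw [h6] at h1
  rw [← h4]
  push_cast at h1 ⊢
  linear_combination charFun LP α * h1 + LM.real {0} * h2

lemma one_sub_ne_zero (hfl : IsFluctuation r p q c F LP LM) (α : ℝ) :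
    1 - r * charFun (jumpLaw p q c F) α ≠ 0 := by
  intro h
  have h1 := hfl.charFun_sup_mul_inf α
  rw [h, mul_zero] at h1
  have h2 := hfl.r_lt_one
  have h3 : 0 = 1 - r := by exact_mod_cast h1
  linarith

lemma rho_pos (hfl : IsFluctuation r p q c F LP LM) : 0 < c * LP.real {0} :=
  mul_pos hfl.c_pos hfl.sup_singleton_zero_pos

lemma ofReal_sub_I_mul_ne_zero {a : ℝ} (ha : 0 < a) (α : ℝ) : (a : ℂ) - Complex.I * α ≠ 0 := by
  intro h
  have := congrArg Complex.re h
  simp at this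
  linarith

/-- One more Exp(c) term turns the geometric sum that may be empty into one with at least one term,
which is exponential with parameter c p₊. -/
lemma charFun_sup_mul_exp (hfl : IsFluctuation r p q c F LP LM) (α : ℝ) :
    charFun LP α * charFun (expMeasure c) α = charFun (expMeasure (c * LP.real {0})) α := by
  have h := hfl.charFun_sup_mul α
  rw [charFun_expMeasure hfl.c_pos] at h ⊢
  rw [charFun_expMeasure hfl.rho_pos]
  have h1 := ofReal_sub_I_mul_ne_zero hfl.c_pos α
  have h2 := ofReal_sub_I_mul_ne_zero hfl.rho_pos α
  push_cast at h2 ⊢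
  rw [← mul_div_assoc, div_eq_div_iff h1 h2]
  field_simp at h
  linear_combination c * h

/-- The maximum is `0` or exponential. -/
lemma sup_eq (hfl : IsFluctuation r p q c F LP LM) :
    LP = ENNReal.ofReal (LP.real {0}) • Measure.dirac 0
      + ENNReal.ofReal (1 - LP.real {0}) • expMeasure (c * LP.real {0}) := by
  have := hfl.prob_sup
  have := isProbabilityMeasure_expMeasure hfl.rho_pos
  have h0 := hfl.sup_singleton_zero_le_one
  refine Measure.ext_of_charFun (funext fun α => ?_)
  rw [charFun_add, charFun_ofReal_smul measureReal_nonneg, charFun_ofReal_smul (by linarith),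
    ← hfl.charFun_sup_mul_exp, charFun_dirac_zero]
  have h := hfl.charFun_sup_mul α
  push_cast
  linear_combination h

/-! ### The walk killed on leaving an interval -/

variable {G : Measure ℝ} {a b : ℝ}

lemma killed_compl (ha : a < 0) (hb : 0 < b)
    (hG : G = Measure.dirac 0 + ENNReal.ofReal r • (G ∗ jumpLaw p q c F).restrict (Ioo a b)) :
    G (Ioo a b)ᶜ = 0 := by
  rw [hG]
  have : (0 : ℝ) ∉ (Ioo a b)ᶜ := by simp [ha, hb]
  simp [Measure.dirac_apply' _ measurableSet_Ioo.compl, this, Measure.restrict_apply]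

variable [IsFiniteMeasure G]

/-- Without killing, (1-r)G has transform (1-r)/(1 - rμ̂), which the factorization splits into a
maximum and an independent minimum. -/
lemma eq_conv_of_killed_univ (hfl : IsFluctuation r p q c F LP LM)
    (hG : G = Measure.dirac 0 + ENNReal.ofReal r • (G ∗ jumpLaw p q c F)) :
    ENNReal.ofReal (1 - r) • G = LP ∗ LM := by
  have := hfl.prob_sup
  have := hfl.prob_inf
  have := hfl.prob_jump
  have h1 := hfl.r_lt_one
  refine Measure.ext_of_charFun (funext fun α => ?_)
  rw [charFun_ofReal_smul (by linarith), charFun_conv]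
  have h := congrArg (charFun · α) hG
  simp only [charFun_add, charFun_ofReal_smul hfl.r_pos.le, charFun_conv, charFun_dirac_zero] at h
  refine mul_right_cancel₀ (hfl.one_sub_ne_zero α) ?_
  rw [hfl.charFun_sup_mul_inf]
  linear_combination (1 - r : ℝ) * h

lemma conv_singleton_zero (hfl : IsFluctuation r p q c F LP LM) :
    (LP ∗ LM).real {0} = LP.real {0} * LM.real {0} := by
  have := hfl.prob_sup
  have := hfl.prob_inf
  have := isProbabilityMeasure_expMeasure hfl.rho_pos
  have h : LP ∗ LM = ENNReal.ofReal (LP.real {0}) • LM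
      + ENNReal.ofReal (1 - LP.real {0}) • (LM ∗ expMeasure (c * LP.real {0})) := by
    conv_lhs => rw [hfl.sup_eq]
    rw [Measure.add_conv, Measure.conv_smul_left, Measure.conv_smul_left, Measure.dirac_zero_conv,
      Measure.conv_comm LM]
  have h0 : (LM ∗ expMeasure (c * LP.real {0})) {0} = 0 :=
    conv_expMeasure_absolutelyContinuous hfl.rho_pos LM (by simp)
  rw [measureReal_def, h]
  simp only [Measure.coe_add, Measure.coe_smul, Pi.add_apply, Pi.smul_apply, smul_eq_mul, h0,
    mul_zero, add_zero, ENNReal.toReal_mul]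
  rw [ENNReal.toReal_ofReal measureReal_nonneg]
  rfl

lemma killed_exit_upper (hfl : IsFluctuation r p q c F LP LM) (ha : a < 0) (hb : 0 < b)
    (hG : G = Measure.dirac 0 + ENNReal.ofReal r • (G ∗ jumpLaw p q c F).restrict (Ioo a b)) :
    ENNReal.ofReal r • (G ∗ jumpLaw p q c F).restrict (Ici b)
      = ENNReal.ofReal (r * (G ∗ jumpLaw p q c F).real (Ici b)) • (expMeasure c).map (b + ·) := by
  have := hfl.probF
  have := hfl.prob_jump
  have h : G (Ioi b) = 0 := measure_mono_null (fun y (hy : b < y) => by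
    simp only [mem_compl_iff, mem_Ioo, not_and, not_lt]
    exact fun _ => hy.le) (killed_compl ha hb hG)
  rw [restrict_conv_jumpLaw hfl.c_pos F hfl.F_neg G h, smul_smul,
    ENNReal.ofReal_mul hfl.r_pos.le, measureReal_def, ENNReal.ofReal_toReal (by finiteness)]

/-- Splitting G ∗ μ into the interval and its two complementary half-lines gives Ĝ(1 - rμ̂) = 1
minus the two exit transforms; the factorization then inverts 1 - rμ̂. -/
lemma charFun_killed (hfl : IsFluctuation r p q c F LP LM) (ha : a < 0) (hb : 0 < b)
    (hG : G = Measure.dirac 0 + ENNReal.ofReal r • (G ∗ jumpLaw p q c F).restrict (Ioo a b))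
    (α : ℝ) :
    charFun (ENNReal.ofReal (1 - r) • G) α = charFun LP α * charFun LM α *
      (1 - charFun (ENNReal.ofReal r • (G ∗ jumpLaw p q c F).restrict (Ici b)) α
        - charFun (ENNReal.ofReal r • (G ∗ jumpLaw p q c F).restrict (Iic a)) α) := by
  have := hfl.prob_jump
  have h1 := hfl.r_lt_one
  set μ := jumpLaw p q c F
  have e1 : G ∗ μ = (G ∗ μ).restrict (Ioo a b) + (G ∗ μ).restrict (Ici b)
      + (G ∗ μ).restrict (Iic a) := by
    conv_lhs => rw [← Measure.restrict_add_restrict_compl (μ := G ∗ μ) (measurableSet_Ioo (a := a) (b := b))]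
    rw [add_assoc]
    congr 1
    rw [← Measure.restrict_union _ measurableSet_Iic]
    · congr 1
      ext y
      simp only [mem_compl_iff, mem_Ioo, not_and, not_lt, mem_union, mem_Ici, mem_Iic]
      grind
    · rw [Set.disjoint_left]
      intro y (h1 : b ≤ y) (h2 : y ≤ a)
      linarith
  have e2 := congrArg (charFun · α) e1
  have e3 := congrArg (charFun · α) hG
  simp only [charFun_add, charFun_ofReal_smul hfl.r_pos.le, charFun_conv, charFun_dirac_zero]
    at e2 e3
  rw [charFun_ofReal_smul (by linarith), charFun_ofReal_smul hfl.r_pos.le,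
    charFun_ofReal_smul hfl.r_pos.le]
  refine mul_right_cancel₀ (hfl.one_sub_ne_zero α) ?_
  have e4 := hfl.charFun_sup_mul_inf α
  linear_combination (1 - r : ℝ) * e3 - (1 - r : ℝ) * r * e2 - (1 - r * charFun ((G ∗ μ).restrict (Ici b)) α
        - r * charFun ((G ∗ μ).restrict (Iic a)) α) * e4

/-- The transform of the position before exit is obtained by projection. -/
lemma charFun_killed_eq_projection (hfl : IsFluctuation r p q c F LP LM) (ha : a < 0) (hb : 0 < b)
    (hG : G = Measure.dirac 0 + ENNReal.ofReal r • (G ∗ jumpLaw p q c F).restrict (Ioo a b))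
    (α : ℝ) :
    charFun (ENNReal.ofReal (1 - r) • G) α = charFun LP α *
      (charFun (LM.restrict (Ioi a)) α - charFun ((LM ∗ (ENNReal.ofReal r •
        (G ∗ jumpLaw p q c F).restrict (Ici b))).restrict (Ioi a)) α) := by
  have := hfl.prob_jump
  have := hfl.prob_inf
  have := hfl.prob_sup
  have := isProbabilityMeasure_expMeasure hfl.c_pos
  have h1 := hfl.r_lt_one
  have h0 := hfl.sup_singleton_zero_le_one
  have hpos := hfl.sup_singleton_zero_pos
  set VP := ENNReal.ofReal r • (G ∗ jumpLaw p q c F).restrict (Ici b)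
  set VN := ENNReal.ofReal r • (G ∗ jumpLaw p q c F).restrict (Iic a)
  set VM := ENNReal.ofReal (1 - r) • G
  set pp := LP.real {0}
  -- `charFun_killed` multiplied by 1 - (1 - p₊)Ê, which removes φ₊, and rearranged so that both
  -- sides are positive measures.
  have key : VM + ENNReal.ofReal pp • (LM ∗ VP) + ENNReal.ofReal pp • (LM ∗ VN)
      = ENNReal.ofReal (1 - pp) • (VM ∗ expMeasure c) + ENNReal.ofReal pp • LM := by
    refine Measure.ext_of_charFun (funext fun α => ?_)
    simp only [charFun_add, charFun_ofReal_smul hpos.le, charFun_conv,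
      charFun_ofReal_smul (show 0 ≤ 1 - pp by linarith)]
    rw [hfl.charFun_killed ha hb hG]
    have h2 := hfl.charFun_sup_mul α
    push_cast
    linear_combination charFun LM α * (1 - charFun VP α - charFun VN α) * h2
  have hVM : VM (Ioo a b)ᶜ = 0 := by
    simp [VM, killed_compl ha hb hG]
  have hVMa : VM (Iic a) = 0 := measure_mono_null (fun y (hy : y ≤ a) => by
    simp only [mem_compl_iff, mem_Ioo, not_and, not_lt]
    exact fun h => absurd h (not_lt.2 hy)) hVM
  have hVN : VN (Ioi a) = 0 := by
    simp [VN, Measure.restrict_apply, Ioi_inter_Iic]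
  have hLN : (LM ∗ VN) (Ioi a) = 0 := by
    simpa using conv_Ioi_eq_zero LM VN hfl.inf_Ioi hVN
  have hVE : (VM ∗ expMeasure c) (Iic a) = 0 := by
    simpa using conv_Iic_eq_zero VM (expMeasure c)
      (measure_mono_null Iio_subset_Iic_self hVMa) (expMeasure_Iic_zero c)
  have hself : ∀ M : Measure ℝ, M (Iic a) = 0 → M.restrict (Ioi a) = M := by
    intro M hM
    refine Measure.restrict_eq_self_of_ae_mem ?_
    rw [ae_iff]
    simpa [Iic] using hM
  -- The killed walk and its convolution with Exp(c) live above a; the minimum convolved with the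
  -- lower exit law lives on (-∞, a] and disappears.
  have key2 := congrArg (fun M => charFun (M.restrict (Ioi a)) α) key
  simp only [Measure.restrict_add, Measure.restrict_smul, hself _ hVMa, hself _ hVE,
    Measure.restrict_eq_zero.2 hLN, smul_zero, add_zero, charFun_add,
    charFun_ofReal_smul hpos.le, charFun_conv,
    charFun_ofReal_smul (show 0 ≤ 1 - pp by linarith)] at key2
  have h2 := hfl.charFun_sup_mul α
  have h3 : (pp : ℂ) ≠ 0 := by exact_mod_cast hpos.ne'
  refine mul_left_cancel₀ h3 ?_
  push_cast at key2
  linear_combination charFun LP α * key2 - charFun VM α * h2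

/-- The equation from which the density of the position before exit is read off. -/
lemma killed_add_eq (hfl : IsFluctuation r p q c F LP LM) (ha : a < 0) (hb : 0 < b)
    (hG : G = Measure.dirac 0 + ENNReal.ofReal r • (G ∗ jumpLaw p q c F).restrict (Ioo a b)) :
    ∃ R : Measure ℝ, IsFiniteMeasure R ∧ R (Ioi a) = 0 ∧
      ENNReal.ofReal (1 - r) • G
        + ENNReal.ofReal (r * (G ∗ jumpLaw p q c F).real (Ici b)) •
          ((LM ∗ expMeasure (c * LP.real {0})).map (b + ·))
        + (ENNReal.ofReal (LP.real {0}) • R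
          + ENNReal.ofReal (1 - LP.real {0}) • (R ∗ expMeasure (c * LP.real {0})))
      = ENNReal.ofReal (LP.real {0}) • LM
          + ENNReal.ofReal (1 - LP.real {0}) • (LM ∗ expMeasure (c * LP.real {0})) := by
  have := hfl.prob_jump
  have := hfl.prob_inf
  have := hfl.prob_sup
  have := isProbabilityMeasure_expMeasure hfl.c_pos
  have := isProbabilityMeasure_expMeasure hfl.rho_pos
  have h0 := hfl.sup_singleton_zero_le_one
  have hpos := hfl.sup_singleton_zero_pos
  have hr := hfl.r_pos
  have hup := hfl.killed_exit_upper ha hb hG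
  set VN := ENNReal.ofReal r • (G ∗ jumpLaw p q c F).restrict (Iic a) with hVNdef
  set pp := LP.real {0}
  set Q := r * (G ∗ jumpLaw p q c F).real (Ici b)
  have hQ : 0 ≤ Q := by positivity
  have hVN : VN (Ioi a) = 0 := by
    simp [VN, Measure.restrict_apply, Ioi_inter_Iic]
  -- R is the minimum convolved with the lower exit law. Only its support will matter.
  refine ⟨LM ∗ VN, inferInstance, ?_, ?_⟩
  · simpa using conv_Ioi_eq_zero LM VN hfl.inf_Ioi hVN
  refine Measure.ext_of_charFun (funext fun α => ?_)
  have e1 := hfl.charFun_killed ha hb hG α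
  rw [hup, ← hVNdef, charFun_ofReal_smul hQ, charFun_map_const_add] at e1
  have e2 := hfl.charFun_sup_mul_exp α
  have e3 : charFun LP α = pp + (1 - pp : ℝ) * charFun (expMeasure (c * pp)) α := by
    conv_lhs => rw [hfl.sup_eq]
    rw [charFun_add, charFun_ofReal_smul hpos.le, charFun_ofReal_smul (by linarith),
      charFun_dirac_zero, mul_one]
  simp only [charFun_add, charFun_ofReal_smul hpos.le, charFun_conv, charFun_ofReal_smul hQ,
      charFun_ofReal_smul (show 0 ≤ 1 - pp by linarith), charFun_map_const_add]
  set E := Complex.exp (inner ℝ b α * Complex.I)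
  linear_combination e1 - Q * charFun LM α * E * e2 + charFun LM α * (1 - charFun VN α) * e3

end IsFluctuation

end ExitProblem

end

noncomputable section

namespace ExitProblem


/-! ### Densities of convolutions with exponential distributions -/

/-- Writing e^{-ρ(z-y)} as e^{-ρz}e^{ρy} separates the variables. In particular, above the support
of A the density is a constant multiple of e^{-ρz}. -/
lemma conv_expMeasure_eq_withDensity {ρ : ℝ} (hρ : 0 < ρ) (A : Measure ℝ) [SFinite A] :
    A ∗ expMeasure ρ = volume.withDensity fun z => ENNReal.ofReal (ρ * Real.exp (-(ρ * z)))
      * ∫⁻ y in Iio z, ENNReal.ofReal (Real.exp (ρ * y)) ∂A := by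
  have := isProbabilityMeasure_expMeasure hρ
  set k : ℝ × ℝ → ℝ≥0∞ := fun w => {w : ℝ × ℝ | w.2 < w.1}.indicator
    (fun w => ENNReal.ofReal (ρ * Real.exp (-(ρ * w.1))) * ENNReal.ofReal (Real.exp (ρ * w.2))) w
    with hk
  have hkm : Measurable k := by
    refine Measurable.indicator (by fun_prop) (measurableSet_lt measurable_snd measurable_fst)
  have h1 : ∀ z, ENNReal.ofReal (ρ * Real.exp (-(ρ * z)))
      * ∫⁻ y in Iio z, ENNReal.ofReal (Real.exp (ρ * y)) ∂A = ∫⁻ y, k (z, y) ∂A := by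
    intro z
    rw [← lintegral_const_mul _ (by fun_prop), ← lintegral_indicator measurableSet_Iio]
    rfl
  simp_rw [h1]
  refine Measure.ext_of_lintegral _ fun f hf => ?_
  rw [Measure.lintegral_conv hf, lintegral_withDensity_eq_lintegral_mul _
    (Measurable.lintegral_prod_right' hkm) hf]
  simp only [Pi.mul_apply]
  have h2 : ∀ z, (∫⁻ y, k (z, y) ∂A) * f z = ∫⁻ y, k (z, y) * f z ∂A := fun z =>
    (lintegral_mul_const _ (by fun_prop)).symm
  simp_rw [h2]
  rw [lintegral_lintegral_swap (μ := volume) (f := fun z y => k (z, y) * f z) (by fun_prop)]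
  refine lintegral_congr fun y => ?_
  rw [lintegral_expMeasure ρ (by fun_prop), ← lintegral_indicator measurableSet_Ioi,
    ← lintegral_add_left_eq_self (μ := (volume : Measure ℝ)) (fun z => k (z, y) * f z) y]
  refine lintegral_congr fun u => ?_
  simp only [hk, indicator, mem_Ioi, mem_ofPred_eq, lt_add_iff_pos_right]
  split_ifs
  · congr 1
    rw [← ENNReal.ofReal_mul (by positivity), mul_assoc, ← Real.exp_add]
    ring_nf
  · simp

lemma conv_expMeasure_real {ρ : ℝ} (hρ : 0 < ρ) (A : Measure ℝ) [IsFiniteMeasure A] :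
    Integrable (fun z => ρ * Real.exp (-(ρ * z)) * ∫ y in Iio z, Real.exp (ρ * y) ∂A) ∧
    ∀ B, MeasurableSet B → (A ∗ expMeasure ρ).real B
      = ∫ z in B, ρ * Real.exp (-(ρ * z)) * ∫ y in Iio z, Real.exp (ρ * y) ∂A := by
  have := isProbabilityMeasure_expMeasure hρ
  set g := fun z => ENNReal.ofReal (ρ * Real.exp (-(ρ * z)))
      * ∫⁻ y in Iio z, ENNReal.ofReal (Real.exp (ρ * y)) ∂A with hg
  have hgm : Measurable g := by
    refine Measurable.mul (by fun_prop) ?_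
    have hmono : Monotone fun z => ∫⁻ y in Iio z, ENNReal.ofReal (Real.exp (ρ * y)) ∂A :=
      fun z z' hz => lintegral_mono_set (Iio_subset_Iio hz)
    exact hmono.measurable
  have heq : ∀ z, ρ * Real.exp (-(ρ * z)) * ∫ y in Iio z, Real.exp (ρ * y) ∂A = (g z).toReal := by
    intro z
    rw [hg, ENNReal.toReal_mul, ENNReal.toReal_ofReal (by positivity),
      integral_eq_lintegral_of_nonneg_ae (ae_of_all _ fun y => (Real.exp_pos _).le) (by fun_prop)]
  have htot : ∫⁻ z, g z ≠ ∞ := by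
    have h := conv_expMeasure_eq_withDensity hρ A
    have h2 : (A ∗ expMeasure ρ) univ = ∫⁻ z, g z := by
      rw [h, withDensity_apply _ MeasurableSet.univ, setLIntegral_univ]
    rw [← h2]
    finiteness
  simp_rw [heq]
  refine ⟨integrable_toReal_of_lintegral_ne_top hgm.aemeasurable htot, fun B hB => ?_⟩
  rw [integral_toReal hgm.aemeasurable, measureReal_def, conv_expMeasure_eq_withDensity hρ A,
    withDensity_apply _ hB]
  exact ae_restrict_of_ae (ae_lt_top hgm htot)

/-! ### Elimination of the lower exit from the law of the killed walk. -/

namespace IsFluctuation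

variable {r p q c : ℝ} {F LP LM : Measure ℝ}

lemma integrable_exp_mul_inf (hfl : IsFluctuation r p q c F LP LM) {ρ : ℝ} (hρ : 0 < ρ) :
    Integrable (fun y => Real.exp (ρ * y)) LM := by
  have := hfl.prob_inf
  have h : ∀ᵐ y ∂LM, y ≤ 0 := by
    rw [ae_iff]
    simpa [Ioi] using hfl.inf_Ioi
  refine Integrable.mono' (integrable_const (1 : ℝ)) (by fun_prop) ?_
  filter_upwards [h] with y hy
  rw [Real.norm_of_nonneg (Real.exp_pos _).le, Real.exp_le_one_iff]
  exact mul_nonpos_of_nonneg_of_nonpos hρ.le hy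

variable {G : Measure ℝ} [IsFiniteMeasure G] {a b : ℝ}

/-- The absolutely continuous part of the law of the killed walk which does not come from the
law of the minimum. -/
def killedDensity (pp ρ Q b : ℝ) (LM : Measure ℝ) (z : ℝ) : ℝ :=
  ρ * Q * ∫ y in Ici (z - b), Real.exp (ρ * (y - (z - b))) ∂LM
    - (1 - pp) * ρ * ∫ y in Ici z, Real.exp (ρ * (y - z)) ∂LM

/-- In `killed_add_eq` every term but p₊LM and p₊R is absolutely continuous, and R vanishes above a.
There the density is a multiple K of ρe^{-ρz} plus `killedDensity`; K contains the unknown lower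
exit, and equals 0 because nothing lies beyond b. -/
lemma killed_real_eq (hfl : IsFluctuation r p q c F LP LM) (ha : a < 0) (hb : 0 < b)
    (hG : G = Measure.dirac 0 + ENNReal.ofReal r • (G ∗ jumpLaw p q c F).restrict (Ioo a b)) :
    IntegrableOn (killedDensity (LP.real {0}) (c * LP.real {0})
      (r * (G ∗ jumpLaw p q c F).real (Ici b)) b LM) (Ioo a b) ∧
    ∀ B, MeasurableSet B → B ⊆ Ioo a b →
      (ENNReal.ofReal (1 - r) • G).real B = LP.real {0} * LM.real B
        + ∫ z in B, killedDensity (LP.real {0}) (c * LP.real {0})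
            (r * (G ∗ jumpLaw p q c F).real (Ici b)) b LM z := by
  have := hfl.prob_inf
  have hr := hfl.r_pos
  have hρ := hfl.rho_pos
  have hpos := hfl.sup_singleton_zero_pos
  have hle := hfl.sup_singleton_zero_le_one
  have := isProbabilityMeasure_expMeasure hρ
  have hcompl := killed_compl ha hb hG
  obtain ⟨N, hN, hNa, hkey⟩ := hfl.killed_add_eq ha hb hG
  set pp := LP.real {0}
  set ρ := c * pp
  set Q := r * (G ∗ jumpLaw p q c F).real (Ici b)
  have hQ : 0 ≤ Q := by positivity
  set VM := ENNReal.ofReal (1 - r) • G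
  set LMb : Measure ℝ := LM.map (b + ·)
  have hLMb : (LM ∗ expMeasure ρ).map (b + ·) = LMb ∗ expMeasure ρ := by
    rw [← Measure.dirac_conv, ← Measure.conv_assoc, Measure.dirac_conv]
  have : IsFiniteMeasure LMb := inferInstance
  rw [hLMb] at hkey
  obtain ⟨hi1, he1⟩ := conv_expMeasure_real hρ LM
  obtain ⟨hi2, he2⟩ := conv_expMeasure_real hρ LMb
  obtain ⟨hi3, he3⟩ := conv_expMeasure_real hρ N
  set e1 := fun z => ρ * Real.exp (-(ρ * z)) * ∫ y in Iio z, Real.exp (ρ * y) ∂LM with he1def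
  set e2 := fun z => ρ * Real.exp (-(ρ * z)) * ∫ y in Iio z, Real.exp (ρ * y) ∂LMb with he2def
  set e3 := fun z => ρ * Real.exp (-(ρ * z)) * ∫ y in Iio z, Real.exp (ρ * y) ∂N with he3def
  set d := fun z => (1 - pp) * e1 z - Q * e2 z - (1 - pp) * e3 z with hd
  have hdi : Integrable d := ((hi1.const_mul _).sub (hi2.const_mul _)).sub (hi3.const_mul _)
  have hmain : ∀ B, MeasurableSet B → B ⊆ Ioi a → VM.real B = pp * LM.real B + ∫ z in B, d z := by
    intro B hB hBa
    have h := congrArg (fun M : Measure ℝ => (M B).toReal) hkey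
    have hNB : N B = 0 := measure_mono_null hBa hNa
    simp only [Measure.coe_add, Measure.coe_smul, Pi.add_apply, Pi.smul_apply, smul_eq_mul,
      hNB, mul_zero, zero_add] at h
    rw [ENNReal.toReal_add (by finiteness) (by finiteness),
      ENNReal.toReal_add (by finiteness) (by finiteness),
      ENNReal.toReal_add (by finiteness) (by finiteness), ENNReal.toReal_mul, ENNReal.toReal_mul,
      ENNReal.toReal_mul, ENNReal.toReal_mul, ENNReal.toReal_ofReal hQ,
      ENNReal.toReal_ofReal (by linarith), ENNReal.toReal_ofReal hpos.le] at h
    have h1 := he1 B hB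
    have h2 := he2 B hB
    have h3 := he3 B hB
    simp only [measureReal_def] at h1 h2 h3 ⊢
    rw [h1, h2, h3] at h
    simp only [hd]
    have hi12 : IntegrableOn (fun z => (1 - pp) * e1 z - Q * e2 z) B :=
      ((hi1.const_mul _).sub (hi2.const_mul _)).integrableOn
    rw [integral_sub hi12 (hi3.const_mul _).integrableOn, integral_sub (hi1.const_mul _).integrableOn
      (hi2.const_mul _).integrableOn, integral_const_mul, integral_const_mul, integral_const_mul]
    linarith
  set L := ∫ y, Real.exp (ρ * y) ∂LM
  set r0 := ∫ y, Real.exp (ρ * y) ∂N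
  have hLi := hfl.integrable_exp_mul_inf hρ
  -- Passing to the complementary integrals isolates a constant times e^{-ρz} and leaves terms that
  -- vanish for z > b.
  have hLz : ∀ z, ∫ y in Iio z, Real.exp (ρ * y) ∂LM = L - ∫ y in Ici z, Real.exp (ρ * y) ∂LM := by
    intro z
    have h := integral_add_compl (measurableSet_Iio (a := z)) hLi
    rw [compl_Iio] at h
    linarith
  have hLbz : ∀ z, ∫ y in Iio z, Real.exp (ρ * y) ∂LMb
      = Real.exp (ρ * b) * (L - ∫ y in Ici (z - b), Real.exp (ρ * y) ∂LM) := by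
    intro z
    rw [← hLz, ← integral_const_mul, setIntegral_map measurableSet_Iio (by fun_prop) (by fun_prop)]
    have : (b + ·) ⁻¹' Iio z = Iio (z - b) := by
      ext y
      simp [lt_sub_iff_add_lt']
    rw [this]
    congr with y
    rw [← Real.exp_add]
    ring_nf
  -- The measure `N` lives on (-∞, a], so above a its truncated integral no longer depends on z.
  have hNz : ∀ z, a < z → ∫ y in Iio z, Real.exp (ρ * y) ∂N = r0 := by
    intro z hz
    congr 1
    refine Measure.restrict_eq_self_of_ae_mem ?_
    rw [ae_iff]
    exact measure_mono_null (fun y (hy : ¬ y < z) => hz.trans_le (not_lt.1 hy)) hNa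
  have hd1 : ∀ z, a < z → d z = ρ * Real.exp (-(ρ * z)) *
      ((1 - pp) * L - Q * Real.exp (ρ * b) * L - (1 - pp) * r0)
      + killedDensity pp ρ Q b LM z := by
    intro z hz
    have h1 : ∫ y in Ici (z - b), Real.exp (ρ * (y - (z - b))) ∂LM
        = Real.exp (-(ρ * z)) * Real.exp (ρ * b) * ∫ y in Ici (z - b), Real.exp (ρ * y) ∂LM := by
      rw [← integral_const_mul]
      congr with y
      rw [← Real.exp_add, ← Real.exp_add]
      ring_nf
    have h2 : ∫ y in Ici z, Real.exp (ρ * (y - z)) ∂LM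
        = Real.exp (-(ρ * z)) * ∫ y in Ici z, Real.exp (ρ * y) ∂LM := by
      rw [← integral_const_mul]
      congr with y
      rw [← Real.exp_add]
      ring_nf
    simp only [hd, he1def, he2def, he3def]
    rw [hNz z hz, hLbz, hLz, killedDensity, h1, h2]
    ring
  have hkd0 : ∀ z, b < z → killedDensity pp ρ Q b LM z = 0 := by
    intro z hz
    have h0 : ∀ w, 0 < w → LM.restrict (Ici w) = 0 := fun w hw => Measure.restrict_eq_zero.2
      (measure_mono_null (fun y (hy : w ≤ y) => hw.trans_le hy) hfl.inf_Ioi)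
    rw [killedDensity, h0 _ (by linarith), h0 _ (by linarith)]
    simp
  -- On (b, b+1) neither the killed walk nor the minimum has mass and `killedDensity` vanishes, so K
  -- times a positive integral is 0. Any nondegenerate bounded interval beyond b would do.
  have hK : (1 - pp) * L - Q * Real.exp (ρ * b) * L - (1 - pp) * r0 = 0 := by
    have h := hmain (Ioo b (b + 1)) measurableSet_Ioo
      (fun y hy => show a < y by linarith [hy.1])
    have h1 : VM.real (Ioo b (b + 1)) = 0 := by
      rw [measureReal_def, show VM (Ioo b (b + 1)) = 0 from ?_, ENNReal.toReal_zero]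
      have : G (Ioo b (b + 1)) = 0 := measure_mono_null (fun y hy => by
        simp only [mem_compl_iff, mem_Ioo, not_and, not_lt]
        exact fun _ => hy.1.le) hcompl
      simp [VM, this]
    have h2 : LM.real (Ioo b (b + 1)) = 0 := by
      rw [measureReal_def, measure_mono_null (fun y hy => ?_) hfl.inf_Ioi, ENNReal.toReal_zero]
      exact hb.trans hy.1
    rw [h1, h2, mul_zero, zero_add, setIntegral_congr_fun (g := fun z => ρ * Real.exp (-(ρ * z)) *
      ((1 - pp) * L - Q * Real.exp (ρ * b) * L - (1 - pp) * r0)) measurableSet_Ioo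
      (fun z hz => by
        simp only [hd1 z (by linarith [hz.1]), hkd0 z hz.1, add_zero]),
      integral_mul_const] at h
    have h3 : 0 < ∫ z in Ioo b (b + 1), ρ * Real.exp (-(ρ * z)) := by
      rw [setIntegral_pos_iff_support_of_nonneg_ae (ae_of_all _ fun z => by positivity)]
      · have : Function.support (fun z => ρ * Real.exp (-(ρ * z))) = univ := by
          ext z
          simp [hρ.ne']
        rw [this]
        simp
      · have hcont : Continuous fun z => ρ * Real.exp (-(ρ * z)) := by fun_prop
        exact (hcont.integrableOn_Icc (a := b) (b := b + 1)).mono_set Ioo_subset_Icc_self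
    rcases mul_eq_zero.1 h.symm with h4 | h4
    · exact absurd h4 h3.ne'
    · exact h4
  have hd2 : ∀ z, a < z → d z = killedDensity pp ρ Q b LM z := by
    intro z hz
    rw [hd1 z hz, hK, mul_zero, zero_add]
  refine ⟨hdi.integrableOn.congr_fun (fun z hz => hd2 z hz.1) measurableSet_Ioo,
    fun B hB hBab => ?_⟩
  rw [hmain B hB fun z hz => (hBab hz).1]
  congr 1
  exact setIntegral_congr_fun hB fun z hz => hd2 z (hBab hz).1

end IsFluctuation

end ExitProblem

end

noncomputable section

namespace ExitProblem


/-! ### The density of the killed walk -/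

/-- Dominated convergence: the indicator of [v, ∞) at y is constant for v near w unless y = w. -/
lemma continuousAt_setIntegral_Ici {A : Measure ℝ} {f : ℝ → ℝ} (hf : Integrable f A) {w : ℝ}
    (hw : A {w} = 0) : ContinuousAt (fun w => ∫ y in Ici w, f y ∂A) w := by
  have h : ∀ w, ∫ y in Ici w, f y ∂A = ∫ y, (Ici w).indicator f y ∂A := fun w =>
    (integral_indicator measurableSet_Ici).symm
  simp_rw [h]
  refine continuousAt_of_dominated (bound := fun y => ‖f y‖) ?_ ?_ hf.norm ?_
  · exact Filter.Eventually.of_forall fun w => (hf.indicator measurableSet_Ici).aestronglyMeasurable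
  · exact Filter.Eventually.of_forall fun w => ae_of_all _ fun y => norm_indicator_le_norm_self _ _
  · have hne : ∀ᵐ y ∂A, y ≠ w := by
      rw [ae_iff]
      simpa using hw
    filter_upwards [hne] with y hy
    rcases lt_or_gt_of_ne hy with h1 | h1
    · refine (continuousAt_const (y := (0 : ℝ))).congr ?_
      filter_upwards [lt_mem_nhds h1] with v hv
      rw [indicator_of_notMem]
      simpa using hv
    · refine (continuousAt_const (y := f y)).congr ?_
      filter_upwards [gt_mem_nhds h1] with v hv
      rw [indicator_of_mem]
      exact le_of_lt hv

/-- The left-continuous distribution function jumps by the mass of w immediately to the right of w.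
-/
lemma measure_singleton_eq_zero_of_continuousAt (A : Measure ℝ) [IsFiniteMeasure A] {w : ℝ}
    (hw : ContinuousAt (fun z => A.real (Iio z)) w) : A {w} = 0 := by
  have h1 : ∀ᶠ z in nhdsWithin w (Ioi w), A.real {w} ≤ A.real (Iio z) - A.real (Iio w) := by
    filter_upwards [self_mem_nhdsWithin] with z (hz : w < z)
    rw [le_sub_iff_add_le, add_comm, ← measureReal_union (by simp) (measurableSet_singleton w)]
    refine measureReal_mono ?_
    rintro y (hy | hy)
    · exact lt_trans hy hz
    · rw [mem_singleton_iff.1 hy]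
      exact hz
  have h2 : Filter.Tendsto (fun z => A.real (Iio z) - A.real (Iio w)) (nhdsWithin w (Ioi w))
      (nhds 0) := by
    have h3 := (hw.tendsto.mono_left (nhdsWithin_le_nhds (s := Ioi w))).sub_const (A.real (Iio w))
    simpa using h3
  have h4 := ge_of_tendsto h2 h1
  have h5 : A.real {w} = 0 := le_antisymm h4 measureReal_nonneg
  simpa [measureReal_eq_zero_iff] using h5

/-- The computation produces integrals over [w, ∞), the formula for h has (w, 0]; they differ by the
endpoint w and a null set. -/
lemma setIntegral_Ici_eq_Ioc {A : Measure ℝ} (hA : A (Ioi 0) = 0) {w : ℝ} (hw : A {w} = 0)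
    (f : ℝ → ℝ) : ∫ y in Ici w, f y ∂A = ∫ y in Ioc w 0, f y ∂A := by
  refine setIntegral_congr_set ?_
  have h0 : ∀ᵐ y ∂A, y ≤ 0 := by
    rw [ae_iff]
    simpa [Ioi] using hA
  have hne : ∀ᵐ y ∂A, y ≠ w := by
    rw [ae_iff]
    simpa using hw
  filter_upwards [h0, hne] with y h1 h2
  refine propext ⟨fun (h : w ≤ y) => ⟨lt_of_le_of_ne h h2.symm, h1⟩, fun h => h.1.le⟩

namespace IsFluctuation

variable {r p q c : ℝ} {F LP LM : Measure ℝ}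

/-- A convolution with a law without atoms has none, so in Lindley's equation atoms can only come
from the point 0. -/
lemma inf_singleton (hfl : IsFluctuation r p q c F LP LM) (hF : ∀ y, F {y} = 0) {z : ℝ}
    (hz : z ≠ 0) : LM {z} = 0 := by
  have := hfl.prob_inf
  have := hfl.prob_jump
  have hexp : ∀ y, expMeasure c {y} = 0 := fun y =>
    expMeasure_absolutelyContinuous c (by simp)
  have hμ : ∀ y, jumpLaw p q c F {y} = 0 := fun y => by simp [jumpLaw, hF, hexp]
  have hconv : (LM ∗ jumpLaw p q c F) {z} = 0 := by
    rw [← lintegral_indicator_one (measurableSet_singleton z), Measure.lintegral_conv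
      (measurable_one.indicator (measurableSet_singleton z))]
    have : ∀ y u, ({z} : Set ℝ).indicator (1 : ℝ → ℝ≥0∞) (y + u)
        = ({z - y} : Set ℝ).indicator 1 u := by
      intro y u
      simp only [indicator, mem_singleton_iff, Pi.one_apply]
      simp [eq_sub_iff_add_eq, add_comm]
    simp_rw [this, lintegral_indicator_one (measurableSet_singleton _), hμ, lintegral_zero]
  rw [hfl.lindley_inf, map_min_zero]
  have h0 : (LM ∗ jumpLaw p q c F).restrict (Iio 0) {z} = 0 :=
    Measure.absolutelyContinuous_of_le Measure.restrict_le_self hconv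
  simp [h0, hz.symm]

lemma inf_restrict_absolutelyContinuous (hfl : IsFluctuation r p q c F LP LM) (hF : F ≪ volume) :
    LM.restrict (Iio 0) ≪ volume := by
  have := hfl.prob_jump
  have hμ : jumpLaw p q c F ≪ volume :=
    Measure.AbsolutelyContinuous.add_left (hF.smul_left _)
      ((expMeasure_absolutelyContinuous c).smul_left _)
  have hconv : LM ∗ jumpLaw p q c F ≪ volume := Measure.conv_absolutelyContinuous hμ
  rw [hfl.lindley_inf, map_min_zero]
  simp only [Measure.restrict_add, Measure.restrict_smul, smul_add]
  have h0 : (Measure.dirac (0 : ℝ)).restrict (Iio 0) = 0 := by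
    simp [Measure.restrict_eq_zero, Measure.dirac_apply' _ measurableSet_Iio]
  rw [h0]
  simp only [smul_zero, zero_add, add_zero]
  exact ((Measure.absolutelyContinuous_of_le Measure.restrict_le_self).trans
    ((Measure.absolutelyContinuous_of_le Measure.restrict_le_self).trans hconv)).smul_left _

/-- The density `h`, in terms of the law `LM` of the minimum. -/
def positionDensity (pp ρ Q b : ℝ) (LM : Measure ℝ) (z : ℝ) : ℝ :=
  (if z < 0 then pp * deriv (fun w => LM.real (Iio w)) z
      - (1 - pp) * ρ * ∫ y in Ioc z 0, Real.exp (ρ * (y - z)) ∂LM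
    else 0)
  + ρ * Q * ∫ y in Ioc (z - b) 0, Real.exp (ρ * (y - (z - b))) ∂LM

lemma killedDensity_eq (hfl : IsFluctuation r p q c F LP LM) {pp ρ Q b z : ℝ}
    (hz : LM {z} = 0) (hzb : LM {z - b} = 0) :
    killedDensity pp ρ Q b LM z
      = (if z < 0 then - ((1 - pp) * ρ * ∫ y in Ioc z 0, Real.exp (ρ * (y - z)) ∂LM) else 0)
        + ρ * Q * ∫ y in Ioc (z - b) 0, Real.exp (ρ * (y - (z - b))) ∂LM := by
  rw [killedDensity, setIntegral_Ici_eq_Ioc hfl.inf_Ioi hz, setIntegral_Ici_eq_Ioc hfl.inf_Ioi hzb]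
  split_ifs with h
  · ring
  · rw [Ioc_eq_empty (not_lt.2 (not_lt.1 h))]
    simp

lemma continuousAt_killedDensity (hfl : IsFluctuation r p q c F LP LM) {pp ρ Q b z : ℝ}
    (hρ : 0 < ρ) (hz : LM {z} = 0) (hzb : LM {z - b} = 0) :
    ContinuousAt (killedDensity pp ρ Q b LM) z := by
  have hi := hfl.integrable_exp_mul_inf hρ
  have h : ∀ w, ∫ y in Ici w, Real.exp (ρ * (y - w)) ∂LM
      = Real.exp (-(ρ * w)) * ∫ y in Ici w, Real.exp (ρ * y) ∂LM := by
    intro w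
    rw [← integral_const_mul]
    congr with y
    rw [← Real.exp_add]
    ring_nf
  have h1 : ∀ w, LM {w} = 0 →
      ContinuousAt (fun w => ∫ y in Ici w, Real.exp (ρ * (y - w)) ∂LM) w := by
    intro w hw
    simp_rw [h]
    exact ContinuousAt.mul (by fun_prop) (continuousAt_setIntegral_Ici hi hw)
  have h2 : ContinuousAt (fun z => ∫ y in Ici (z - b), Real.exp (ρ * (y - (z - b))) ∂LM) z :=
    ContinuousAt.comp (f := fun z => z - b) (h1 (z - b) hzb) (by fun_prop)
  exact (h2.const_mul _).sub ((h1 z hz).const_mul _)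

variable {G : Measure ℝ} [IsFiniteMeasure G] {a b : ℝ}

lemma hasDerivAt_killed (hfl : IsFluctuation r p q c F LP LM) (ha : a < 0) (hb : 0 < b)
    (hG : G = Measure.dirac 0 + ENNReal.ofReal r • (G ∗ jumpLaw p q c F).restrict (Ioo a b))
    {z : ℝ} (haz : a < z) (hzb : z < b) (hz0 : z ≠ 0)
    (hdiff : z < 0 → DifferentiableAt ℝ (fun w => LM.real (Iio w)) z)
    (hatom : LM {z - b} = 0) :
    HasDerivAt (fun w => (ENNReal.ofReal (1 - r) • G).real (Iio w))
      (positionDensity (LP.real {0}) (c * LP.real {0})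
        (r * (G ∗ jumpLaw p q c F).real (Ici b)) b LM z) z := by
  have := hfl.prob_inf
  obtain ⟨hint, heq⟩ := hfl.killed_real_eq ha hb hG
  have hcompl := killed_compl ha hb hG
  have hρ := hfl.rho_pos
  set pp := LP.real {0}
  set ρ := c * pp
  set Q := r * (G ∗ jumpLaw p q c F).real (Ici b)
  set VM := ENNReal.ofReal (1 - r) • G
  set k := killedDensity pp ρ Q b LM with hk
  -- Below 0 differentiability of the distribution function excludes an atom; above 0 the minimum
  -- has no mass.
  have hatomz : LM {z} = 0 := by
    rcases lt_or_gt_of_ne hz0 with h | h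
    · exact measure_singleton_eq_zero_of_continuousAt LM (hdiff h).continuousAt
    · exact measure_mono_null (fun y hy => by rw [mem_singleton_iff.1 hy]; exact h) hfl.inf_Ioi
  have hPM : HasDerivAt (fun w => LM.real (Iio w))
      (if z < 0 then deriv (fun w => LM.real (Iio w)) z else 0) z := by
    split_ifs with h
    · exact (hdiff h).hasDerivAt
    · have h' : 0 < z := lt_of_le_of_ne (not_lt.1 h) hz0.symm
      refine (hasDerivAt_const z (1 : ℝ)).congr_of_eventuallyEq ?_
      filter_upwards [lt_mem_nhds h'] with w hw
      rw [measureReal_def, (prob_compl_eq_zero_iff measurableSet_Iio).1, ENNReal.toReal_one]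
      rw [compl_Iio]
      exact measure_mono_null (fun y (hy : w ≤ y) => lt_of_lt_of_le hw hy) hfl.inf_Ioi
  have hint' : IntervalIntegrable k volume a z := by
    rw [intervalIntegrable_iff_integrableOn_Ioo_of_le haz.le]
    exact hint.mono_set (Ioo_subset_Ioo_right hzb.le)
  have hmeas : StronglyMeasurableAtFilter k (nhds z) :=
    ⟨Ioo a b, Ioo_mem_nhds haz hzb, hint.aestronglyMeasurable⟩
  have hI := intervalIntegral.integral_hasDerivAt_right hint' hmeas
    (hfl.continuousAt_killedDensity hρ hatomz hatom)
  have hsum := (hPM.const_mul pp).add hI |>.sub_const (pp * LM.real (Iic a))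
  have hval : pp * (if z < 0 then deriv (fun w => LM.real (Iio w)) z else 0) + k z
      = positionDensity pp ρ Q b LM z := by
    rw [hk, hfl.killedDensity_eq hatomz hatom, positionDensity]
    split_ifs <;> ring
  rw [hval] at hsum
  refine hsum.congr_of_eventuallyEq ?_
  filter_upwards [Ioo_mem_nhds haz hzb] with w hw
  -- The killed walk charges only (a, b), so the distribution function is the mass of (a, w), to
  -- which `killed_real_eq` applies.
  have h1 : VM.real (Iio w) = VM.real (Ioo a w) := by
    simp only [measureReal_def]
    congr 1
    refine measure_congr ?_
    have : ∀ᵐ y ∂VM, y ∈ Ioo a b := by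
      rw [ae_iff]
      have h0 : VM (Ioo a b)ᶜ = 0 := by simp [VM, hcompl]
      exact h0
    filter_upwards [this] with y hy
    refine propext ⟨fun h => ⟨hy.1, h⟩, fun h => h.2⟩
  have h2 : LM.real (Ioo a w) = LM.real (Iio w) - LM.real (Iic a) := by
    rw [eq_sub_iff_add_eq, add_comm, ← measureReal_union _ measurableSet_Ioo]
    · congr 1
      exact Iic_union_Ioo_eq_Iio hw.1
    · rw [Set.disjoint_left]
      intro y (h : y ≤ a) h'
      exact absurd h'.1 (not_lt.2 h)
  rw [h1, heq _ measurableSet_Ioo (Ioo_subset_Ioo_right hw.2.le), h2]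
  simp only [Pi.add_apply]
  rw [intervalIntegral.integral_of_le hw.1.le, integral_Ioc_eq_integral_Ioo]
  ring

/-- Lebesgue differentiation for `cdf`, which is built from closed half-lines; it agrees with the
open version below 0 because there are no atoms there. -/
lemma ae_hasDerivAt_inf (hfl : IsFluctuation r p q c F LP LM) (hF : F ≪ volume) :
    ∀ᵐ z, z < 0 → deriv (fun w => LM.real (Iio w)) z = (LM.rnDeriv volume z).toReal := by
  have := hfl.prob_inf
  have h := StieltjesFunction.ae_hasDerivAt (cdf LM)
  rw [measure_cdf] at h
  filter_upwards [h] with z hz hz0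
  refine HasDerivAt.deriv (hz.congr_of_eventuallyEq ?_)
  filter_upwards [gt_mem_nhds hz0] with w hw
  rw [cdf_eq_real, ← Iio_union_right, measureReal_union (by simp) (measurableSet_singleton w),
    measureReal_def LM {w}, hfl.inf_singleton (fun y => hF (by simp)) hw.ne, ENNReal.toReal_zero,
    add_zero]

lemma inf_real_eq (hfl : IsFluctuation r p q c F LP LM) (hF : F ≪ volume) {B : Set ℝ}
    (hB : MeasurableSet B) :
    LM.real B = LM.real {0} * (Measure.dirac (0 : ℝ)).real B
      + ∫ z in B ∩ Iio 0, (LM.rnDeriv volume z).toReal := by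
  have := hfl.prob_inf
  have h1 : LM.real B = LM.real (B ∩ {0}) + LM.real (B ∩ Iio 0) := by
    rw [← measureReal_union _ (hB.inter measurableSet_Iio)]
    · simp only [measureReal_def]
      congr 1
      refine measure_congr ?_
      have h0 : ∀ᵐ y ∂LM, y ≤ 0 := by
        rw [ae_iff]
        simpa [Ioi] using hfl.inf_Ioi
      filter_upwards [h0] with y hy
      refine propext ⟨fun (h : y ∈ B) => ?_, fun h => ?_⟩
      · rcases hy.eq_or_lt with h' | h'
        · exact Or.inl ⟨h, h'⟩
        · exact Or.inr ⟨h, h'⟩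
      · rcases h with h | h
        · exact h.1
        · exact h.1
    · rw [Set.disjoint_left]
      rintro y ⟨_, h⟩ ⟨_, h'⟩
      rw [mem_singleton_iff.1 h] at h'
      exact lt_irrefl (0 : ℝ) h'
  rw [h1]
  congr 1
  · by_cases h0 : (0 : ℝ) ∈ B
    · rw [inter_eq_right.2 (singleton_subset_iff.2 h0)]
      simp [measureReal_def, h0]
    · rw [inter_singleton_eq_empty.2 h0]
      simp [measureReal_def, Measure.dirac_apply' _ hB, h0]
  · have hac := hfl.inf_restrict_absolutelyContinuous hF
    have h2 : LM (B ∩ Iio 0) = ∫⁻ z in B ∩ Iio 0, LM.rnDeriv volume z := by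
      rw [← Measure.restrict_apply hB, ← Measure.setLIntegral_rnDeriv hac,
        lintegral_congr_ae (ae_restrict_of_ae (Measure.rnDeriv_restrict LM volume measurableSet_Iio)),
        setLIntegral_indicator measurableSet_Iio, inter_comm]
    rw [integral_toReal (by fun_prop), measureReal_def, h2]
    exact ae_restrict_of_ae (Measure.rnDeriv_lt_top LM volume)

/-- In `killed_real_eq` the term p₊LM splits into an atom of mass p₊p₋ = 1 - r at 0 and p₊ times the
derivative of the distribution function, which completes `killedDensity` to `positionDensity` almost
everywhere. -/
lemma killed_eq_dirac_add_withDensity (hfl : IsFluctuation r p q c F LP LM) (hF : F ≪ volume)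
    (ha : a < 0) (hb : 0 < b)
    (hG : G = Measure.dirac 0 + ENNReal.ofReal r • (G ∗ jumpLaw p q c F).restrict (Ioo a b)) :
    ENNReal.ofReal (1 - r) • G = ENNReal.ofReal (1 - r) • Measure.dirac 0
      + (volume.restrict (Ioo a b)).withDensity fun z => ENNReal.ofReal
          (positionDensity (LP.real {0}) (c * LP.real {0})
            (r * (G ∗ jumpLaw p q c F).real (Ici b)) b LM z) := by
  have := hfl.prob_inf
  obtain ⟨hint, heq⟩ := hfl.killed_real_eq ha hb hG
  have hcompl := killed_compl ha hb hG
  have hmul := hfl.inf_mul_sup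
  have hr := hfl.r_lt_one
  set pp := LP.real {0}
  set ρ := c * pp
  set Q := r * (G ∗ jumpLaw p q c F).real (Ici b)
  set VM := ENNReal.ofReal (1 - r) • G
  set k := killedDensity pp ρ Q b LM with hk
  set f := fun z => (LM.rnDeriv volume z).toReal with hf
  set d := positionDensity pp ρ Q b LM with hd
  have hfi : Integrable f := Measure.integrable_toReal_rnDeriv
  have hatom : ∀ y, y ≠ 0 → LM {y} = 0 := fun y hy => hfl.inf_singleton (fun y => hF (by simp)) hy
  have hne : ∀ w : ℝ, ∀ᵐ z : ℝ, z ≠ w := fun w => by simp [ae_iff]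
  have hdk : ∀ᵐ z, pp * (Iio 0).indicator f z + k z = d z := by
    filter_upwards [hfl.ae_hasDerivAt_inf hF, hne 0, hne b] with z h1 h2 h3
    rw [hk, hfl.killedDensity_eq (hatom z h2) (hatom _ (sub_ne_zero.2 h3)), hd, positionDensity]
    by_cases h : z < 0
    · rw [indicator_of_mem (show z ∈ Iio 0 from h), if_pos h, if_pos h, h1 h]
      ring
    · rw [indicator_of_notMem (show z ∉ Iio 0 from h), if_neg h, if_neg h]
      ring
  have hdi : IntegrableOn d (Ioo a b) :=
    (((hfi.indicator measurableSet_Iio).const_mul pp).integrableOn.add hint).congr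
      (ae_restrict_of_ae hdk)
  have hreal : ∀ B, MeasurableSet B → B ⊆ Ioo a b →
      VM.real B = (1 - r) * (Measure.dirac (0 : ℝ)).real B + ∫ z in B, d z := by
    intro B hB hBab
    have h1 : ∫ z in B, d z = pp * (∫ z in B ∩ Iio 0, f z) + ∫ z in B, k z := by
      rw [← setIntegral_congr_ae hB (hdk.mono fun z hz _ => hz), integral_add
        ((hfi.indicator measurableSet_Iio).const_mul pp).integrableOn (hint.mono_set hBab),
        integral_const_mul, setIntegral_indicator measurableSet_Iio]
    rw [heq B hB hBab, hfl.inf_real_eq hF hB, h1, ← hmul]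
    ring
  -- The formula is a difference, so its sign is not visible. Its integrals over sets avoiding 0 are
  -- masses of the killed walk, and the point 0 is Lebesgue-null.
  have hnonneg : 0 ≤ᵐ[volume.restrict (Ioo a b)] d := by
    refine ae_nonneg_restrict_of_forall_setIntegral_nonneg_inter hdi fun B hB _ => ?_
    have hm : MeasurableSet ((B ∩ Ioo a b) \ {0}) :=
      (hB.inter measurableSet_Ioo).diff (measurableSet_singleton 0)
    have h1 := hreal _ hm (sdiff_subset.trans inter_subset_right)
    have h2 : (Measure.dirac (0 : ℝ)).real ((B ∩ Ioo a b) \ {0}) = 0 := by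
      simp [measureReal_def, Measure.dirac_apply' _ hm]
    have h3 : ∫ z in (B ∩ Ioo a b) \ {0}, d z = ∫ z in B ∩ Ioo a b, d z := by
      refine setIntegral_congr_set (sdiff_null_ae_eq_self (by simp))
    rw [h2, mul_zero, zero_add, h3] at h1
    rw [← h1]
    exact measureReal_nonneg
  ext B hB
  have hVM : VM B = VM (B ∩ Ioo a b) := by
    have h2 : VM (Ioo a b)ᶜ = 0 := by simp [VM, hcompl]
    exact (measure_inter_conull h2).symm
  have h0 : (Measure.dirac (0 : ℝ)) B = Measure.dirac (0 : ℝ) (B ∩ Ioo a b) := by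
    rw [Measure.dirac_apply' _ hB, Measure.dirac_apply' _ (hB.inter measurableSet_Ioo)]
    have hiff : (0 : ℝ) ∈ B ∩ Ioo a b ↔ (0 : ℝ) ∈ B := ⟨fun h => h.1, fun h => ⟨h, ha, hb⟩⟩
    by_cases h : (0 : ℝ) ∈ B
    · rw [indicator_of_mem h, indicator_of_mem (hiff.2 h)]
    · rw [indicator_of_notMem h, indicator_of_notMem (hiff.not.2 h)]
  have h1 := hreal _ (hB.inter measurableSet_Ioo) inter_subset_right
  have hnn : 0 ≤ᵐ[volume.restrict (B ∩ Ioo a b)] d :=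
    ae_mono (Measure.restrict_mono inter_subset_right le_rfl) hnonneg
  rw [hVM, Measure.add_apply, Measure.smul_apply _ (Measure.dirac 0), smul_eq_mul, h0, withDensity_apply _ hB,
    Measure.restrict_restrict hB, ← ofReal_integral_eq_lintegral_ofReal
      (hdi.mono_set inter_subset_right) hnn, ← ENNReal.ofReal_toReal (measure_ne_top VM _)]
  rw [measureReal_def] at h1
  rw [h1, ENNReal.ofReal_add (mul_nonneg (by linarith) measureReal_nonneg)
    (integral_nonneg_of_ae hnn), ENNReal.ofReal_mul (by linarith), ofReal_measureReal]

end IsFluctuation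

end ExitProblem

end

noncomputable section

namespace ExitProblem


/-! ### Paths of the process -/

variable {Ω : Type*}

/-- The partial sum of the first `n` terms. -/
def partialSum (Y : ℕ → Ω → ℝ) (n : ℕ) (ω : Ω) : ℝ := ∑ k ∈ Finset.range n, Y k ω

lemma partialSum_zero (Y : ℕ → Ω → ℝ) (ω : Ω) : partialSum Y 0 ω = 0 := by simp [partialSum]

lemma partialSum_succ (Y : ℕ → Ω → ℝ) (n : ℕ) (ω : Ω) :
    partialSum Y (n + 1) ω = partialSum Y n ω + Y n ω := by
  simp [partialSum, Finset.sum_range_succ]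

/-- The waiting times are positive and their sum diverges. -/
structure IsGoodPath (W : ℕ → Ω → ℝ) (ω : Ω) : Prop where
  pos : ∀ k, 0 < W k ω
  unbounded : ∀ M : ℝ, ∃ n, M < partialSum W n ω

namespace IsGoodPath

variable {W X : ℕ → Ω → ℝ} {ω : Ω}

lemma strictMono (hg : IsGoodPath W ω) : StrictMono fun n => partialSum W n ω :=
  strictMono_nat_of_lt_succ fun n => by
    rw [partialSum_succ]
    linarith [hg.pos n]

/-- The jumps up to time t form an initial segment, so the set is finite and `ncard` is not its
default value 0. The shift between `jumpTime` and `partialSum` is that jump m occurs after m + 1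
waiting times. -/
lemma count_eq (hg : IsGoodPath W ω) {n : ℕ} {t : ℝ} (h1 : partialSum W n ω ≤ t)
    (h2 : t < partialSum W (n + 1) ω) : count W t ω = n := by
  have : {m : ℕ | jumpTime W m ω ≤ t} = ↑(Finset.range n) := by
    ext m
    simp only [mem_ofPred_eq, Finset.coe_range, mem_Iio]
    change partialSum W (m + 1) ω ≤ t ↔ m < n
    constructor
    · intro h
      have := hg.strictMono.lt_iff_lt.1 (h.trans_lt h2)
      omega
    · intro h
      exact (hg.strictMono.monotone (by omega : m + 1 ≤ n)).trans h1
  rw [count, this, ncard_coe_finset, Finset.card_range]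

lemma count_spec (hg : IsGoodPath W ω) {t : ℝ} (ht : 0 ≤ t) :
    partialSum W (count W t ω) ω ≤ t ∧ t < partialSum W (count W t ω + 1) ω := by
  classical
  have hex : ∃ n, t < partialSum W (n + 1) ω := by
    obtain ⟨n, hn⟩ := hg.unbounded t
    exact ⟨n, hn.trans (hg.strictMono n.lt_succ_self)⟩
  have h2 := Nat.find_spec hex
  have h1 : partialSum W (Nat.find hex) ω ≤ t := by
    rcases Nat.eq_zero_or_pos (Nat.find hex) with h | h
    · rw [h, partialSum_zero]
      exact ht
    · obtain ⟨m, hm⟩ := Nat.exists_eq_succ_of_ne_zero h.ne'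
      have h3 := Nat.find_min hex (m := m) (by omega)
      rw [hm]
      exact not_lt.1 h3
  rw [hg.count_eq h1 h2]
  exact ⟨h1, h2⟩

lemma partialSum_nonneg (hg : IsGoodPath W ω) (n : ℕ) : 0 ≤ partialSum W n ω := by
  have := hg.strictMono.monotone (Nat.zero_le n)
  simpa [partialSum_zero] using this

lemma count_partialSum (hg : IsGoodPath W ω) (n : ℕ) : count W (partialSum W n ω) ω = n :=
  hg.count_eq le_rfl (hg.strictMono n.lt_succ_self)

lemma le_count_iff (hg : IsGoodPath W ω) {t : ℝ} (ht : 0 ≤ t) (n : ℕ) :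
    n ≤ count W t ω ↔ partialSum W n ω ≤ t := by
  obtain ⟨h1, h2⟩ := hg.count_spec ht
  constructor
  · intro h
    exact (hg.strictMono.monotone h).trans h1
  · intro h
    have := hg.strictMono.lt_iff_lt.1 (h.trans_lt h2)
    omega

/-- The path is a step function: up to time t it takes exactly the values of the walk at steps 0, …,
ν(t). This turns the extrema of the process into those of the walk. -/
lemma image_xi (hg : IsGoodPath W ω) {t : ℝ} (ht : 0 ≤ t) :
    (fun u => xi W X u ω) '' Icc 0 t = (fun n => partialSum X n ω) '' Iic (count W t ω) := by
  ext y
  constructor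
  · rintro ⟨u, hu, rfl⟩
    refine ⟨count W u ω, ?_, rfl⟩
    rw [mem_Iic, hg.le_count_iff ht]
    exact (hg.count_spec hu.1).1.trans hu.2
  · rintro ⟨n, hn, rfl⟩
    refine ⟨partialSum W n ω, ⟨hg.partialSum_nonneg n, (hg.le_count_iff ht n).1 hn⟩, ?_⟩
    change partialSum X (count W (partialSum W n ω) ω) ω = _
    rw [hg.count_partialSum]

variable {x T : ℝ}

/-- The path only moves at jumps, so the infimum is attained at the first jump leading out of the
interval. -/
lemma exitTime_eq (hg : IsGoodPath W ω) {n : ℕ}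
    (hin : ∀ k ≤ n, partialSum X k ω ∈ Ioo (x - T) x)
    (hout : partialSum X (n + 1) ω ∉ Ioo (x - T) x) :
    exitTime W X x T ω = ENNReal.ofReal (partialSum W (n + 1) ω) := by
  refine le_antisymm ?_ ?_
  · refine iInf₂_le_of_le (partialSum W (n + 1) ω) ⟨?_, ?_⟩ le_rfl
    · exact (hg.partialSum_nonneg n).trans_lt (hg.strictMono n.lt_succ_self)
    · change partialSum X (count W _ ω) ω ∉ _
      rwa [hg.count_partialSum]
  · refine le_iInf₂ fun t ht => ENNReal.ofReal_le_ofReal ?_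
    by_contra! h
    refine ht.2 (hin _ ?_)
    by_contra! h'
    exact absurd ((hg.le_count_iff ht.1.le (n + 1)).1 h') (not_le.2 h)

lemma exitPos_eq (hg : IsGoodPath W ω) {n : ℕ}
    (hin : ∀ k ≤ n, partialSum X k ω ∈ Ioo (x - T) x)
    (hout : partialSum X (n + 1) ω ∉ Ioo (x - T) x) :
    exitPos W X x T ω = partialSum X (n + 1) ω := by
  rw [exitPos, hg.exitTime_eq hin hout, ENNReal.toReal_ofReal (hg.partialSum_nonneg _)]
  change partialSum X (count W _ ω) ω = _
  rw [hg.count_partialSum]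

lemma exitTime_eq_top (h : ∀ n, partialSum X n ω ∈ Ioo (x - T) x) : exitTime W X x T ω = ∞ := by
  refine iInf₂_eq_top.2 fun t ht => absurd (h (count W t ω)) ht.2

lemma forall_or_exists_first (h0 : (0 : ℝ) ∈ Ioo (x - T) x) :
    (∀ n, partialSum X n ω ∈ Ioo (x - T) x) ∨
      ∃ n, (∀ k ≤ n, partialSum X k ω ∈ Ioo (x - T) x) ∧
        partialSum X (n + 1) ω ∉ Ioo (x - T) x := by
  by_contra! h
  obtain ⟨⟨m, hm⟩, h⟩ := h
  refine hm ?_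
  induction m using Nat.strong_induction_on with
  | _ m ih =>
    rcases m with _ | n
    · rwa [partialSum_zero]
    · exact h n fun k hk => by
        by_contra h'
        exact h' (ih k (by omega) h')

lemma lt_exitTime_iff (hg : IsGoodPath W ω) (h0 : (0 : ℝ) ∈ Ioo (x - T) x) {t : ℝ} (ht : 0 ≤ t) :
    ENNReal.ofReal t < exitTime W X x T ω ↔
      ∀ k ≤ count W t ω, partialSum X k ω ∈ Ioo (x - T) x := by
  rcases forall_or_exists_first (X := X) (ω := ω) h0 with h | ⟨n, hin, hout⟩
  · rw [exitTime_eq_top h]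
    simp [h]
  · rw [hg.exitTime_eq hin hout, ENNReal.ofReal_lt_ofReal_iff_of_nonneg ht, ← not_le,
      ← hg.le_count_iff ht]
    constructor
    · intro h k hk
      exact hin k (by omega)
    · intro h h'
      exact hout (h _ h')

lemma mem_upperExit_iff (hg : IsGoodPath W ω) (h0 : (0 : ℝ) ∈ Ioo (x - T) x) :
    ω ∈ upperExit W X x T ↔
      ∃ n, (∀ k ≤ n, partialSum X k ω ∈ Ioo (x - T) x) ∧ x ≤ partialSum X (n + 1) ω := by
  constructor
  · rintro ⟨h1, h2⟩
    rcases forall_or_exists_first (X := X) (ω := ω) h0 with h | ⟨n, hin, hout⟩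
    · exact absurd (exitTime_eq_top h) h1
    · refine ⟨n, hin, ?_⟩
      rwa [hg.exitPos_eq hin hout] at h2
  · rintro ⟨n, hin, hx⟩
    have hout : partialSum X (n + 1) ω ∉ Ioo (x - T) x := fun h => absurd h.2 (not_lt.2 hx)
    refine ⟨?_, ?_⟩
    · rw [hg.exitTime_eq hin hout]
      exact ENNReal.ofReal_ne_top
    · rwa [hg.exitPos_eq hin hout]

end IsGoodPath

/-- The sequence with `r₀ = 0` and `rₙ₊₁(X) = g (X₀ + rₙ(X₁, X₂, …))`. -/
def lindleySeq (g : ℝ → ℝ) (X : ℕ → Ω → ℝ) : ℕ → Ω → ℝ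
  | 0 => fun _ => 0
  | n + 1 => fun ω => g (X 0 ω + lindleySeq g (fun k => X (k + 1)) n ω)

lemma partialSum_succ_shift (X : ℕ → Ω → ℝ) (n : ℕ) (ω : Ω) :
    partialSum X (n + 1) ω = X 0 ω + partialSum (fun k => X (k + 1)) n ω := by
  rw [partialSum, Finset.sum_range_succ', partialSum, add_comm]

/-- max(0, S₁, …, Sₙ₊₁) = max(0, X₀ + M), with M the maximum of the walk driven by the shifted
jumps. Splitting off the first jump keeps M independent of it. -/
lemma isGreatest_lindleySeq (X : ℕ → Ω → ℝ) (n : ℕ) (ω : Ω) :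
    IsGreatest ((fun k => partialSum X k ω) '' Iic n) (lindleySeq (max 0) X n ω) := by
  induction n generalizing X with
  | zero =>
    refine ⟨⟨0, by simp, by simp [partialSum_zero, lindleySeq]⟩, ?_⟩
    rintro _ ⟨k, hk, rfl⟩
    have : k = 0 := by simpa using hk
    simp [this, partialSum_zero, lindleySeq]
  | succ n ih =>
    obtain ⟨⟨k, hk, hk'⟩, hub⟩ := ih (fun k => X (k + 1))
    simp only [lindleySeq]
    constructor
    · rcases max_cases 0 (X 0 ω + lindleySeq (max 0) (fun k => X (k + 1)) n ω) with h | h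
      · exact ⟨0, by simp, by simp [h.1, partialSum_zero]⟩
      · refine ⟨k + 1, by simpa using hk, ?_⟩
        rw [h.1, ← hk']
        exact partialSum_succ_shift X k ω
    · rintro _ ⟨j, hj, rfl⟩
      rcases j with _ | j
      · simp [partialSum_zero]
      · refine le_max_of_le_right ?_
        simp only [partialSum_succ_shift]
        gcongr
        exact hub ⟨j, by simpa using hj, rfl⟩

lemma isLeast_lindleySeq (X : ℕ → Ω → ℝ) (n : ℕ) (ω : Ω) :
    IsLeast ((fun k => partialSum X k ω) '' Iic n) (lindleySeq (min 0) X n ω) := by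
  induction n generalizing X with
  | zero =>
    refine ⟨⟨0, by simp, by simp [partialSum_zero, lindleySeq]⟩, ?_⟩
    rintro _ ⟨k, hk, rfl⟩
    have : k = 0 := by simpa using hk
    simp [this, partialSum_zero, lindleySeq]
  | succ n ih =>
    obtain ⟨⟨k, hk, hk'⟩, hub⟩ := ih (fun k => X (k + 1))
    simp only [lindleySeq]
    constructor
    · rcases min_cases 0 (X 0 ω + lindleySeq (min 0) (fun k => X (k + 1)) n ω) with h | h
      · exact ⟨0, by simp, by simp [h.1, partialSum_zero]⟩
      · refine ⟨k + 1, by simpa using hk, ?_⟩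
        rw [h.1, ← hk']
        exact partialSum_succ_shift X k ω
    · rintro _ ⟨j, hj, rfl⟩
      rcases j with _ | j
      · simp [partialSum_zero]
      · refine min_le_of_right_le ?_
        simp only [partialSum_succ_shift]
        gcongr
        exact hub ⟨j, by simpa using hj, rfl⟩

lemma IsGoodPath.xiSup_eq {W X : ℕ → Ω → ℝ} {ω : Ω} (hg : IsGoodPath W ω) {t : ℝ} (ht : 0 ≤ t) :
    xiSup W X t ω = lindleySeq (max 0) X (count W t ω) ω := by
  rw [xiSup, hg.image_xi ht]
  exact (isGreatest_lindleySeq X _ ω).csSup_eq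

lemma IsGoodPath.xiInf_eq {W X : ℕ → Ω → ℝ} {ω : Ω} (hg : IsGoodPath W ω) {t : ℝ} (ht : 0 ≤ t) :
    xiInf W X t ω = lindleySeq (min 0) X (count W t ω) ω := by
  rw [xiInf, hg.image_xi ht]
  exact (isLeast_lindleySeq X _ ω).csInf_eq

end ExitProblem

end

noncomputable section

namespace ExitProblem


/-! ### Geometric mixtures -/

lemma sum_conv (m : ℕ → Measure ℝ) (μ : Measure ℝ) [SFinite μ] :
    Measure.sum m ∗ μ = Measure.sum fun n => m n ∗ μ := by
  refine Measure.ext_of_lintegral _ fun f hf => ?_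
  rw [Measure.lintegral_conv hf, lintegral_sum_measure, lintegral_sum_measure]
  simp_rw [Measure.lintegral_conv hf]

lemma smul_sum_measure (a : ℝ≥0∞) (m : ℕ → Measure ℝ) :
    a • Measure.sum m = Measure.sum fun n => a • m n := by
  ext B hB
  simp [Measure.sum_apply _ hB, ENNReal.tsum_mul_left]

/-- The mixture of the measures `m n` with geometric weights `r ^ n`. -/
def geomSum (r : ℝ) (m : ℕ → Measure ℝ) : Measure ℝ :=
  Measure.sum fun n => ENNReal.ofReal (r ^ n) • m n

lemma isFiniteMeasure_geomSum {r : ℝ} (hr0 : 0 ≤ r) (hr1 : r < 1) (m : ℕ → Measure ℝ)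
    (hm : ∀ n, m n univ ≤ 1) : IsFiniteMeasure (geomSum r m) := by
  constructor
  rw [geomSum, Measure.sum_apply _ MeasurableSet.univ]
  calc ∑' n, (ENNReal.ofReal (r ^ n) • m n) univ
      ≤ ∑' n, ENNReal.ofReal (r ^ n) := by
        refine ENNReal.tsum_le_tsum fun n => ?_
        rw [Measure.smul_apply, smul_eq_mul]
        exact mul_le_of_le_one_right' (hm n)
    _ = ENNReal.ofReal (∑' n, r ^ n) :=
        (ENNReal.ofReal_tsum_of_nonneg (fun n => pow_nonneg hr0 n)
          (summable_geometric_of_lt_one hr0 hr1)).symm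
    _ < ∞ := ENNReal.ofReal_lt_top

/-- Renewal equation: separate the term n = 0 and shift the index in the rest. It serves for Ψ
clipping at 0, restriction to the interval, and the identity. -/
lemma geomSum_eq {r : ℝ} (hr : 0 ≤ r) {m : ℕ → Measure ℝ} {μ : Measure ℝ} [SFinite μ]
    {Ψ : Measure ℝ → Measure ℝ}
    (hsum : ∀ m : ℕ → Measure ℝ, Ψ (Measure.sum m) = Measure.sum fun n => Ψ (m n))
    (hsmul : ∀ (a : ℝ≥0∞) (M : Measure ℝ), Ψ (a • M) = a • Ψ M)
    (h0 : m 0 = Measure.dirac 0) (hsucc : ∀ n, m (n + 1) = Ψ (m n ∗ μ)) :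
    geomSum r m = Measure.dirac 0 + ENNReal.ofReal r • Ψ (geomSum r m ∗ μ) := by
  have h1 : ENNReal.ofReal r • Ψ (geomSum r m ∗ μ)
      = Measure.sum fun n => ENNReal.ofReal (r ^ (n + 1)) • m (n + 1) := by
    rw [geomSum, sum_conv, hsum, smul_sum_measure]
    congr 1
    ext1 n
    rw [Measure.conv_smul_left, hsmul, smul_smul, ← ENNReal.ofReal_mul hr, pow_succ', hsucc]
  rw [h1]
  ext B hB
  rw [geomSum, Measure.add_apply, Measure.sum_apply _ hB, Measure.sum_apply _ hB,
    tsum_eq_zero_add' ENNReal.summable]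
  simp [h0]

variable {Ω : Type*}

lemma measurable_eval_nat {mΩ : MeasurableSpace Ω} {N : Ω → ℕ} (hN : Measurable N)
    {Y : ℕ → Ω → ℝ} (hY : ∀ n, Measurable (Y n)) : Measurable fun ω => Y (N ω) ω :=
  (measurable_from_prod_countable_right (f := fun z : ℕ × Ω => Y z.1 z.2) hY).comp
    (hN.prodMk measurable_id)

/-- Slicing by the value of N, each slice factors by independence. In the application 𝓐 carries
waiting times and clock, and 𝓑 the jumps. -/
lemma map_restrict_mixture {𝓐 𝓑 mΩ : MeasurableSpace Ω} {P : Measure Ω} (hA : 𝓐 ≤ mΩ) (hB : 𝓑 ≤ mΩ)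
    (hind : Indep 𝓐 𝓑 P) {N : Ω → ℕ} (hN : Measurable[𝓐] N) {Y : ℕ → Ω → ℝ}
    (hY : ∀ n, Measurable[𝓑] (Y n)) {E : ℕ → Set Ω} (hE : ∀ n, MeasurableSet[𝓑] (E n)) :
    (P.restrict {ω | ω ∈ E (N ω)}).map (fun ω => Y (N ω) ω)
      = Measure.sum fun n => P (N ⁻¹' {n}) • (P.restrict (E n)).map (Y n) := by
  have hN' : Measurable N := hN.mono hA le_rfl
  have hY' : ∀ n, Measurable (Y n) := fun n => (hY n).mono hB le_rfl
  have hmeas : Measurable fun ω => Y (N ω) ω := measurable_eval_nat hN' hY'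
  ext B hBm
  rw [Measure.map_apply hmeas hBm, Measure.restrict_apply (hmeas hBm), Measure.sum_apply _ hBm]
  have h1 : (fun ω => Y (N ω) ω) ⁻¹' B ∩ {ω | ω ∈ E (N ω)}
      = ⋃ n, N ⁻¹' {n} ∩ (Y n ⁻¹' B ∩ E n) := by
    ext ω
    simp
  rw [h1, measure_iUnion]
  · refine tsum_congr fun n => ?_
    rw [Measure.smul_apply, smul_eq_mul, Measure.map_apply (hY' n) hBm,
      Measure.restrict_apply (hY' n hBm)]
    exact (Indep_iff _ _ _).1 hind _ _ (hN (measurableSet_singleton n))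
      ((hY n hBm).inter (hE n))
  · intro i j hij
    refine Set.disjoint_left.2 ?_
    rintro ω ⟨h, _⟩ ⟨h', _⟩
    exact hij (h.symm.trans h')
  · exact fun n => (hN' (measurableSet_singleton n)).inter ((hY' n hBm).inter (hB _ (hE n)))

lemma map_add_restrict {𝓐 𝓑 mΩ : MeasurableSpace Ω} {P : Measure Ω} [IsProbabilityMeasure P]
    (hA : 𝓐 ≤ mΩ) (hB : 𝓑 ≤ mΩ) (hind : Indep 𝓐 𝓑 P) {Y Z : Ω → ℝ} (hY : Measurable[𝓐] Y)
    {E : Set Ω} (hE : MeasurableSet[𝓐] E) (hZ : Measurable[𝓑] Z) :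
    (P.restrict E).map (fun ω => Y ω + Z ω) = (P.restrict E).map Y ∗ P.map Z := by
  have hY' : Measurable Y := hY.mono hA le_rfl
  have hZ' : Measurable Z := hZ.mono hB le_rfl
  have hprod : ((P.restrict E).map Y).prod (P.map Z) = (P.restrict E).map fun ω => (Y ω, Z ω) := by
    refine Measure.prod_eq fun s t hs ht => ?_
    rw [Measure.map_apply (hY'.prodMk hZ') (hs.prod ht), Measure.map_apply hY' hs,
      Measure.map_apply hZ' ht, Measure.restrict_apply (hY' hs),
      Measure.restrict_apply ((hY'.prodMk hZ') (hs.prod ht)), ← (Indep_iff _ _ _).1 hind _ _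
        ((hY hs).inter hE) (hZ ht)]
    congr 1
    ext ω
    simp only [mem_inter_iff, mem_preimage, mem_prod]
    tauto
  rw [Measure.conv, hprod, Measure.map_map (by fun_prop) (hY'.prodMk hZ')]
  rfl

lemma restrict_map_restrict {mΩ : MeasurableSpace Ω} {P : Measure Ω} {Y : Ω → ℝ} (hY : Measurable Y)
    (E : Set Ω) {C : Set ℝ} (hC : MeasurableSet C) :
    (P.restrict (E ∩ Y ⁻¹' C)).map Y = ((P.restrict E).map Y).restrict C := by
  rw [Measure.restrict_map hY hC, Measure.restrict_restrict (hY hC), inter_comm]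

end ExitProblem

end

noncomputable section

namespace ExitProblem


/-! ### The random walk at a geometric time -/

variable {Ω : Type*}

lemma measurable_partialSum {m : MeasurableSpace Ω} {Y : ℕ → Ω → ℝ} {n : ℕ}
    (hY : ∀ k < n, Measurable (Y k)) : Measurable (partialSum Y n) :=
  Finset.measurable_fun_sum _ fun k hk => hY k (Finset.mem_range.1 hk)

lemma measurable_count {m : MeasurableSpace Ω} {W : ℕ → Ω → ℝ} (hW : ∀ k, Measurable (W k))
    {θ : Ω → ℝ} (hθ : Measurable θ) : Measurable fun ω => count W (θ ω) ω := by
  refine measurable_ncard.comp ?_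
  rw [measurable_set_iff]
  intro n
  exact measurableSet_setOfPred.1
    (measurableSet_le (measurable_partialSum (n := n + 1) fun k _ => hW k) hθ)

lemma measurable_lindleySeq {m : MeasurableSpace Ω} {g : ℝ → ℝ} (hg : Measurable g) (n : ℕ)
    {X : ℕ → Ω → ℝ} (hX : ∀ k, Measurable (X k)) : Measurable (lindleySeq g X n) := by
  induction n generalizing X with
  | zero => exact measurable_const
  | succ n ih => exact hg.comp ((hX 0).add (ih fun k => hX (k + 1)))

/-- The σ-algebra generated by the variables with indices in `S`. -/
abbrev sigmaOf {ι : Type*} (X : ι → Ω → ℝ) (S : Set ι) : MeasurableSpace Ω :=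
  ⨆ i ∈ S, (inferInstance : MeasurableSpace ℝ).comap (X i)

lemma measurable_sigmaOf {ι : Type*} (X : ι → Ω → ℝ) {S : Set ι} {i : ι} (hi : i ∈ S) :
    Measurable[sigmaOf X S] (X i) :=
  measurable_iff_comap_le.2 (le_iSup₂_of_le i hi le_rfl)

variable {mΩ : MeasurableSpace Ω} {P : Measure Ω}

lemma indep_sigmaOf {ι : Type*} {X : ι → Ω → ℝ} (hX : ∀ i, Measurable (X i))
    (hind : iIndepFun X P) {S T : Set ι} (hST : Disjoint S T) :
    Indep (sigmaOf X S) (sigmaOf X T) P :=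
  indep_iSup_of_disjoint (fun i => (hX i).comap_le) hind.iIndep hST

lemma sigmaOf_le {ι : Type*} {X : ι → Ω → ℝ} (hX : ∀ i, Measurable (X i)) (S : Set ι) :
    sigmaOf X S ≤ mΩ :=
  iSup₂_le fun i _ => (hX i).comap_le

/-- The laws obtained from `δ₀` by iterating a convolution with `μ` followed by `Ψ`. -/
def walkLaw (Ψ : Measure ℝ → Measure ℝ) (μ : Measure ℝ) : ℕ → Measure ℝ
  | 0 => Measure.dirac 0
  | n + 1 => Ψ (walkLaw Ψ μ n ∗ μ)

variable [IsProbabilityMeasure P] {μ : Measure ℝ}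

/-- The shifted sequence has the same law as X and is independent of X 0, so one step is a
convolution with μ followed by g. -/
lemma map_lindleySeq {g : ℝ → ℝ} (hg : Measurable g) (n : ℕ) {X : ℕ → Ω → ℝ}
    (hX : ∀ k, Measurable (X k)) (hlaw : ∀ k, P.map (X k) = μ) (hind : iIndepFun X P) :
    P.map (lindleySeq g X n) = walkLaw (fun M => M.map g) μ n := by
  induction n generalizing X with
  | zero =>
    change P.map (fun _ => (0 : ℝ)) = Measure.dirac 0
    simp [Measure.map_const]
  | succ n ih =>
    have hind' : Indep (sigmaOf X (Ioi 0)) (sigmaOf X {0}) P :=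
      indep_sigmaOf hX hind (by simp)
    have hm : Measurable[sigmaOf X (Ioi 0)] (lindleySeq g (fun k => X (k + 1)) n) :=
      measurable_lindleySeq (m := sigmaOf X (Ioi 0)) hg n fun k =>
        measurable_sigmaOf X (Nat.succ_pos k)
    have h := map_add_restrict (sigmaOf_le hX _) (sigmaOf_le hX _) hind' hm MeasurableSet.univ
      (measurable_sigmaOf X (mem_singleton 0))
    have hm' : Measurable fun ω => lindleySeq g (fun k => X (k + 1)) n ω + X 0 ω :=
      (measurable_lindleySeq hg n fun k => hX (k + 1)).add (hX 0)
    rw [Measure.restrict_univ, hlaw 0, ih (fun k => hX (k + 1)) (fun k => hlaw (k + 1))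
      (hind.precomp (add_left_injective 1))] at h
    rw [walkLaw, ← h, Measure.map_map hg hm']
    congr 1
    ext ω
    simp [lindleySeq, add_comm]

/-- The event that the walk stays in `D` up to step `n`. -/
def stayEvent (X : ℕ → Ω → ℝ) (D : Set ℝ) (n : ℕ) : Set Ω := {ω | ∀ k ≤ n, partialSum X k ω ∈ D}

lemma stayEvent_succ (X : ℕ → Ω → ℝ) (D : Set ℝ) (n : ℕ) :
    stayEvent X D (n + 1) = stayEvent X D n ∩ partialSum X (n + 1) ⁻¹' D := by
  ext ω
  simp only [stayEvent, mem_ofPred_eq, mem_inter_iff, mem_preimage]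
  constructor
  · exact fun h => ⟨fun k hk => h k (by omega), h _ le_rfl⟩
  · rintro ⟨h1, h2⟩ k hk
    rcases Nat.lt_or_ge n k with h | h
    · rwa [show k = n + 1 by omega]
    · exact h1 k h

lemma measurableSet_stayEvent {m : MeasurableSpace Ω} {X : ℕ → Ω → ℝ} {D : Set ℝ}
    (hD : MeasurableSet D) {n : ℕ} (hX : ∀ k < n, Measurable (X k)) :
    MeasurableSet (stayEvent X D n) := by
  have : stayEvent X D n = ⋂ k, ⋂ (_ : k ≤ n), partialSum X k ⁻¹' D := by
    ext ω
    simp [stayEvent]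
  rw [this]
  exact MeasurableSet.iInter fun k => MeasurableSet.iInter fun hk =>
    measurable_partialSum (fun j hj => hX j (by omega)) hD

/-- Staying in D up to step n involves only the jumps with index below n, hence is independent of
the jump X n. -/
lemma map_partialSum_succ_restrict {X : ℕ → Ω → ℝ} (hX : ∀ k, Measurable (X k))
    (hlaw : ∀ k, P.map (X k) = μ) (hind : iIndepFun X P) {D : Set ℝ} (hD : MeasurableSet D) (n : ℕ) :
    (P.restrict (stayEvent X D n)).map (partialSum X (n + 1))
      = (P.restrict (stayEvent X D n)).map (partialSum X n) ∗ μ := by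
  have hind' : Indep (sigmaOf X (Iio n)) (sigmaOf X {n}) P := indep_sigmaOf hX hind (by simp)
  have hm : ∀ k < n, Measurable[sigmaOf X (Iio n)] (X k) := fun k hk => measurable_sigmaOf X hk
  have h := map_add_restrict (sigmaOf_le hX _) (sigmaOf_le hX _) hind'
    (measurable_partialSum (m := sigmaOf X (Iio n)) hm)
    (measurableSet_stayEvent (m := sigmaOf X (Iio n)) hD hm)
    (measurable_sigmaOf X (mem_singleton n))
  rw [hlaw n] at h
  rw [← h]
  congr 1
  ext ω
  exact partialSum_succ X n ω

lemma map_partialSum_restrict {X : ℕ → Ω → ℝ} (hX : ∀ k, Measurable (X k))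
    (hlaw : ∀ k, P.map (X k) = μ) (hind : iIndepFun X P) {D : Set ℝ} (hD : MeasurableSet D)
    (h0 : (0 : ℝ) ∈ D) (n : ℕ) :
    (P.restrict (stayEvent X D n)).map (partialSum X n)
      = walkLaw (fun M => M.restrict D) μ n := by
  induction n with
  | zero =>
    have h1 : stayEvent X D 0 = univ := by
      ext ω
      simp [stayEvent, partialSum_zero, h0]
    have h2 : partialSum X 0 = fun _ => 0 := funext fun ω => partialSum_zero X ω
    rw [h1, h2, Measure.restrict_univ]
    simp [Measure.map_const, walkLaw]
  | succ n ih =>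
    rw [stayEvent_succ, restrict_map_restrict (measurable_partialSum fun k _ => hX k) _ hD,
      map_partialSum_succ_restrict hX hlaw hind hD, ih, walkLaw]

lemma walkLaw_univ_le_one {Ψ : Measure ℝ → Measure ℝ} (hΨ : ∀ M, Ψ M univ ≤ M univ)
    [IsProbabilityMeasure μ] (n : ℕ) : walkLaw Ψ μ n univ ≤ 1 := by
  induction n with
  | zero => simp [walkLaw]
  | succ n ih =>
    refine (hΨ _).trans ?_
    rw [Measure.conv, Measure.map_apply (by fun_prop) MeasurableSet.univ, preimage_univ,
      ← univ_prod_univ, Measure.prod_prod, measure_univ (μ := μ), mul_one]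
    exact ih

end ExitProblem

end

noncomputable section

namespace ExitProblem


/-! ### The exponential clock -/

variable {Ω : Type*} {mΩ : MeasurableSpace Ω} {P : Measure Ω} {W : ℕ → Ω → ℝ} {θ : Ω → ℝ}
  {lam s : ℝ}

lemma ae_pos_of_map_eq_expMeasure {Z : Ω → ℝ} (hZ : Measurable Z) {c : ℝ}
    (hlaw : P.map Z = expMeasure c) : ∀ᵐ ω ∂P, 0 < Z ω := by
  rw [ae_iff]
  have h := expMeasure_Iic_zero c
  rw [← hlaw, Measure.map_apply hZ measurableSet_Iic] at h
  simpa [Iic, preimage] using h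

lemma lintegral_exp_neg_mul_partialSum (hlam : 0 < lam) (hs : 0 ≤ s) (hW : ∀ k, Measurable (W k))
    (hlaw : ∀ k, P.map (W k) = expMeasure lam) (hind : iIndepFun W P) (n : ℕ) :
    ∫⁻ ω, ENNReal.ofReal (Real.exp (-s * partialSum W n ω)) ∂P
      = ENNReal.ofReal ((lam / (lam + s)) ^ n) := by
  have hf : Measurable fun y : ℝ => ENNReal.ofReal (Real.exp (-s * y)) := by fun_prop
  have h1 : ∀ ω, ENNReal.ofReal (Real.exp (-s * partialSum W n ω))
      = ∏ k ∈ Finset.range n, ENNReal.ofReal (Real.exp (-s * W k ω)) := by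
    intro ω
    rw [← ENNReal.ofReal_prod_of_nonneg fun k _ => (Real.exp_pos _).le, ← Real.exp_sum,
      partialSum, Finset.mul_sum]
  simp_rw [h1]
  rw [lintegral_prod_eq_prod_lintegral_of_indepFun _ (fun k ω => ENNReal.ofReal (Real.exp (-s * W k ω)))
    (hind.comp _ fun _ => hf) fun k => hf.comp (hW k)]
  have h2 : ∀ k, ∫⁻ ω, ENNReal.ofReal (Real.exp (-s * W k ω)) ∂P
      = ENNReal.ofReal (lam / (lam + s)) := by
    intro k
    rw [← lintegral_exp_neg_mul_expMeasure hlam hs, ← hlaw k, lintegral_map hf (hW k)]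
  rw [Finset.prod_congr rfl fun k _ => h2 k, Finset.prod_const, Finset.card_range,
    ENNReal.ofReal_pow (by positivity)]

/-- Divergence is a Chernoff bound: the probability that all jump times stay below M is at most e^M
E e^{-t_n} = e^M (λ/(λ+1))^n for every n. -/
lemma ae_isGoodPath (hlam : 0 < lam) (hW : ∀ k, Measurable (W k))
    (hlaw : ∀ k, P.map (W k) = expMeasure lam) (hind : iIndepFun W P) :
    ∀ᵐ ω ∂P, IsGoodPath W ω := by
  have hpos : ∀ᵐ ω ∂P, ∀ k, 0 < W k ω :=
    ae_all_iff.2 fun k => ae_pos_of_map_eq_expMeasure (hW k) (hlaw k)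
  have hbd : ∀ M : ℕ, P {ω | ∀ n, partialSum W n ω ≤ M} = 0 := by
    intro M
    have hle : ∀ n, P {ω | ∀ n, partialSum W n ω ≤ M}
        ≤ ENNReal.ofReal (Real.exp M) * ENNReal.ofReal ((lam / (lam + 1)) ^ n) := by
      intro n
      rw [← lintegral_exp_neg_mul_partialSum hlam zero_le_one hW hlaw hind n,
        ← lintegral_const_mul _ (by
          have := measurable_partialSum (n := n) fun k _ => hW k
          fun_prop)]
      calc P {ω | ∀ n, partialSum W n ω ≤ M}
          ≤ P {ω | 1 ≤ ENNReal.ofReal (Real.exp M)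
              * ENNReal.ofReal (Real.exp (-1 * partialSum W n ω))} := by
            refine measure_mono fun ω hω => ?_
            simp only [mem_ofPred_eq]
            rw [← ENNReal.ofReal_mul (Real.exp_pos _).le, ← Real.exp_add, ← ENNReal.ofReal_one]
            refine ENNReal.ofReal_le_ofReal (Real.one_le_exp ?_)
            have : partialSum W n ω ≤ M := hω n
            linarith
        _ ≤ _ := by
            have hm : Measurable fun ω => ENNReal.ofReal (Real.exp M)
                * ENNReal.ofReal (Real.exp (-1 * partialSum W n ω)) := by
              have := measurable_partialSum (n := n) fun k _ => hW k
              fun_prop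
            have h := mul_meas_ge_le_lintegral (μ := P) hm 1
            rwa [one_mul] at h
    have htend : Filter.Tendsto (fun n : ℕ => ENNReal.ofReal (Real.exp M)
        * ENNReal.ofReal ((lam / (lam + 1)) ^ n)) Filter.atTop (nhds 0) := by
      have h1 : Filter.Tendsto (fun n : ℕ => (lam / (lam + 1)) ^ n) Filter.atTop (nhds 0) :=
        tendsto_pow_atTop_nhds_zero_of_lt_one (by positivity)
          ((div_lt_one (by positivity)).2 (by linarith))
      have h2 := ENNReal.Tendsto.const_mul (a := ENNReal.ofReal (Real.exp M))
        (ENNReal.tendsto_ofReal h1) (Or.inr ENNReal.ofReal_ne_top)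
      simpa using h2
    exact le_antisymm (ge_of_tendsto' htend hle) zero_le
  have hbd' : ∀ᵐ ω ∂P, ∀ M : ℕ, ∃ n, (M : ℝ) < partialSum W n ω := by
    refine ae_all_iff.2 fun M => ?_
    rw [ae_iff]
    simpa using hbd M
  filter_upwards [hpos, hbd'] with ω h1 h2
  refine ⟨h1, fun M => ?_⟩
  obtain ⟨k, hk⟩ := exists_nat_gt M
  obtain ⟨n, hn⟩ := h2 k
  exact ⟨n, hk.trans hn⟩

/-- Given the n-th jump time t_n, the independent clock survives it with probability e^{-s t_n};
integration gives the Laplace transform. -/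
lemma measure_partialSum_le [IsProbabilityMeasure P] (hlam : 0 < lam) (hs : 0 < s)
    (hW : ∀ k, Measurable (W k)) (hlaw : ∀ k, P.map (W k) = expMeasure lam) (hind : iIndepFun W P)
    (hθ : Measurable θ) (hθlaw : P.map θ = expMeasure s) {n : ℕ}
    (hindθ : IndepFun (partialSum W n) θ P) :
    P {ω | partialSum W n ω ≤ θ ω} = ENNReal.ofReal ((lam / (lam + s)) ^ n) := by
  have hm := measurable_partialSum (n := n) fun k _ => hW k
  have h1 := (indepFun_iff_map_prod_eq_prod_map_map hm.aemeasurable hθ.aemeasurable).1 hindθ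
  have hset : MeasurableSet {z : ℝ × ℝ | z.1 ≤ z.2} := measurableSet_le measurable_fst measurable_snd
  have h2 : P {ω | partialSum W n ω ≤ θ ω}
      = P.map (fun ω => (partialSum W n ω, θ ω)) {z : ℝ × ℝ | z.1 ≤ z.2} := by
    rw [Measure.map_apply (hm.prodMk hθ) hset]
    rfl
  have := isProbabilityMeasure_expMeasure hs
  rw [h2, h1, hθlaw, Measure.prod_apply hset, lintegral_map (measurable_measure_prodMk_left hset) hm,
    ← lintegral_exp_neg_mul_partialSum hlam hs.le hW hlaw hind n]
  refine lintegral_congr_ae ?_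
  filter_upwards [ae_isGoodPath hlam hW hlaw hind] with ω hω
  change expMeasure s (Ici (partialSum W n ω)) = _
  rw [expMeasure_Ici hs (hω.partialSum_nonneg n), neg_mul]

/-- The event {ν(θ) = n} is {t_n ≤ θ} minus {t_{n+1} ≤ θ}, of probability r^n - r^{n+1}. -/
lemma measure_count_eq [IsProbabilityMeasure P] (hlam : 0 < lam) (hs : 0 < s)
    (hW : ∀ k, Measurable (W k)) (hlaw : ∀ k, P.map (W k) = expMeasure lam) (hind : iIndepFun W P)
    (hθ : Measurable θ) (hθlaw : P.map θ = expMeasure s)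
    (hindθ : ∀ n, IndepFun (partialSum W n) θ P) (n : ℕ) :
    P ((fun ω => count W (θ ω) ω) ⁻¹' {n})
      = ENNReal.ofReal ((1 - lam / (lam + s)) * (lam / (lam + s)) ^ n) := by
  have hgood := ae_isGoodPath hlam hW hlaw hind
  have hpos := ae_pos_of_map_eq_expMeasure hθ hθlaw
  set r := lam / (lam + s)
  have hr : 0 ≤ r := by positivity
  have h1 : P ((fun ω => count W (θ ω) ω) ⁻¹' {n})
      = P ({ω | partialSum W n ω ≤ θ ω} \ {ω | partialSum W (n + 1) ω ≤ θ ω}) := by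
    refine measure_congr ?_
    filter_upwards [hgood, hpos] with ω hg hω
    refine propext ?_
    change count W (θ ω) ω = n ↔ (partialSum W n ω ≤ θ ω ∧ ¬ partialSum W (n + 1) ω ≤ θ ω)
    rw [← hg.le_count_iff hω.le, ← hg.le_count_iff hω.le]
    omega
  have hset : ∀ n, MeasurableSet {ω | partialSum W n ω ≤ θ ω} := fun n =>
    measurableSet_le (measurable_partialSum fun k _ => hW k) hθ
  rw [h1, measure_sdiff' _ (hset (n + 1)).nullMeasurableSet (measure_ne_top _ _)]
  have h2 : P ({ω | partialSum W n ω ≤ θ ω} ∪ {ω | partialSum W (n + 1) ω ≤ θ ω})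
      = P {ω | partialSum W n ω ≤ θ ω} := by
    refine measure_congr ?_
    filter_upwards [hgood] with ω hg
    refine propext ⟨?_, Or.inl⟩
    rintro (h | h)
    · exact h
    · exact (hg.strictMono n.lt_succ_self).le.trans h
  rw [h2, measure_partialSum_le hlam hs hW hlaw hind hθ hθlaw (hindθ n),
    measure_partialSum_le hlam hs hW hlaw hind hθ hθlaw (hindθ (n + 1)),
    ← ENNReal.ofReal_sub _ (by positivity)]
  congr 1
  ring

end ExitProblem

end

noncomputable section

namespace ExitProblem


/-! ### The laws attached to the model -/

section Mixture

variable {Ω : Type*} {𝓐 𝓑 mΩ : MeasurableSpace Ω} {P : Measure Ω} {N : Ω → ℕ} {r : ℝ}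

lemma map_restrict_geometric (hA : 𝓐 ≤ mΩ) (hB : 𝓑 ≤ mΩ) (hind : Indep 𝓐 𝓑 P)
    (hN : Measurable[𝓐] N) (hr : r ≤ 1)
    (hgeom : ∀ n, P (N ⁻¹' {n}) = ENNReal.ofReal ((1 - r) * r ^ n)) {Y : ℕ → Ω → ℝ}
    (hY : ∀ n, Measurable[𝓑] (Y n)) {E : ℕ → Set Ω} (hE : ∀ n, MeasurableSet[𝓑] (E n)) :
    (P.restrict {ω | ω ∈ E (N ω)}).map (fun ω => Y (N ω) ω)
      = ENNReal.ofReal (1 - r) • geomSum r fun n => (P.restrict (E n)).map (Y n) := by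
  rw [map_restrict_mixture hA hB hind hN hY hE, geomSum, smul_sum_measure]
  congr 1
  ext1 n
  rw [hgeom, smul_smul, ENNReal.ofReal_mul (by linarith)]

lemma map_geometric (hA : 𝓐 ≤ mΩ) (hB : 𝓑 ≤ mΩ) (hind : Indep 𝓐 𝓑 P)
    (hN : Measurable[𝓐] N) (hr : r ≤ 1)
    (hgeom : ∀ n, P (N ⁻¹' {n}) = ENNReal.ofReal ((1 - r) * r ^ n)) {Y : ℕ → Ω → ℝ}
    (hY : ∀ n, Measurable[𝓑] (Y n)) :
    P.map (fun ω => Y (N ω) ω) = ENNReal.ofReal (1 - r) • geomSum r fun n => P.map (Y n) := by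
  have h := map_restrict_geometric hA hB hind hN hr hgeom hY (E := fun _ => univ)
    fun _ => MeasurableSet.univ
  simpa using h

end Mixture

variable {Ω : Type*} {mΩ : MeasurableSpace Ω}

/-- The laws of the position, the maximum and the minimum at the exponential time, and of the
position before exit and at the upper exit, with the equations they satisfy. -/
structure IsExitLaws (P : Measure Ω) (lam p q c s : ℝ) (F : Measure ℝ) (W X : ℕ → Ω → ℝ)
    (θ : Ω → ℝ) (x T : ℝ) (LP LM G U : Measure ℝ) : Prop where
  fluct : IsFluctuation (lam / (lam + s)) p q c F LP LM
  finite_killed : IsFiniteMeasure G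
  killed : G = Measure.dirac 0
    + ENNReal.ofReal (lam / (lam + s)) • (G ∗ jumpLaw p q c F).restrict (Ioo (x - T) x)
  finite_free : IsFiniteMeasure U
  free : U = Measure.dirac 0 + ENNReal.ofReal (lam / (lam + s)) • (U ∗ jumpLaw p q c F)
  aemeasurable_xi : AEMeasurable (fun ω => xi W X (θ ω) ω) P
  aemeasurable_sup : AEMeasurable (fun ω => xiSup W X (θ ω) ω) P
  aemeasurable_inf : AEMeasurable (fun ω => xiInf W X (θ ω) ω) P
  map_xi_restrict : (P.restrict (noExit W X θ x T)).map (fun ω => xi W X (θ ω) ω)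
    = ENNReal.ofReal (1 - lam / (lam + s)) • G
  map_xi : P.map (fun ω => xi W X (θ ω) ω) = ENNReal.ofReal (1 - lam / (lam + s)) • U
  map_sup : P.map (fun ω => xiSup W X (θ ω) ω) = LP
  map_inf : P.map (fun ω => xiInf W X (θ ω) ω) = LM
  exit : ∀ f : ℝ → ℂ, Measurable f → (∀ y, ‖f y‖ ≤ 1) →
    ∫ ω in upperExit W X x T,
        f (exitPos W X x T ω) * Complex.exp (-s * ((exitTime W X x T ω).toReal : ℂ)) ∂P
      = (lam / (lam + s) : ℝ) * ∫ y in Ici x, f y ∂(G ∗ jumpLaw p q c F)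

lemma lindleySeq_congr (g : ℝ → ℝ) (n : ℕ) {X X' : ℕ → Ω → ℝ} {ω : Ω} (h : ∀ k, X k ω = X' k ω) :
    lindleySeq g X n ω = lindleySeq g X' n ω := by
  induction n generalizing X X' with
  | zero => rfl
  | succ n ih => simp only [lindleySeq, h 0, ih fun k => h (k + 1)]

lemma partialSum_congr (n : ℕ) {X X' : ℕ → Ω → ℝ} {ω : Ω} (h : ∀ k, X k ω = X' k ω) :
    partialSum X n ω = partialSum X' n ω :=
  Finset.sum_congr rfl fun k _ => h k

lemma count_congr (t : ℝ) {W W' : ℕ → Ω → ℝ} {ω : Ω} (h : ∀ k, W k ω = W' k ω) :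
    count W t ω = count W' t ω := by
  have h1 : ∀ n, jumpTime W n ω = jumpTime W' n ω := fun n => partialSum_congr (n + 1) h
  simp only [count, h1]

lemma IsGoodPath.congr {W W' : ℕ → Ω → ℝ} {ω : Ω} (h : ∀ k, W k ω = W' k ω)
    (hg : IsGoodPath W' ω) : IsGoodPath W ω := by
  refine ⟨fun k => (h k).symm ▸ hg.pos k, fun M => ?_⟩
  obtain ⟨n, hn⟩ := hg.unbounded M
  exact ⟨n, by rwa [partialSum_congr n h]⟩

/-- The renewal equation multiplied by 1 - r, in the form of Lindley's equation. -/
lemma smul_geomSum_walkLaw_map {g : ℝ → ℝ} (hg : Measurable g) {r : ℝ} (hr : 0 ≤ r)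
    (μ : Measure ℝ) [IsProbabilityMeasure μ] :
    ENNReal.ofReal (1 - r) • geomSum r (walkLaw (fun M => M.map g) μ)
      = ENNReal.ofReal (1 - r) • Measure.dirac 0 + ENNReal.ofReal r •
        ((ENNReal.ofReal (1 - r) • geomSum r (walkLaw (fun M => M.map g) μ)) ∗ μ).map g := by
  have h := geomSum_eq hr (m := walkLaw (fun M => M.map g) μ) (μ := μ) (Ψ := fun M => M.map g)
    (fun m => Measure.map_sum hg.aemeasurable) (fun a M => Measure.map_smul _ _ _) rfl
    (fun n => rfl)
  conv_lhs => rw [h]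
  rw [smul_add, Measure.conv_smul_left, Measure.map_smul, smul_comm]

end ExitProblem

end

noncomputable section

namespace ExitProblem


/-! ### From the model to the equations of the walk. -/

variable {Ω : Type*} {mΩ : MeasurableSpace Ω}

/-- The transform at the upper exit, summed over the steps of the walk. -/
lemma setIntegral_upperExit {𝓐 𝓑 : MeasurableSpace Ω} {mΩ : MeasurableSpace Ω} {P : Measure Ω}
    [IsProbabilityMeasure P] (hA : 𝓐 ≤ mΩ) (hB : 𝓑 ≤ mΩ) (hind : Indep 𝓐 𝓑 P)
    {W X W' X' : ℕ → Ω → ℝ} {r s x T : ℝ} {μ : Measure ℝ} [IsProbabilityMeasure μ]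
    (hr0 : 0 ≤ r) (hr1 : r < 1) (hs : 0 < s)
    (hx : (0 : ℝ) ∈ Ioo (x - T) x)
    (hWm : ∀ k, Measurable[𝓐] (W' k)) (hXm : ∀ k, Measurable[𝓑] (X' k))
    (hlaw : ∀ k, P.map (X' k) = μ) (hiX : iIndepFun X' P)
    (hexp : ∀ n, ∫⁻ ω, ENNReal.ofReal (Real.exp (-s * partialSum W' n ω)) ∂P
      = ENNReal.ofReal (r ^ n))
    (hae : ∀ᵐ ω ∂P, IsGoodPath W ω ∧ (∀ k, W k ω = W' k ω) ∧ ∀ k, X k ω = X' k ω)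
    {f : ℝ → ℂ} (hf : Measurable f) (hf1 : ∀ y, ‖f y‖ ≤ 1) :
    ∫ ω in upperExit W X x T,
        f (exitPos W X x T ω) * Complex.exp (-s * ((exitTime W X x T ω).toReal : ℂ)) ∂P
      = r * ∫ y in Ici x, f y
          ∂(geomSum r (walkLaw (fun M => M.restrict (Ioo (x - T) x)) μ) ∗ μ) := by
  set D := Ioo (x - T) x
  set ν := walkLaw (fun M => M.restrict D) μ
  set A : ℕ → Set Ω := fun n => stayEvent X' D n ∩ partialSum X' (n + 1) ⁻¹' Ici x with hAdef
  set h : Ω → ℂ := fun ω =>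
    f (exitPos W X x T ω) * Complex.exp (-s * ((exitTime W X x T ω).toReal : ℂ)) with hh
  have hX' : ∀ k, Measurable (X' k) := fun k => (hXm k).mono hB le_rfl
  have hW' : ∀ k, Measurable (W' k) := fun k => (hWm k).mono hA le_rfl
  have hSm : ∀ n, Measurable[𝓑] (partialSum X' n) := fun n =>
    measurable_partialSum (m := 𝓑) fun k _ => hXm k
  have htm : ∀ n, Measurable[𝓐] (partialSum W' n) := fun n =>
    measurable_partialSum (m := 𝓐) fun k _ => hWm k
  have hAm : ∀ n, MeasurableSet[𝓑] (A n) := fun n => by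
    refine MeasurableSet.inter ?_ (hSm (n + 1) measurableSet_Ici)
    exact measurableSet_stayEvent (m := 𝓑) measurableSet_Ioo fun k _ => hXm k
  have hAm' : ∀ n, MeasurableSet (A n) := fun n => hB _ (hAm n)
  -- `A n` is the event that the upper exit happens at step n + 1; step 0 cannot be an exit because
  -- the walk starts inside the interval.
  have hset : upperExit W X x T =ᵐ[P] ⋃ n, A n := by
    filter_upwards [hae] with ω ⟨hg, _, hX⟩
    refine propext ?_
    change ω ∈ upperExit W X x T ↔ ω ∈ ⋃ n, A n
    rw [hg.mem_upperExit_iff hx]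
    simp [hAdef, stayEvent, partialSum_congr _ hX, D]
  have hval : ∀ n, ∀ᵐ ω ∂(P.restrict (A n)),
      f (partialSum X' (n + 1) ω) * Complex.exp (-s * (partialSum W' (n + 1) ω : ℂ)) = h ω := by
    intro n
    filter_upwards [ae_restrict_of_ae hae, ae_restrict_mem (hAm' n)] with ω ⟨hg, hW, hX⟩ hω
    have hin : ∀ k ≤ n, partialSum X k ω ∈ Ioo (x - T) x := fun k hk => by
      rw [partialSum_congr _ hX]
      exact hω.1 k hk
    have hout : partialSum X (n + 1) ω ∉ Ioo (x - T) x := fun h => by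
      rw [partialSum_congr _ hX] at h
      exact absurd h.2 (not_lt.2 hω.2)
    simp only [hh]
    rw [hg.exitPos_eq hin hout, hg.exitTime_eq hin hout,
      ENNReal.toReal_ofReal (hg.partialSum_nonneg _), partialSum_congr _ hX, partialSum_congr _ hW]
  have hmeas1 : ∀ n, Measurable fun ω =>
      f (partialSum X' (n + 1) ω) * Complex.exp (-s * (partialSum W' (n + 1) ω : ℂ)) := by
    intro n
    have h1 := (hSm (n + 1)).mono hB le_rfl
    have h2 := (htm (n + 1)).mono hA le_rfl
    fun_prop
  have hbound : ∀ ω, ‖h ω‖ ≤ 1 := by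
    intro ω
    rw [hh, norm_mul, Complex.norm_exp]
    refine mul_le_one₀ (hf1 _) (Real.exp_pos _).le (Real.exp_le_one_iff.2 ?_)
    have : 0 ≤ (exitTime W X x T ω).toReal := ENNReal.toReal_nonneg
    simp
    positivity
  -- Measurability of h is obtained piecewise: on each `A n` it agrees almost everywhere with an
  -- explicit measurable function.
  have hint : IntegrableOn h (⋃ n, A n) P := by
    refine Integrable.mono' (integrable_const (1 : ℝ)) ?_ (ae_of_all _ hbound)
    rw [aestronglyMeasurable_iUnion_iff]
    exact fun n => (hmeas1 n).aestronglyMeasurable.congr (hval n)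
  have hdisj : Pairwise (Function.onFun Disjoint A) := by
    have key : ∀ m n ω, m < n → ω ∈ A m → ω ∈ A n → False := by
      intro m n ω hmn hm hn
      exact absurd (hn.1 (m + 1) hmn).2 (not_lt.2 hm.2)
    intro m n hmn
    refine Set.disjoint_left.2 fun ω hm hn => ?_
    rcases lt_or_gt_of_ne hmn with h | h
    · exact key m n ω h hm hn
    · exact key n m ω h hn hm
  have hsum1 := hasSum_integral_iUnion hAm' hdisj hint
  rw [← setIntegral_congr_set hset] at hsum1
  have hexpC : ∀ n, ∫ ω, Complex.exp (-s * (partialSum W' n ω : ℂ)) ∂P = (r ^ n : ℝ) := by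
    intro n
    have h1 : ∀ ω, Complex.exp (-s * (partialSum W' n ω : ℂ))
        = ((Real.exp (-s * partialSum W' n ω) : ℝ) : ℂ) := by
      intro ω
      push_cast
      rfl
    simp_rw [h1]
    rw [integral_complex_ofReal, integral_eq_lintegral_of_nonneg_ae
      (ae_of_all _ fun ω => (Real.exp_pos _).le), hexp, ENNReal.toReal_ofReal (by positivity)]
    have := (htm n).mono hA le_rfl
    exact Measurable.aestronglyMeasurable (by fun_prop)
  -- The position is a function of the jumps and the time of the waiting times, so the integral
  -- factors. The time factor r^{n+1} supplies one r in front and the weight r^n of the geometric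
  -- sum.
  have hterm : ∀ n, ∫ ω in A n, h ω ∂P
      = r * ∫ y, f y ∂(ENNReal.ofReal (r ^ n) • (ν n ∗ μ).restrict (Ici x)) := by
    intro n
    rw [← integral_congr_ae (hval n), ← integral_indicator (hAm' n)]
    have h1 : ∀ ω, (A n).indicator (fun ω => f (partialSum X' (n + 1) ω)
          * Complex.exp (-s * (partialSum W' (n + 1) ω : ℂ))) ω
        = (A n).indicator (fun ω => f (partialSum X' (n + 1) ω)) ω
          * Complex.exp (-s * (partialSum W' (n + 1) ω : ℂ)) := by
      intro ω
      by_cases hω : ω ∈ A n <;> simp [hω]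
    simp_rw [h1]
    have hm1 : Measurable[𝓑] ((A n).indicator fun ω => f (partialSum X' (n + 1) ω)) :=
      (hf.comp (hSm (n + 1))).indicator (hAm n)
    have hm2 : Measurable[𝓐] fun ω => Complex.exp (-s * (partialSum W' (n + 1) ω : ℂ)) := by
      have h2 : Measurable fun y : ℝ => Complex.exp (-s * (y : ℂ)) := by fun_prop
      exact h2.comp (htm (n + 1))
    have hindep : IndepFun ((A n).indicator fun ω => f (partialSum X' (n + 1) ω))
        (fun ω => Complex.exp (-s * (partialSum W' (n + 1) ω : ℂ))) P :=
      indep_of_indep_of_le_left (indep_of_indep_of_le_right hind.symm hm2.comap_le) hm1.comap_le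
    rw [hindep.integral_fun_mul_eq_mul_integral
      (hm1.mono hB le_rfl).aestronglyMeasurable (hm2.mono hA le_rfl).aestronglyMeasurable,
      hexpC, integral_indicator (hAm' n)]
    have hS' : Measurable (partialSum X' (n + 1)) := (hSm (n + 1)).mono hB le_rfl
    have h3 : ∫ ω in A n, f (partialSum X' (n + 1) ω) ∂P = ∫ y in Ici x, f y ∂(ν n ∗ μ) := by
      rw [← integral_map (φ := partialSum X' (n + 1)) hS'.aemeasurable hf.aestronglyMeasurable,
        restrict_map_restrict hS' _ measurableSet_Ici,
        map_partialSum_succ_restrict hX' hlaw hiX measurableSet_Ioo,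
        map_partialSum_restrict hX' hlaw hiX measurableSet_Ioo hx]
    rw [h3, integral_smul_measure, ENNReal.toReal_ofReal (by positivity), Complex.real_smul]
    push_cast
    ring
  simp_rw [hterm] at hsum1
  have hfin : IsFiniteMeasure (geomSum r ν) := by
    refine isFiniteMeasure_geomSum hr0 hr1 _ (walkLaw_univ_le_one fun M => ?_)
    exact Measure.restrict_le_self univ
  have hmeasure : (geomSum r ν ∗ μ).restrict (Ici x)
      = Measure.sum fun n => ENNReal.ofReal (r ^ n) • (ν n ∗ μ).restrict (Ici x) := by
    rw [geomSum, sum_conv, Measure.restrict_sum _ measurableSet_Ici]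
    congr 1
    ext1 n
    rw [Measure.conv_smul_left, Measure.restrict_smul]
  have hfint : Integrable f ((geomSum r ν ∗ μ).restrict (Ici x)) :=
    Integrable.mono' (integrable_const (1 : ℝ)) hf.aestronglyMeasurable (ae_of_all _ hf1)
  rw [hmeasure] at hfint ⊢
  exact hsum1.unique ((hasSum_integral_measure hfint).mul_left (r : ℂ))

/-- All the probability is used here: afterwards only equations between measures on the line remain.
-/
theorem exists_isExitLaws {P : Measure Ω} [IsProbabilityMeasure P]
    {lam p q c s : ℝ} (hlam : 0 < lam) (hp : 0 ≤ p) (hq : 0 ≤ q) (hpq : p + q = 1)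
    (hc : 0 < c) (hs : 0 < s)
    {F : Measure ℝ} [IsProbabilityMeasure F] (hF : F (Ici 0) = 0)
    {W X : ℕ → Ω → ℝ} {θ : Ω → ℝ} (hmodel : IsModel P lam p q c s F W X θ)
    {x T : ℝ} (hx : 0 < x) (hxT : x < T) :
    ∃ LP LM G U, IsExitLaws P lam p q c s F W X θ x T LP LM G U := by
  have hμ := isProbabilityMeasure_jumpLaw hp hq hpq hc F
  set μ := jumpLaw p q c F with hμdef
  set r := lam / (lam + s) with hrdef
  have hr0 : 0 < r := by positivity
  have hr1 : r < 1 := (div_lt_one (by positivity)).2 (by linarith)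
  have h0 : (0 : ℝ) ∈ Ioo (x - T) x := ⟨by linarith, hx⟩
  -- `HasLaw` gives only almost everywhere measurability; strictly measurable versions are needed to
  -- speak of generated σ-algebras.
  set W' : ℕ → Ω → ℝ := fun k => (hmodel.waiting k).aemeasurable.mk (W k)
  set X' : ℕ → Ω → ℝ := fun k => (hmodel.jump k).aemeasurable.mk (X k)
  set θ' : Ω → ℝ := hmodel.clock.aemeasurable.mk θ
  have hWW : ∀ k, W k =ᵐ[P] W' k := fun k => (hmodel.waiting k).aemeasurable.ae_eq_mk
  have hXX : ∀ k, X k =ᵐ[P] X' k := fun k => (hmodel.jump k).aemeasurable.ae_eq_mk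
  have hθθ : θ =ᵐ[P] θ' := hmodel.clock.aemeasurable.ae_eq_mk
  have hWm : ∀ k, Measurable (W' k) := fun k => (hmodel.waiting k).aemeasurable.measurable_mk
  have hXm : ∀ k, Measurable (X' k) := fun k => (hmodel.jump k).aemeasurable.measurable_mk
  have hθm : Measurable θ' := hmodel.clock.aemeasurable.measurable_mk
  have hWlaw : ∀ k, P.map (W' k) = expMeasure lam := fun k => by
    rw [← Measure.map_congr (hWW k), (hmodel.waiting k).map_eq]
  have hXlaw : ∀ k, P.map (X' k) = μ := fun k => by
    rw [← Measure.map_congr (hXX k), (hmodel.jump k).map_eq]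
  have hθlaw : P.map θ' = expMeasure s := by
    rw [← Measure.map_congr hθθ, hmodel.clock.map_eq]
  set Z : ℕ ⊕ ℕ ⊕ Unit → Ω → ℝ := Sum.elim W' (Sum.elim X' fun _ => θ') with hZ
  have hZind : iIndepFun Z P := hmodel.indep.congr (by
    rintro (k | k | k)
    · exact hWW k
    · exact hXX k
    · exact hθθ)
  have hZm : ∀ i, Measurable (Z i) := by
    rintro (k | k | k)
    · exact hWm k
    · exact hXm k
    · exact hθm
  have hiW : iIndepFun W' P := hZind.precomp Sum.inl_injective
  have hiX : iIndepFun X' P := hZind.precomp (Sum.inr_injective.comp Sum.inl_injective)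
  -- Indices of the jumps; the complement holds the waiting times and the clock, which determine the
  -- number of steps N.
  set SX : Set (ℕ ⊕ ℕ ⊕ Unit) := range fun k => Sum.inr (Sum.inl k)
  have hind : Indep (sigmaOf Z SXᶜ) (sigmaOf Z SX) P :=
    indep_sigmaOf hZm hZind disjoint_compl_left
  have hA : sigmaOf Z SXᶜ ≤ mΩ := sigmaOf_le hZm _
  have hB : sigmaOf Z SX ≤ mΩ := sigmaOf_le hZm _
  have hWA : ∀ k, Measurable[sigmaOf Z SXᶜ] (W' k) := fun k =>
    measurable_sigmaOf Z (i := Sum.inl k) (by simp [SX])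
  have hθA : Measurable[sigmaOf Z SXᶜ] θ' :=
    measurable_sigmaOf Z (i := Sum.inr (Sum.inr ())) (by simp [SX])
  have hXB : ∀ k, Measurable[sigmaOf Z SX] (X' k) := fun k =>
    measurable_sigmaOf Z (i := Sum.inr (Sum.inl k)) (by simp [SX])
  have hindθ : ∀ n, IndepFun (partialSum W' n) θ' P := by
    intro n
    have h1 : Indep (sigmaOf Z (range Sum.inl)) (sigmaOf Z {Sum.inr (Sum.inr ())}) P :=
      indep_sigmaOf hZm hZind (by simp)
    have h2 : Measurable[sigmaOf Z (range Sum.inl)] (partialSum W' n) :=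
      measurable_partialSum (m := sigmaOf Z (range Sum.inl)) fun k _ =>
        measurable_sigmaOf Z (i := Sum.inl k) (by simp)
    have h3 : Measurable[sigmaOf Z {Sum.inr (Sum.inr ())}] θ' :=
      measurable_sigmaOf Z (i := Sum.inr (Sum.inr ())) (by simp)
    exact indep_of_indep_of_le_left (indep_of_indep_of_le_right h1 h3.comap_le) h2.comap_le
  set N : Ω → ℕ := fun ω => count W' (θ' ω) ω
  have hNA : Measurable[sigmaOf Z SXᶜ] N := measurable_count (m := sigmaOf Z SXᶜ) hWA hθA
  have hN : Measurable N := measurable_count hWm hθm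
  have hgeom := measure_count_eq hlam hs hWm hWlaw hiW hθm hθlaw hindθ
  have hgood' := ae_isGoodPath hlam hWm hWlaw hiW
  have hae : ∀ᵐ ω ∂P, IsGoodPath W ω ∧ (∀ k, W k ω = W' k ω) ∧ ∀ k, X k ω = X' k ω := by
    filter_upwards [ae_all_iff.2 hWW, ae_all_iff.2 hXX, hgood'] with ω h1 h2 h3
    exact ⟨h3.congr h1, h1, h2⟩
  have haeθ : ∀ᵐ ω ∂P, θ ω = θ' ω ∧ 0 ≤ θ ω ∧ count W (θ ω) ω = N ω := by
    filter_upwards [hθθ, ae_pos_of_map_eq_expMeasure hθm hθlaw, hae] with ω h1 h2 h3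
    refine ⟨h1, h1 ▸ h2.le, ?_⟩
    rw [h1]
    exact count_congr _ h3.2.1
  have hxi : (fun ω => xi W X (θ ω) ω) =ᵐ[P] fun ω => partialSum X' (N ω) ω := by
    filter_upwards [hae, haeθ] with ω h1 h2
    change partialSum X (count W (θ ω) ω) ω = _
    rw [h2.2.2, partialSum_congr _ h1.2.2]
  have hsup : (fun ω => xiSup W X (θ ω) ω) =ᵐ[P] fun ω => lindleySeq (max 0) X' (N ω) ω := by
    filter_upwards [hae, haeθ] with ω h1 h2
    rw [h1.1.xiSup_eq h2.2.1, h2.2.2, lindleySeq_congr _ _ h1.2.2]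
  have hinf : (fun ω => xiInf W X (θ ω) ω) =ᵐ[P] fun ω => lindleySeq (min 0) X' (N ω) ω := by
    filter_upwards [hae, haeθ] with ω h1 h2
    rw [h1.1.xiInf_eq h2.2.1, h2.2.2, lindleySeq_congr _ _ h1.2.2]
  have hno : noExit W X θ x T =ᵐ[P] {ω | ω ∈ stayEvent X' (Ioo (x - T) x) (N ω)} := by
    filter_upwards [hae, haeθ] with ω h1 h2
    refine propext ?_
    change ENNReal.ofReal (θ ω) < exitTime W X x T ω ↔ ω ∈ stayEvent X' (Ioo (x - T) x) (N ω)
    rw [h1.1.lt_exitTime_iff h0 h2.2.1, h2.2.2]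
    simp [stayEvent, partialSum_congr _ h1.2.2]
  have hmaxm : Measurable (max (0 : ℝ)) := by fun_prop
  have hminm : Measurable (min (0 : ℝ)) := by fun_prop
  have hSB : ∀ n, Measurable[sigmaOf Z SX] (partialSum X' n) := fun n =>
    measurable_partialSum (m := sigmaOf Z SX) fun k _ => hXB k
  have hlB : ∀ {g : ℝ → ℝ}, Measurable g → ∀ n, Measurable[sigmaOf Z SX] (lindleySeq g X' n) :=
    fun hg n => measurable_lindleySeq (m := sigmaOf Z SX) hg n hXB
  have hlindley : ∀ {g : ℝ → ℝ}, Measurable g → P.map (fun ω => lindleySeq g X' (N ω) ω)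
      = ENNReal.ofReal (1 - r) • geomSum r (walkLaw (fun M => M.map g) μ) := by
    intro g hg
    rw [map_geometric hA hB hind hNA hr1.le hgeom (hlB hg)]
    congr 2
    ext1 n
    exact map_lindleySeq hg n hXm hXlaw hiX
  have hfree : geomSum r (walkLaw id μ)
      = Measure.dirac 0 + ENNReal.ofReal r • (geomSum r (walkLaw id μ) ∗ μ) :=
    geomSum_eq hr0.le (Ψ := id) (fun m => rfl) (fun a M => rfl) rfl fun n => rfl
  have hkilled : geomSum r (walkLaw (fun M => M.restrict (Ioo (x - T) x)) μ) = Measure.dirac 0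
      + ENNReal.ofReal r •
        (geomSum r (walkLaw (fun M => M.restrict (Ioo (x - T) x)) μ) ∗ μ).restrict (Ioo (x - T) x) :=
    geomSum_eq hr0.le (Ψ := fun M => M.restrict (Ioo (x - T) x))
      (fun m => Measure.restrict_sum _ measurableSet_Ioo) (fun a M => Measure.restrict_smul _ _ _)
      rfl fun n => rfl
  have hmsup := measurable_eval_nat hN fun n => measurable_lindleySeq hmaxm n hXm
  have hminf := measurable_eval_nat hN fun n => measurable_lindleySeq hminm n hXm
  have hmxi : Measurable fun ω => partialSum X' (N ω) ω :=
    measurable_eval_nat hN fun n => measurable_partialSum fun k _ => hXm k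
  refine ⟨P.map fun ω => xiSup W X (θ ω) ω, P.map fun ω => xiInf W X (θ ω) ω,
    geomSum r (walkLaw (fun M => M.restrict (Ioo (x - T) x)) μ), geomSum r (walkLaw id μ),
    ⟨⟨hr0, hr1, hc, inferInstance, hμ, hF, ?_, ?_, ?_, ?_⟩, ?_, hkilled, ?_, hfree,
      ⟨_, hmxi, hxi⟩, ⟨_, hmsup, hsup⟩, ⟨_, hminf, hinf⟩, ?_, ?_, rfl, rfl, ?_⟩⟩
  · exact Measure.isProbabilityMeasure_map ⟨_, hmsup, hsup⟩
  · exact Measure.isProbabilityMeasure_map ⟨_, hminf, hinf⟩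
  · rw [Measure.map_congr hsup, hlindley hmaxm]
    exact smul_geomSum_walkLaw_map hmaxm hr0.le μ
  · rw [Measure.map_congr hinf, hlindley hminm]
    exact smul_geomSum_walkLaw_map hminm hr0.le μ
  · exact isFiniteMeasure_geomSum hr0.le hr1 _
      (walkLaw_univ_le_one fun M => Measure.restrict_le_self univ)
  · exact isFiniteMeasure_geomSum hr0.le hr1 _ (walkLaw_univ_le_one fun M => le_rfl)
  · rw [Measure.restrict_congr_set hno, Measure.map_congr (ae_restrict_of_ae hxi),
      map_restrict_geometric hA hB hind hNA hr1.le hgeom hSB (E := stayEvent X' (Ioo (x - T) x))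
        (fun n => measurableSet_stayEvent (m := sigmaOf Z SX) measurableSet_Ioo fun k _ => hXB k)]
    congr 2
    ext1 n
    exact map_partialSum_restrict hXm hXlaw hiX measurableSet_Ioo h0 n
  · rw [Measure.map_congr hxi, map_geometric hA hB hind hNA hr1.le hgeom hSB]
    congr 2
    ext1 n
    have h := map_partialSum_restrict hXm hXlaw hiX MeasurableSet.univ (mem_univ 0) n
    have h1 : stayEvent X' univ n = univ := by
      ext ω
      simp [stayEvent]
    rw [h1, Measure.restrict_univ] at h
    rw [h]
    congr 1
    ext1 M
    exact Measure.restrict_univ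
  · intro f hf hf1
    exact setIntegral_upperExit hA hB hind hr0.le hr1 hs h0 hWA hXB hXlaw hiX
      (lintegral_exp_neg_mul_partialSum hlam hs.le hWm hWlaw hiW) hae hf hf1

end ExitProblem

end

noncomputable section

namespace ExitProblem


/-! ### The exit identities -/

lemma integral_exp_I_mul (M : Measure ℝ) (α : ℝ) :
    ∫ y : ℝ, Complex.exp (Complex.I * α * y) ∂M = charFun M α := by
  rw [charFun_apply_real]
  congr with y
  ring_nf

lemma charFun_restrict_rnDeriv {M : Measure ℝ} [IsFiniteMeasure M] (hM : M ≪ volume) {I : Set ℝ}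
    (hI : MeasurableSet I) (α : ℝ) :
    ∫ y in I, Complex.exp (Complex.I * α * y) * ((M.rnDeriv volume y).toReal : ℂ)
      = charFun (M.restrict I) α := by
  rw [← integral_exp_I_mul, ← setIntegral_rnDeriv_smul hM hI]
  congr with y
  rw [Complex.real_smul, mul_comm]

lemma integrable_exp_mul_rnDeriv (M : Measure ℝ) [IsFiniteMeasure M] (α : ℝ) :
    Integrable fun y : ℝ => Complex.exp (Complex.I * α * y) * ((M.rnDeriv volume y).toReal : ℂ) := by
  have h : Integrable fun y => ((M.rnDeriv volume y).toReal : ℂ) :=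
    (Measure.integrable_toReal_rnDeriv (μ := M) (ν := volume)).ofReal
  refine h.bdd_mul (c := 1) (by fun_prop) (ae_of_all _ fun y => ?_)
  rw [mul_assoc, mul_comm, ← Complex.ofReal_mul, Complex.norm_exp_ofReal_mul_I]

/-- G is the difference of the Radon–Nikodym densities. The constant C is the atom at 0, which
survives restriction because 0 ∈ I. -/
lemma isProjection_charFun {C : ℝ} (hC : 0 ≤ C) {A M : Measure ℝ} [IsFiniteMeasure A]
    [IsFiniteMeasure M] (hA : A ≪ volume) (hM : M ≪ volume) {I : Set ℝ} (hI : MeasurableSet I)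
    (h0 : (0 : ℝ) ∈ I) :
    IsProjection I
      (fun α => charFun (ENNReal.ofReal C • Measure.dirac 0 + A) α - charFun M α)
      (fun α => charFun ((ENNReal.ofReal C • Measure.dirac 0 + A).restrict I) α
        - charFun (M.restrict I) α) := by
  have hG : ∀ α y : ℝ, Complex.exp (Complex.I * α * y)
      * (((A.rnDeriv volume y).toReal : ℂ) - ((M.rnDeriv volume y).toReal : ℂ))
      = Complex.exp (Complex.I * α * y) * ((A.rnDeriv volume y).toReal : ℂ)
        - Complex.exp (Complex.I * α * y) * ((M.rnDeriv volume y).toReal : ℂ) :=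
    fun α y => mul_sub _ _ _
  have hset : ∀ {J : Set ℝ}, MeasurableSet J → ∀ α : ℝ, ∫ y in J, Complex.exp (Complex.I * α * y)
      * (((A.rnDeriv volume y).toReal : ℂ) - ((M.rnDeriv volume y).toReal : ℂ))
      = charFun (A.restrict J) α - charFun (M.restrict J) α := by
    intro J hJ α
    simp_rw [hG]
    rw [integral_sub (integrable_exp_mul_rnDeriv A α).integrableOn
      (integrable_exp_mul_rnDeriv M α).integrableOn, charFun_restrict_rnDeriv hA hJ,
      charFun_restrict_rnDeriv hM hJ]
  refine ⟨C, fun y => ((A.rnDeriv volume y).toReal : ℂ) - ((M.rnDeriv volume y).toReal : ℂ),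
    ?_, fun α => ?_, fun α => ?_⟩
  · exact Measure.integrable_toReal_rnDeriv.ofReal.sub Measure.integrable_toReal_rnDeriv.ofReal
  · have h := hset MeasurableSet.univ α
    simp only [Measure.restrict_univ] at h
    change charFun (ENNReal.ofReal C • Measure.dirac 0 + A) α - charFun M α = _
    rw [h, charFun_add, charFun_ofReal_smul hC, charFun_dirac_zero]
    ring
  · have hd : (Measure.dirac (0 : ℝ)).restrict I = Measure.dirac 0 := by
      refine Measure.restrict_eq_self_of_ae_mem ?_
      exact (ae_dirac_iff (p := fun y => y ∈ I) hI).2 h0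
    change charFun ((ENNReal.ofReal C • Measure.dirac 0 + A).restrict I) α
      - charFun (M.restrict I) α = _
    rw [hset hI α, Measure.restrict_add, Measure.restrict_smul, hd, charFun_add,
      charFun_ofReal_smul hC, charFun_dirac_zero]
    ring

lemma isMeasureProjection_charFun (M N : Measure ℝ) [IsFiniteMeasure M] [IsFiniteMeasure N]
    (I : Set ℝ) :
    IsMeasureProjection I (fun α => charFun M α - charFun N α)
      (fun α => charFun (M.restrict I) α - charFun (N.restrict I) α) :=
  ⟨M, N, inferInstance, inferInstance, fun α => by simp_rw [integral_exp_I_mul],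
    fun α => by simp_rw [integral_exp_I_mul]⟩

/-! ### The quantities of the statement in terms of the laws of the walk. -/

namespace IsExitLaws

variable {Ω : Type*} [MeasurableSpace Ω] {P : Measure Ω} {lam p q c s : ℝ} {F : Measure ℝ}
  {W X : ℕ → Ω → ℝ} {θ : Ω → ℝ} {x T : ℝ} {LP LM G U : Measure ℝ}

lemma pPlus_eq (hE : IsExitLaws P lam p q c s F W X θ x T LP LM G U) :
    pPlus P W X θ = LP.real {0} := by
  rw [← hE.map_sup, map_measureReal_apply_of_aemeasurable hE.aemeasurable_sup
    (measurableSet_singleton 0)]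
  rfl

lemma pMinus_eq (hE : IsExitLaws P lam p q c s F W X θ x T LP LM G U) :
    pMinus P W X θ = LM.real {0} := by
  rw [← hE.map_inf, map_measureReal_apply_of_aemeasurable hE.aemeasurable_inf
    (measurableSet_singleton 0)]
  rfl

lemma PMinus_eq (hE : IsExitLaws P lam p q c s F W X θ x T LP LM G U) :
    PMinus P W X θ = fun z => LM.real (Iio z) := by
  ext z
  rw [← hE.map_inf, map_measureReal_apply_of_aemeasurable hE.aemeasurable_inf measurableSet_Iio]
  rfl

lemma lawMinus_eq (hE : IsExitLaws P lam p q c s F W X θ x T LP LM G U) :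
    lawMinus P W X θ = LM := hE.map_inf

lemma phiPlus_eq (hE : IsExitLaws P lam p q c s F W X θ x T LP LM G U) (α : ℝ) :
    phiPlus P W X θ α = charFun LP α := by
  rw [← integral_exp_I_mul, ← hE.map_sup, integral_map hE.aemeasurable_sup
    (Measurable.aestronglyMeasurable (by fun_prop))]
  rfl

lemma phiMinus_eq (hE : IsExitLaws P lam p q c s F W X θ x T LP LM G U) (α : ℝ) :
    phiMinus P W X θ α = charFun LM α := by
  rw [← integral_exp_I_mul, ← hE.map_inf, integral_map hE.aemeasurable_inf
    (Measurable.aestronglyMeasurable (by fun_prop))]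
  rfl

lemma VNoExit_eq (hE : IsExitLaws P lam p q c s F W X θ x T LP LM G U) (α : ℝ) :
    VNoExit P W X θ α x T = charFun (ENNReal.ofReal (1 - lam / (lam + s)) • G) α := by
  rw [← integral_exp_I_mul, ← hE.map_xi_restrict, integral_map
    (hE.aemeasurable_xi.mono_measure Measure.restrict_le_self)
    (Measurable.aestronglyMeasurable (by fun_prop))]
  rfl

lemma measure_inter_noExit (hE : IsExitLaws P lam p q c s F W X θ x T LP LM G U) {B : Set ℝ}
    (hB : MeasurableSet B) :
    P.real ({ω | xi W X (θ ω) ω ∈ B} ∩ noExit W X θ x T)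
      = (ENNReal.ofReal (1 - lam / (lam + s)) • G).real B := by
  rw [← hE.map_xi_restrict, map_measureReal_apply_of_aemeasurable
    (hE.aemeasurable_xi.mono_measure Measure.restrict_le_self) hB, measureReal_def, measureReal_def,
    Measure.restrict_apply₀]
  · rfl
  · exact (hE.aemeasurable_xi.mono_measure Measure.restrict_le_self).nullMeasurable hB

/-- The integrals at the upper exit, as integrals over the exit measure. -/
lemma exit_eq (hE : IsExitLaws P lam p q c s F W X θ x T LP LM G U) {f : ℝ → ℂ}
    (hf : Measurable f) (hf1 : ∀ y, ‖f y‖ ≤ 1) :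
    ∫ ω in upperExit W X x T,
        f (exitPos W X x T ω) * Complex.exp (-s * ((exitTime W X x T ω).toReal : ℂ)) ∂P
      = ∫ y, f y ∂(ENNReal.ofReal (lam / (lam + s)) •
          (G ∗ jumpLaw p q c F).restrict (Ici x)) := by
  rw [hE.exit f hf hf1, integral_smul_measure, ENNReal.toReal_ofReal hE.fluct.r_pos.le,
    Complex.real_smul]

lemma QT_eq (hE : IsExitLaws P lam p q c s F W X θ x T LP LM G U) :
    QT P W X s x T = lam / (lam + s) * (G ∗ jumpLaw p q c F).real (Ici x) := by
  have h := hE.exit (fun _ => 1) measurable_const (by simp)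
  have h1 : ∀ ω, (1 : ℂ) * Complex.exp (-s * ((exitTime W X x T ω).toReal : ℂ))
      = ((Real.exp (-s * (exitTime W X x T ω).toReal) : ℝ) : ℂ) := by
    intro ω
    push_cast
    rw [one_mul]
  simp_rw [h1] at h
  rw [integral_complex_ofReal, integral_const] at h
  simp only [measureReal_restrict_apply_univ, Complex.real_smul, mul_one] at h
  exact_mod_cast h

lemma VPosition_eq_charFun (hE : IsExitLaws P lam p q c s F W X θ x T LP LM G U) (α : ℝ) :
    VPosition P W X s α x T = charFun (ENNReal.ofReal (lam / (lam + s)) •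
      (G ∗ jumpLaw p q c F).restrict (Ici x)) α := by
  rw [← integral_exp_I_mul, ← hE.exit_eq (f := fun y => Complex.exp (Complex.I * α * y))
    (by fun_prop) fun y => ?_]
  · rw [VPosition]
    congr with ω
    rw [← Complex.exp_add]
    ring_nf
  · rw [mul_assoc, mul_comm, ← Complex.ofReal_mul, Complex.norm_exp_ofReal_mul_I]

lemma VPosition_eq_mul (α : ℝ) :
    VPosition P W X s α x T = Complex.exp (Complex.I * α * x) * VOvershoot P W X s α x T := by
  rw [VPosition, VOvershoot, ← integral_const_mul]
  congr with ω
  rw [← Complex.exp_add]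
  push_cast
  ring_nf

lemma VPosition_eq (hE : IsExitLaws P lam p q c s F W X θ x T LP LM G U) (hx : 0 < x) (hxT : x < T)
    (α : ℝ) :
    VPosition P W X s α x T
      = c * Complex.exp (Complex.I * α * x) / (c - Complex.I * α) * (QT P W X s x T : ℂ) := by
  have := hE.finite_killed
  have hr := hE.fluct.r_pos
  rw [hE.VPosition_eq_charFun, hE.fluct.killed_exit_upper (by linarith) hx hE.killed,
    charFun_ofReal_smul (by positivity), charFun_map_const_add, charFun_expMeasure hE.fluct.c_pos,
    hE.QT_eq]
  have : Complex.exp (inner ℝ x α * Complex.I) = Complex.exp (Complex.I * α * x) := by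
    congr 1
    simp [inner]
    ring
  rw [this]
  push_cast
  ring

lemma VOvershoot_eq (hE : IsExitLaws P lam p q c s F W X θ x T LP LM G U) (hx : 0 < x) (hxT : x < T)
    (α : ℝ) :
    VOvershoot P W X s α x T = c / (c - Complex.I * α) * (QT P W X s x T : ℂ) := by
  refine mul_left_cancel₀ (Complex.exp_ne_zero (Complex.I * α * x)) ?_
  rw [← VPosition_eq_mul, hE.VPosition_eq hx hxT]
  ring

lemma h_eq (hE : IsExitLaws P lam p q c s F W X θ x T LP LM G U) (z : ℝ) :
    h P c s W X θ T x z = IsFluctuation.positionDensity (LP.real {0}) (c * LP.real {0})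
      (lam / (lam + s) * (G ∗ jumpLaw p q c F).real (Ici x)) x LM z := by
  rw [h, IsFluctuation.positionDensity, qPlus, rhoPlus, hE.pPlus_eq, hE.PMinus_eq, hE.lawMinus_eq,
    hE.QT_eq]

lemma phiMinus_mul_eq (hE : IsExitLaws P lam p q c s F W X θ x T LP LM G U) :
    (fun α => phiMinus P W X θ α * (1 - VPosition P W X s α x T))
      = fun α => charFun LM α - charFun (LM ∗ (ENNReal.ofReal (lam / (lam + s)) •
          (G ∗ jumpLaw p q c F).restrict (Ici x))) α := by
  have := hE.finite_killed
  have := hE.fluct.prob_inf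
  have := hE.fluct.prob_jump
  ext α
  rw [hE.phiMinus_eq, hE.VPosition_eq_charFun, charFun_conv]
  ring

lemma phiMinus_mul_eq_explicit (hE : IsExitLaws P lam p q c s F W X θ x T LP LM G U) (hx : 0 < x)
    (hxT : x < T) :
    (fun α : ℝ => phiMinus P W X θ α
      * (1 - c * Complex.exp (Complex.I * α * x) / (c - Complex.I * α) * (QT P W X s x T : ℂ)))
      = fun α => phiMinus P W X θ α * (1 - VPosition P W X s α x T) := by
  ext α
  rw [hE.VPosition_eq hx hxT]

/-- The half-line is open because the minimum may have an atom at x - T, a position that already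
counts as exit. -/
lemma exists_isMeasureProjection (hE : IsExitLaws P lam p q c s F W X θ x T LP LM G U)
    (hx : 0 < x) (hxT : x < T) :
    ∃ g : ℝ → ℂ, IsMeasureProjection (Ioi (x - T))
        (fun α => phiMinus P W X θ α * (1 - VPosition P W X s α x T)) g ∧
      ∀ α : ℝ, VNoExit P W X θ α x T = phiPlus P W X θ α * g α := by
  have := hE.finite_killed
  have := hE.fluct.prob_inf
  have := hE.fluct.prob_jump
  rw [hE.phiMinus_mul_eq]
  refine ⟨_, isMeasureProjection_charFun _ _ _, fun α => ?_⟩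
  rw [hE.VNoExit_eq, hE.phiPlus_eq,
    hE.fluct.charFun_killed_eq_projection (by linarith) hx hE.killed]

lemma exists_isProjection (hE : IsExitLaws P lam p q c s F W X θ x T LP LM G U)
    (hF : F ≪ volume) (hx : 0 < x) (hxT : x < T) :
    ∃ g : ℝ → ℂ, IsProjection (Ici (x - T))
        (fun α => phiMinus P W X θ α * (1 - VPosition P W X s α x T)) g ∧
      ∀ α : ℝ, VNoExit P W X θ α x T = phiPlus P W X θ α * g α := by
  have := hE.finite_killed
  have := hE.fluct.prob_inf
  have := hE.fluct.prob_jump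
  have := isProbabilityMeasure_expMeasure hE.fluct.c_pos
  have ha : x - T < 0 := by linarith
  rw [hE.phiMinus_mul_eq]
  set M := LM ∗ (ENNReal.ofReal (lam / (lam + s)) • (G ∗ jumpLaw p q c F).restrict (Ici x))
    with hMdef
  -- The upper exit law is a multiple of a shifted exponential, so its convolution with the minimum
  -- has a density.
  have hM : M ≪ volume := by
    rw [hMdef, hE.fluct.killed_exit_upper ha hx hE.killed, Measure.conv_smul_right]
    refine Measure.AbsolutelyContinuous.smul_left ?_ _
    refine Measure.conv_absolutelyContinuous ?_
    refine Measure.AbsolutelyContinuous.mk fun B hB hB0 => ?_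
    rw [Measure.map_apply (by fun_prop) hB]
    refine expMeasure_absolutelyContinuous c ?_
    rwa [measure_preimage_add]
  have hLM : LM = ENNReal.ofReal (LM.real {0}) • Measure.dirac 0 + LM.restrict (Iio 0) := by
    rw [measureReal_def, ENNReal.ofReal_toReal (by finiteness), ← Measure.restrict_singleton,
      ← Measure.restrict_union (by simp) measurableSet_Iio]
    refine (Measure.restrict_eq_self_of_ae_mem ?_).symm
    rw [ae_iff]
    refine measure_mono_null (fun y hy => ?_) hE.fluct.inf_Ioi
    by_contra h
    have hy0 : ¬ 0 < y := h
    rcases (not_lt.1 hy0).eq_or_lt with h' | h'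
    · exact hy (Or.inl h')
    · exact hy (Or.inr h')
  have hproj := isProjection_charFun (C := LM.real {0}) measureReal_nonneg
    (hE.fluct.inf_restrict_absolutelyContinuous hF) hM (measurableSet_Ici (a := x - T)) ha.le
  rw [← hLM] at hproj
  refine ⟨_, hproj, fun α => ?_⟩
  -- When F has a density, neither measure charges the endpoint x - T, so closed and open half-lines
  -- give the same projection.
  have h1 : LM.restrict (Ici (x - T)) = LM.restrict (Ioi (x - T)) :=
    Measure.restrict_congr_set
      (Ioi_ae_eq_Ici' (hE.fluct.inf_singleton (fun y => hF (by simp)) ha.ne)).symm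
  have h2 : M.restrict (Ici (x - T)) = M.restrict (Ioi (x - T)) :=
    Measure.restrict_congr_set (Ioi_ae_eq_Ici' (hM (by simp))).symm
  rw [hE.VNoExit_eq, hE.phiPlus_eq, hE.fluct.charFun_killed_eq_projection ha hx hE.killed, h1, h2]

lemma hasDerivAt_H (hE : IsExitLaws P lam p q c s F W X θ x T LP LM G U) (hx : 0 < x) (hxT : x < T)
    {z : ℝ} (hz1 : x - T < z) (hz2 : z < x) (hz0 : z ≠ 0)
    (hdiff : z < 0 → DifferentiableAt ℝ (PMinus P W X θ) z)
    (hatom : (∀ y : ℝ, F {y} = 0) ∨ ContinuousAt (PMinus P W X θ) (z - x)) :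
    HasDerivAt (H P W X θ T x) (h P c s W X θ T x z) z := by
  have := hE.finite_killed
  have := hE.fluct.prob_inf
  rw [hE.PMinus_eq] at hdiff hatom
  have hH : H P W X θ T x
      = fun w => (ENNReal.ofReal (1 - lam / (lam + s)) • G).real (Iio w) := by
    ext w
    exact hE.measure_inter_noExit measurableSet_Iio
  rw [hH, hE.h_eq]
  refine hE.fluct.hasDerivAt_killed (by linarith) hx hE.killed hz1 hz2 hz0 hdiff ?_
  rcases hatom with h | h
  · exact hE.fluct.inf_singleton h (by linarith)
  · exact measure_singleton_eq_zero_of_continuousAt LM h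

lemma pMinus_mul_pPlus (hE : IsExitLaws P lam p q c s F W X θ x T LP LM G U) :
    pMinus P W X θ * pPlus P W X θ = 1 - lam / (lam + s) := by
  rw [hE.pMinus_eq, hE.pPlus_eq, hE.fluct.inf_mul_sup]

/-- ξ(θ) is distributed as the sum of an independent maximum and minimum, and the exponential part
of the maximum destroys every atom except the product of the two atoms at 0. -/
lemma measure_xi_eq_zero (hE : IsExitLaws P lam p q c s F W X θ x T LP LM G U) :
    P.real {ω | xi W X (θ ω) ω = 0} = pMinus P W X θ * pPlus P W X θ := by
  have := hE.finite_free
  have h : P.real {ω | xi W X (θ ω) ω = 0} = (P.map fun ω => xi W X (θ ω) ω).real {0} := by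
    rw [map_measureReal_apply_of_aemeasurable hE.aemeasurable_xi (measurableSet_singleton 0)]
    rfl
  rw [h, hE.map_xi, hE.fluct.eq_conv_of_killed_univ hE.free, hE.fluct.conv_singleton_zero,
    hE.pMinus_eq, hE.pPlus_eq, mul_comm]

/-- The term δ₀ in the equation of G already gives the killed law mass 1 - r at 0, and this is the
whole of P{ξ(θ) = 0}. -/
lemma measure_xi_eq_zero_inter [IsFiniteMeasure P]
    (hE : IsExitLaws P lam p q c s F W X θ x T LP LM G U) :
    P.real ({ω | xi W X (θ ω) ω = 0} ∩ noExit W X θ x T) = P.real {ω | xi W X (θ ω) ω = 0} := by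
  have := hE.finite_killed
  refine le_antisymm (measureReal_mono inter_subset_left) ?_
  have hr := hE.fluct.r_lt_one
  have h1 := hE.measure_inter_noExit (measurableSet_singleton 0)
  simp only [mem_singleton_iff] at h1
  rw [h1, hE.measure_xi_eq_zero, hE.pMinus_mul_pPlus, measureReal_ennreal_smul_apply,
    ENNReal.toReal_ofReal (by linarith)]
  refine le_mul_of_one_le_right (by linarith) ?_
  have h2 : (1 : ℝ≥0∞) ≤ G {0} := by
    rw [hE.killed]
    simp
  rw [measureReal_def, ← ENNReal.toReal_one]
  exact ENNReal.toReal_mono (by finiteness) h2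

end IsExitLaws

end ExitProblem

end

/-! ### The theorem. -/

open ExitProblem in
theorem theorem2 {Ω : Type*} [MeasurableSpace Ω] (P : Measure Ω) [IsProbabilityMeasure P]
    (lam p q c s : ℝ) (hlam : 0 < lam) (hp : 0 ≤ p) (hq : 0 ≤ q) (hpq : p + q = 1)
    (hc : 0 < c) (hs : 0 < s)
    (F : Measure ℝ) [IsProbabilityMeasure F] (hF : F (Ici 0) = 0)
    (W X : ℕ → Ω → ℝ) (θ : Ω → ℝ) (hmodel : IsModel P lam p q c s F W X θ)
    (x T : ℝ) (hx : 0 < x) (hxT : x < T) :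
    -- the transforms of the upper exit time with the overshoot and with the position
    (∀ α : ℝ,
      VOvershoot P W X s α x T = c / (c - Complex.I * α) * (QT P W X s x T : ℂ) ∧
      VPosition P W X s α x T = Complex.exp (Complex.I * α * x) * VOvershoot P W X s α x T ∧
      VPosition P W X s α x T
        = c * Complex.exp (Complex.I * α * x) / (c - Complex.I * α) * (QT P W X s x T : ℂ)) ∧
    -- the transform of the position before exit, when `F` has a density
    (F ≪ volume → ∃ g : ℝ → ℂ,
      IsProjection (Ici (x - T))
        (fun α => phiMinus P W X θ α * (1 - VPosition P W X s α x T)) g ∧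
      IsProjection (Ici (x - T))
        (fun α => phiMinus P W X θ α
          * (1 - c * Complex.exp (Complex.I * α * x) / (c - Complex.I * α)
              * (QT P W X s x T : ℂ))) g ∧
      ∀ α : ℝ, VNoExit P W X θ α x T = phiPlus P W X θ α * g α) ∧
    -- the same for arbitrary `F`, with the projection of measures
    (∃ g : ℝ → ℂ,
      IsMeasureProjection (Ioi (x - T))
        (fun α => phiMinus P W X θ α * (1 - VPosition P W X s α x T)) g ∧
      IsMeasureProjection (Ioi (x - T))
        (fun α => phiMinus P W X θ α
          * (1 - c * Complex.exp (Complex.I * α * x) / (c - Complex.I * α)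
              * (QT P W X s x T : ℂ))) g ∧
      ∀ α : ℝ, VNoExit P W X θ α x T = phiPlus P W X θ α * g α) ∧
    -- the derivative of `H_s(T,x,·)`
    (∀ z : ℝ, x - T < z → z < x → z ≠ 0 →
      (z < 0 → DifferentiableAt ℝ (PMinus P W X θ) z) →
      ((∀ y : ℝ, F {y} = 0) ∨ ContinuousAt (PMinus P W X θ) (z - x)) →
      HasDerivAt (H P W X θ T x) (h P c s W X θ T x z) z) ∧
    -- the distribution is its atom at `0` plus the density, when `F` has a density
    (F ≪ volume →
      (P.restrict (noExit W X θ x T)).map (fun ω => xi W X (θ ω) ω)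
        = ENNReal.ofReal (s / (s + lam)) • Measure.dirac 0
          + (volume.restrict (Ioo (x - T) x)).withDensity
              (fun z => ENNReal.ofReal (h P c s W X θ T x z))) ∧
    -- the atom
    (P.real ({ω | xi W X (θ ω) ω = 0} ∩ noExit W X θ x T) = P.real {ω | xi W X (θ ω) ω = 0} ∧
      P.real {ω | xi W X (θ ω) ω = 0} = pMinus P W X θ * pPlus P W X θ ∧
      pMinus P W X θ * pPlus P W X θ = s / (s + lam)) := by
  obtain ⟨LP, LM, G, U, hE⟩ := exists_isExitLaws hlam hp hq hpq hc hs hF hmodel hx hxT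
  have hr : 1 - lam / (lam + s) = s / (s + lam) := by
    have : lam + s ≠ 0 := by positivity
    rw [add_comm s lam]
    field_simp
    ring
  refine ⟨fun α => ⟨hE.VOvershoot_eq hx hxT α, IsExitLaws.VPosition_eq_mul α,
    hE.VPosition_eq hx hxT α⟩, fun hFac => ?_, ?_, fun z h1 h2 h3 h4 h5 =>
    hE.hasDerivAt_H hx hxT h1 h2 h3 h4 h5, fun hFac => ?_, hE.measure_xi_eq_zero_inter,
    hE.measure_xi_eq_zero, hE.pMinus_mul_pPlus.trans hr⟩
  · obtain ⟨g, hg, hV⟩ := hE.exists_isProjection hFac hx hxT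
    exact ⟨g, hg, by rwa [hE.phiMinus_mul_eq_explicit hx hxT], hV⟩
  · obtain ⟨g, hg, hV⟩ := hE.exists_isMeasureProjection hx hxT
    exact ⟨g, hg, by rwa [hE.phiMinus_mul_eq_explicit hx hxT], hV⟩
  · have := hE.finite_killed
    rw [hE.map_xi_restrict, hE.fluct.killed_eq_dirac_add_withDensity hFac (by linarith) hx
      hE.killed, hr]
    simp_rw [hE.h_eq]
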